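/- Let $X$ be a locally compact separable metric space, $\mu$ a nonnegative Radon measure on $X$ with $\mu(U)>0$ for every nonempty open $U\subset X$, and $(\mathcal E,\mathcal F)$ a regular symmetric Dirichlet form on $L_2(X,\mu)$ without killing part (i.e. the killing measure in its Beurling–Deny decomposition is zero). Put $\mathcal C:=C_c(X)\cap\mathcal F$. For $f\in\mathcal C$ let $\Gamma(f)$ be the energy measure of $f$, i.e. the Radon measure with $\int_X\varphi\,d\Gamma(f)=\mathcal E(\varphi f,f)-\tfrac12\mathcal E(\varphi,f^2)$ for $\varphi\in\mathcal C$, and let $\Gamma(f,g)$ be the mutual energy measures obtained by polarization. Assume that $\mu$ is energy dominant, i.e. $\Gamma(f)\ll\mu$ for all $f\in\mathcal C$ (equivalently, $(\mathcal E,\mathcal F)$ admits a carré du champ). We use the natural complexifications of $\mathcal E,\mathcal F,\mathcal C,\Gamma$ and $L_2(X,\mu)$, with $\Gamma(a)=\Gamma(\operatorname{Re}a)+\Gamma(\operatorname{Im}a)$ for complex $a$, and write $\|\Gamma(a)\|_\infty$ for the $\mu$-essential supremum of the density $d\Gamma(a)/d\mu$. Let $\mathcal H$ be the Hilbert space of differential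 $1$-forms, obtained from $\mathcal C\otimes\mathcal C$ with the nonnegative definite sesquilinear form determined by $\langle a\otimes b,c\otimes d\rangle_{\mathcal H}=\int_X \bar b\,d\;d\Gamma(\bar a,c)$ by factoring out zero seminorm elements and completing (here $\Gamma(\cdot,\cdot)$ is complex bilinear). For $a\in\mathcal C$ let $\partial a=a\otimes\mathbf 1\in\mathcal H$, i.e. the element with $\langle c\otimes d,\partial a\rangle_{\mathcal H}=\int_X\bar d\,d\Gamma(\bar c,a)$ for all $c,d\in\mathcal C$; denote the closure of $\partial:\mathcal C\to\mathcal H$ as an operator from $L_2(X,\mu)$ to $\mathcal H$ again by $\partial$, and its adjoint by $\partial^*$. Let $\mathbb H:=L_2(X,\mu)\oplus\mathcal H$, and let $\mathbb D(f,\omega):=(\partial^*\omega,\partial f)$ on $\operatorname{dom}\mathbb D:=\operatorname{dom}\partial\oplus\operatorname{dom}\partial^*$. Let $$\mathbb A_0:=\{f\in\mathcal C:\Gamma(f)\in L_\infty(X,\mu)\},\qquad \mathbb A:=\operatorname{clos}_{C_0(X)}\mathbb A_0 .$$ Then the domain of the closed operator $\partial$ is $\mathcal F$, $\mathbb A_0$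 is an involutive subalgebra of $C_0(X)$ (so that $\mathbb A$ is a $C^*$-subalgebra), and the following hold. (i) There is a faithful $*$-representation $\pi$ of $\mathbb A$ on $\mathbb H$ by multiplication: for $a\in\mathbb A$ the $L_2$-component of $\pi(a)(f,\omega)$ is $af$, and for $a\in\mathbb A_0$ one has $\pi(a)(f,\omega)=(af,a\omega)$, where $a(c\otimes d)=(ac)\otimes d-a\otimes(cd)$ for $c,d\in\mathcal C$. (ii) For every $a\in\mathbb A_0$ the operator $\pi(a)$ maps $\operatorname{dom}\mathbb D$ into itself, and the commutator $[\mathbb D,\pi(a)]=\mathbb D\pi(a)-\pi(a)\mathbb D$ extends from $\operatorname{dom}\mathbb D$ to a bounded linear operator on $\mathbb H$ with $\|[\mathbb D,\pi(a)]\|^2\le\|\Gamma(a)\|_\infty$. (iii) Suppose that the $L_2(X,\mu)$-generator $L$ of $(\mathcal E,\mathcal F)$ has discrete spectrum, i.e. $L_2(X,\mu)$ has an orthonormal basis of eigenfunctions of $-L$ whose eigenvalues, counted with multiplicity, tend to infinity (no condition if the basis is finite). Then $\mathbb D$ restricted to $(\ker\mathbb D)^\perp$ has compact resolvents: for every $z\in\mathbb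 C$ which is not an eigenvalue of this restriction, $(\mathbb D-z)^{-1}$ exists and is a compact operator on $(\ker\mathbb D)^\perp$ (in particular $(1+\mathbb D)^{-1}$ is compact there whenever $-1$ is not an eigenvalue). Moreover $(\mathbb A,\mathbb H,\mathbb D)$ is a (possibly kernel degenerate) spectral triple: $\mathbb D$ is self-adjoint, $\pi$ is a faithful $*$-representation of $\mathbb A$ on $\mathbb H$, there is a dense $*$-subalgebra of $\mathbb A$ (namely $\mathbb A_0$) for whose elements $a$ the commutator $[\mathbb D,\pi(a)]$ is bounded, and $\mathbb D$ has compact resolvents on $(\ker\mathbb D)^\perp$ in the sense above. -/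

import Mathlib

open MeasureTheory Filter Topology
open scoped ENNReal TensorProduct ZeroAtInfty

/-- A symmetric Dirichlet form on `L²(X, μ)`: a nonnegative definite symmetric bilinear form on a
dense subspace of the real `L²`, closed (complete for `E₁ = E + ⟨·,·⟩`), with the Markov property. -/
structure DirichletForm {X : Type*} [MeasurableSpace X] (μ : Measure X) where
  domain : Submodule ℝ (Lp ℝ 2 μ)
  form : domain →ₗ[ℝ] domain →ₗ[ℝ] ℝ
  symm : ∀ u v, form u v = form v u
  nonneg : ∀ u, 0 ≤ form u u
  dense_domain : Dense (domain : Set (Lp ℝ 2 μ))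
  complete : ∀ u : ℕ → domain,
    (∀ ε > 0, ∃ N, ∀ m ≥ N, ∀ n ≥ N,
      form (u m - u n) (u m - u n) + ‖(u m - u n : Lp ℝ 2 μ)‖ ^ 2 < ε) →
    ∃ v : domain, Tendsto
      (fun n => form (u n - v) (u n - v) + ‖(u n - v : Lp ℝ 2 μ)‖ ^ 2) atTop (𝓝 0)
  markov : ∀ u : domain, ∃ v : domain,
    (v : Lp ℝ 2 μ) =ᵐ[μ] (fun x => min (max 0 ((u : Lp ℝ 2 μ) x)) 1) ∧ form v v ≤ form u u

namespace DirichletForm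

section Closedness

variable {X : Type*} [MeasurableSpace X] {μ : Measure X} (E : DirichletForm μ)

/-- `E₁(u) = E(u, u) + ‖u‖²`. -/
noncomputable def energyOne (u : E.domain) : ℝ := E.form u u + ‖(u : Lp ℝ 2 μ)‖ ^ 2

lemma form_parallelogram (u v : E.domain) :
    E.form (u + v) (u + v) + E.form (u - v) (u - v) = 2 * E.form u u + 2 * E.form v v := by
  simp only [map_add, map_sub, LinearMap.add_apply, LinearMap.sub_apply]; ring

lemma energyOne_parallelogram (u v : E.domain) :
    E.energyOne (u + v) + E.energyOne (u - v) = 2 * E.energyOne u + 2 * E.energyOne v := by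
  have h1 := E.form_parallelogram u v
  have h2 := parallelogram_law_with_norm ℝ (u : Lp ℝ 2 μ) (v : Lp ℝ 2 μ)
  simp only [energyOne, Submodule.coe_add, Submodule.coe_sub]
  nlinarith

lemma energyOne_nonneg (u : E.domain) : 0 ≤ E.energyOne u :=
  add_nonneg (E.nonneg u) (sq_nonneg _)

lemma form_half (u : E.domain) : E.form ((1 / 2 : ℝ) • u) ((1 / 2 : ℝ) • u) = E.form u u / 4 := by
  simp only [map_smul, LinearMap.smul_apply, smul_eq_mul]; ring

lemma energyOne_half (u : E.domain) : E.energyOne ((1 / 2 : ℝ) • u) = E.energyOne u / 4 := by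
  simp only [energyOne, form_half, Submodule.coe_smul, norm_smul, mul_pow]
  norm_num; ring

lemma form_cauchy (u v : E.domain) : E.form u v ^ 2 ≤ E.form u u * E.form v v := by
  have h : ∀ t : ℝ, 0 ≤ E.form v v * (t * t) + (2 * E.form u v) * t + E.form u u := by
    intro t
    have := E.nonneg (u + t • v)
    simp only [map_add, map_smul, LinearMap.add_apply, LinearMap.smul_apply, smul_eq_mul,
      E.symm v u] at this
    nlinarith
  have := discrim_le_zero h
  unfold discrim at this
  nlinarith

/-- Lower semicontinuity of the energy with respect to `L²` convergence. -/
lemma mem_of_approx (w : Lp ℝ 2 μ) (M : ℝ)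
    (h : ∀ r > 0, ∃ v : E.domain, ‖(v : Lp ℝ 2 μ) - w‖ ≤ r ∧ E.form v v ≤ M) :
    ∃ hw : w ∈ E.domain, E.form ⟨w, hw⟩ ⟨w, hw⟩ ≤ M := by
  classical
  set r : ℕ → ℝ := fun n => 1 / ((n : ℝ) + 1) with hr
  have hr0 : ∀ n, 0 < r n := fun n => by positivity
  have hr1 : ∀ n, r n ≤ 1 := fun n => by
    rw [hr]; simp only; rw [div_le_one (by positivity)]; simp
  have hrlim : Tendsto r atTop (𝓝 0) := tendsto_one_div_add_atTop_nhds_zero_nat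
  have hranti : Antitone r := by
    intro m n hmn
    simp only [hr]
    apply one_div_le_one_div_of_le (by positivity)
    have : (m : ℝ) ≤ n := by exact_mod_cast hmn
    linarith
  set K : ℕ → Set E.domain := fun n => {v | ‖(v : Lp ℝ 2 μ) - w‖ ≤ r n ∧ E.form v v ≤ M} with hK
  have hKne : ∀ n, (K n).Nonempty := fun n => h _ (hr0 n)
  have hKanti : ∀ m n, m ≤ n → K n ⊆ K m := fun m n hmn v hv => ⟨hv.1.trans (hranti hmn), hv.2⟩
  have hKmid : ∀ n, ∀ u ∈ K n, ∀ v ∈ K n, (1 / 2 : ℝ) • (u + v) ∈ K n := by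
    intro n u hu v hv
    constructor
    · have : (((1 / 2 : ℝ) • (u + v) : E.domain) : Lp ℝ 2 μ) - w
          = (1 / 2 : ℝ) • (((u : Lp ℝ 2 μ) - w) + ((v : Lp ℝ 2 μ) - w)) := by
        simp only [Submodule.coe_smul, Submodule.coe_add]
        module
      rw [this, norm_smul]
      have := norm_add_le ((u : Lp ℝ 2 μ) - w) ((v : Lp ℝ 2 μ) - w)
      have h1 := hu.1
      have h2 := hv.1
      norm_num
      linarith
    · rw [form_half]
      have h1 := E.form_parallelogram u v
      have h2 := E.nonneg (u - v)
      have := hu.2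
      have := hv.2
      linarith
  set m : ℕ → ℝ := fun n => sInf (E.energyOne '' K n) with hm
  have hbdd : ∀ n, BddBelow (E.energyOne '' K n) := fun n =>
    ⟨0, by rintro _ ⟨v, -, rfl⟩; exact E.energyOne_nonneg v⟩
  have hmle : ∀ n, ∀ v ∈ K n, m n ≤ E.energyOne v := fun n v hv =>
    csInf_le (hbdd n) ⟨v, hv, rfl⟩
  have hex : ∀ n, ∃ v ∈ K n, E.energyOne v < m n + r n := by
    intro n
    obtain ⟨_, ⟨v, hv, rfl⟩, hlt⟩ :=
      exists_lt_of_csInf_lt ((hKne n).image E.energyOne) (lt_add_of_pos_right (m n) (hr0 n))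
    exact ⟨v, hv, hlt⟩
  choose u huK hu using hex
  have hmmono : Monotone m := fun i j hij =>
    csInf_le_csInf (hbdd i) ((hKne j).image _) (Set.image_mono (hKanti i j hij))
  have hmbdd : BddAbove (Set.range m) := by
    refine ⟨M + (‖w‖ + 1) ^ 2, ?_⟩
    rintro _ ⟨n, rfl⟩
    refine (hmle n _ (huK n)).trans ?_
    have h1 := (huK n).2
    have h2 : ‖((u n : E.domain) : Lp ℝ 2 μ)‖ ≤ ‖w‖ + 1 := by
      have := norm_le_norm_add_norm_sub' ((u n : E.domain) : Lp ℝ 2 μ) w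
      have := (huK n).1
      have := hr1 n
      linarith
    have h3 : ‖((u n : E.domain) : Lp ℝ 2 μ)‖ ^ 2 ≤ (‖w‖ + 1) ^ 2 := by gcongr
    simp only [energyOne]; linarith
  have hmlim : Tendsto m atTop (𝓝 (⨆ n, m n)) := tendsto_atTop_ciSup hmmono hmbdd
  have hkey : ∀ k i, k ≤ i → E.energyOne (u i - u k) ≤ 2 * (m i + r i) + 2 * (m k + r k) - 4 * m k := by
    intro k i hki
    have h1 := E.energyOne_parallelogram (u i) (u k)
    have h2 := hmle k _ (hKmid k _ (hKanti k i hki (huK i)) _ (huK k))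
    rw [energyOne_half] at h2
    have h3 := (hu i).le
    have h4 := (hu k).le
    linarith
  have hsymm : ∀ a b : E.domain, E.energyOne (a - b) = E.energyOne (b - a) := by
    intro a b
    have : a - b = -(b - a) := by abel
    rw [this]
    simp [energyOne, norm_sub_rev]
    ring
  obtain ⟨v, hv⟩ := E.complete u (by
    intro ε hε
    set l := ⨆ n, m n
    have e1 : ∀ᶠ n in atTop, l - ε / 16 < m n := hmlim.eventually_const_lt (by linarith)
    have e2 : ∀ᶠ n in atTop, r n < ε / 16 := hrlim.eventually_lt_const (by linarith)
    obtain ⟨N, hN⟩ := eventually_atTop.1 (e1.and e2)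
    have hml : ∀ n, m n ≤ l := fun n => le_ciSup hmbdd n
    have claim : ∀ k i, N ≤ k → k ≤ i → E.energyOne (u i - u k) < ε := by
      intro k i hk hki
      have := hkey k i hki
      have := (hN k hk).1
      have := (hN k hk).2
      have := (hN i (hk.trans hki)).2
      have := hml i
      linarith
    refine ⟨N, fun a ha b hb => ?_⟩
    change E.energyOne (u a - u b) < ε
    rcases le_total a b with hab | hab
    · rw [hsymm]; exact claim a b ha hab
    · exact claim b a hb hab)
  have hv1 : Tendsto (fun n => ‖((u n - v : E.domain) : Lp ℝ 2 μ)‖ ^ 2) atTop (𝓝 0) := by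
    refine squeeze_zero (fun n => sq_nonneg _) (fun n => ?_) hv
    have := E.nonneg (u n - v)
    simp only [Submodule.coe_sub]
    linarith
  have hv2 : Tendsto (fun n => E.form (u n - v) (u n - v)) atTop (𝓝 0) := by
    refine squeeze_zero (fun n => E.nonneg _) (fun n => ?_) hv
    have := sq_nonneg ‖((u n - v : E.domain) : Lp ℝ 2 μ)‖
    simp only [Submodule.coe_sub] at this ⊢
    linarith
  have hvw : (v : Lp ℝ 2 μ) = w := by
    have t1 : Tendsto (fun n => ((u n : E.domain) : Lp ℝ 2 μ)) atTop (𝓝 w) := by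
      rw [tendsto_iff_norm_sub_tendsto_zero]
      exact squeeze_zero (fun n => norm_nonneg _) (fun n => (huK n).1) hrlim
    have t2 : Tendsto (fun n => ((u n : E.domain) : Lp ℝ 2 μ)) atTop (𝓝 (v : Lp ℝ 2 μ)) := by
      rw [tendsto_iff_norm_sub_tendsto_zero]
      have := hv1.sqrt
      simpa [Real.sqrt_sq] using this
    exact tendsto_nhds_unique t2 t1
  have hfv : E.form v v ≤ M := by
    -- `√E(v) ≤ √E(u n) + √E(u n - v)` in the limit, through Young's inequality
    by_contra hcon
    push Not at hcon
    have hM : 0 ≤ M := (E.nonneg _).trans (huK 0).2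
    have hlim : Tendsto (fun n => 2 * E.form v (u n - v)) atTop (𝓝 0) := by
      have h0 : Tendsto (fun n => E.form v (u n - v) ^ 2) atTop (𝓝 0) := by
        refine squeeze_zero (fun n => sq_nonneg _) (fun n => E.form_cauchy v (u n - v)) ?_
        simpa using hv2.const_mul (E.form v v)
      have h1 : Tendsto (fun n => |E.form v (u n - v)|) atTop (𝓝 0) := by
        have := h0.sqrt
        simpa [Real.sqrt_sq_eq_abs] using this
      have h2 := (tendsto_zero_iff_abs_tendsto_zero _).2 h1
      simpa using h2.const_mul 2
    have : ∀ n, E.form v v + 2 * E.form v (u n - v) ≤ M := by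
      intro n
      have h1 := (huK n).2
      have h2 := E.nonneg (u n - v)
      have h3 : E.form (u n) (u n)
          = E.form v v + 2 * E.form v (u n - v) + E.form (u n - v) (u n - v) := by
        simp only [map_sub, LinearMap.sub_apply, E.symm (u n) v]; ring
      linarith
    have := le_of_tendsto (by simpa using hlim.const_add (E.form v v)) (Eventually.of_forall this)
    linarith
  subst hvw
  exact ⟨v.2, hfv⟩

/-- `u` agrees a.e. with an element of the domain of energy at most `c²`. -/
def EnergyLE (u : X → ℝ) (c : ℝ) : Prop :=
  0 ≤ c ∧ ∃ v : E.domain, (v : Lp ℝ 2 μ) =ᵐ[μ] u ∧ E.form v v ≤ c ^ 2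

variable {E}

lemma EnergyLE.add {u v : X → ℝ} {c d : ℝ} (hu : E.EnergyLE u c) (hv : E.EnergyLE v d) :
    E.EnergyLE (fun x => u x + v x) (c + d) := by
  obtain ⟨hc, a, ha, ha'⟩ := hu
  obtain ⟨hd, b, hb, hb'⟩ := hv
  refine ⟨add_nonneg hc hd, a + b, ?_, ?_⟩
  · filter_upwards [ha, hb, Lp.coeFn_add (a : Lp ℝ 2 μ) b] with x h1 h2 h3
    simp only [Submodule.coe_add, h3, Pi.add_apply, h1, h2]
  · have h1 := E.form_cauchy a b
    have h2 : E.form a b ≤ c * d := by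
      refine abs_le_of_sq_le_sq' (h1.trans ?_) (mul_nonneg hc hd) |>.2
      rw [mul_pow]
      exact mul_le_mul ha' hb' (E.nonneg _) (sq_nonneg _)
    simp only [map_add, LinearMap.add_apply, E.symm b a]
    nlinarith

lemma EnergyLE.smul {u : X → ℝ} {c : ℝ} (t : ℝ) (hu : E.EnergyLE u c) :
    E.EnergyLE (fun x => t * u x) (|t| * c) := by
  obtain ⟨hc, a, ha, ha'⟩ := hu
  refine ⟨mul_nonneg (abs_nonneg _) hc, t • a, ?_, ?_⟩
  · filter_upwards [ha, Lp.coeFn_smul t (a : Lp ℝ 2 μ)] with x h1 h2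
    simp only [Submodule.coe_smul, h2, Pi.smul_apply, h1, smul_eq_mul]
  · simp only [map_smul, LinearMap.smul_apply, smul_eq_mul, mul_pow, sq_abs]
    nlinarith [sq_nonneg t]

lemma EnergyLE.congr {u v : X → ℝ} {c : ℝ} (hu : E.EnergyLE u c) (h : ∀ x, u x = v x) :
    E.EnergyLE v c := by
  have : u = v := funext h
  exact this ▸ hu

lemma EnergyLE.zero : E.EnergyLE (fun _ => 0) 0 := by
  refine ⟨le_rfl, 0, ?_, by simp⟩
  exact Lp.coeFn_zero ℝ 2 μ

lemma EnergyLE.sum {ι : Type*} (s : Finset ι) {u : ι → X → ℝ} {c : ι → ℝ}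
    (hu : ∀ i ∈ s, E.EnergyLE (u i) (c i)) :
    E.EnergyLE (fun x => ∑ i ∈ s, u i x) (∑ i ∈ s, c i) := by
  classical
  induction s using Finset.induction_on with
  | empty => simpa using EnergyLE.zero
  | insert a s ha ih =>
    have h1 := hu a (by simp)
    have h2 := ih fun i hi => hu i (by simp [hi])
    have := h1.add h2
    rw [Finset.sum_insert ha]
    exact this.congr fun x => by rw [Finset.sum_insert ha]

lemma EnergyLE.clip {u : X → ℝ} {c t : ℝ} (ht : 0 < t) (hu : E.EnergyLE u c) :
    E.EnergyLE (fun x => min (max 0 (u x)) t) c := by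
  obtain ⟨hc, a, ha, ha'⟩ := hu.smul t⁻¹
  obtain ⟨b, hb, hb'⟩ := E.markov a
  have hb2 : E.EnergyLE (fun x => min (max 0 (t⁻¹ * u x)) 1) (|t⁻¹| * c) := by
    refine ⟨hc, b, ?_, hb'.trans ha'⟩
    filter_upwards [ha, hb] with x h1 h2
    rw [h2, h1]
  have := hb2.smul t
  have hcc : |t| * (|t⁻¹| * c) = c := by
    rw [← mul_assoc, ← abs_mul, mul_inv_cancel₀ ht.ne']; simp
  rw [hcc] at this
  refine this.congr fun x => ?_
  rw [mul_min_of_nonneg _ _ ht.le, mul_max_of_nonneg _ _ ht.le, ← mul_assoc,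
    mul_inv_cancel₀ ht.ne']
  simp

/-- Riemann sums for `y² / 2 = ∫ (y - t)⁺ dt`. -/
lemma riemann_sq (δ : ℝ) (hδ : 0 < δ) (n : ℕ) : ∀ y : ℝ, 0 ≤ y → y ≤ n * δ →
    0 ≤ y ^ 2 - ∑ k ∈ Finset.range n, 2 * δ * (y - min y ((k + 1 : ℕ) * δ)) ∧
    y ^ 2 - ∑ k ∈ Finset.range n, 2 * δ * (y - min y ((k + 1 : ℕ) * δ)) ≤ δ * y := by
  induction n with
  | zero =>
    intro y h1 h2
    have : y = 0 := by simp at h2; linarith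
    simp [this]
  | succ n ih =>
    intro y h1 h2
    rcases le_total y δ with h | h
    · have : ∑ k ∈ Finset.range (n + 1), 2 * δ * (y - min y ((k + 1 : ℕ) * δ)) = 0 := by
        refine Finset.sum_eq_zero fun k _ => ?_
        have : y ≤ ((k + 1 : ℕ) : ℝ) * δ := by
          push_cast
          have : (0 : ℝ) ≤ k * δ := by positivity
          linarith
        rw [min_eq_left this]; ring
      rw [this]
      constructor <;> nlinarith
    · have h3 := ih (y - δ) (by linarith) (by push_cast at h2; linarith)
      rw [Finset.sum_range_succ']
      have e0 : min y (((0 + 1 : ℕ) : ℝ) * δ) = δ := by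
        rw [min_eq_right]; · simp
        · simpa using h
      have e1 : ∀ k ∈ Finset.range n, 2 * δ * (y - min y ((k + 1 + 1 : ℕ) * δ))
          = 2 * δ * ((y - δ) - min (y - δ) ((k + 1 : ℕ) * δ)) := by
        intro k _
        have : min y ((k + 1 + 1 : ℕ) * δ) = min (y - δ) ((k + 1 : ℕ) * δ) + δ := by
          rw [← min_add_add_right]; congr 1 <;> push_cast <;> ring
        rw [this]; ring
      rw [Finset.sum_congr rfl e1, e0]
      constructor <;> nlinarith [h3.1, h3.2]

lemma EnergyLE.sq_of_nonneg {u : X → ℝ} {c M : ℝ} (hu : E.EnergyLE u c) (hM : 0 < M)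
    (h0 : ∀ x, 0 ≤ u x) (h1 : ∀ x, u x ≤ M) :
    E.EnergyLE (fun x => u x ^ 2) (4 * M * c) := by
  have hc := hu.1
  obtain ⟨-, a, ha, -⟩ := id hu
  have hmem : MemLp u 2 μ := (memLp_congr_ae ha).1 (Lp.memLp (a : Lp ℝ 2 μ))
  have hmem2 : MemLp (fun x => u x ^ 2) 2 μ := by
    refine MemLp.of_le_mul (c := M) hmem (hmem.1.pow 2) (Eventually.of_forall fun x => ?_)
    rw [Real.norm_of_nonneg (sq_nonneg _), Real.norm_of_nonneg (h0 x), sq]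
    exact mul_le_mul_of_nonneg_right (h1 x) (h0 x)
  have key := E.mem_of_approx (hmem2.toLp _) ((4 * M * c) ^ 2) (by
    intro r hr
    obtain ⟨n, hn⟩ := exists_nat_gt (M * ‖hmem.toLp u‖ / r)
    have hn0 : (0 : ℝ) < n := lt_of_le_of_lt (by positivity) hn
    have hn1 : 0 < n := by exact_mod_cast hn0
    set δ : ℝ := M / n with hδ
    have hδ0 : 0 < δ := by positivity
    have hsum : E.EnergyLE (fun x => ∑ k ∈ Finset.range n,
        2 * δ * (u x + (-1) * min (max 0 (u x)) ((k + 1 : ℕ) * δ)))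
        (∑ k ∈ Finset.range n, |2 * δ| * (c + |(-1 : ℝ)| * c)) := by
      refine EnergyLE.sum _ fun k _ => ?_
      exact (hu.add ((hu.clip (t := ((k + 1 : ℕ) : ℝ) * δ) (by positivity)).smul (-1))).smul (2 * δ)
    have hc2 : (∑ k ∈ Finset.range n, |2 * δ| * (c + |(-1 : ℝ)| * c)) = 4 * M * c := by
      rw [Finset.sum_const, Finset.card_range, abs_of_pos (by positivity), abs_neg, abs_one, hδ,
        nsmul_eq_mul]
      field_simp; ring
    rw [hc2] at hsum
    obtain ⟨-, v, hv, hv'⟩ := hsum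
    refine ⟨v, ?_, hv'⟩
    have : ‖(v : Lp ℝ 2 μ) - hmem2.toLp _‖ ≤ δ * ‖hmem.toLp u‖ := by
      refine Lp.norm_le_mul_norm_of_ae_le_mul ?_
      filter_upwards [hv, hmem2.coeFn_toLp, hmem.coeFn_toLp,
        Lp.coeFn_sub (v : Lp ℝ 2 μ) (hmem2.toLp _)] with x e1 e2 e3 e4
      rw [e4, Pi.sub_apply, e1, e2, e3]
      have := riemann_sq δ hδ0 n (u x) (h0 x) (by
        rw [hδ]; field_simp; exact h1 x)
      have e5 : ∑ k ∈ Finset.range n,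
          2 * δ * (u x + (-1) * min (max 0 (u x)) ((k + 1 : ℕ) * δ))
          = ∑ k ∈ Finset.range n, 2 * δ * (u x - min (u x) ((k + 1 : ℕ) * δ)) := by
        refine Finset.sum_congr rfl fun k _ => ?_
        rw [max_eq_right (h0 x)]; ring
      rw [e5, Real.norm_eq_abs, abs_sub_comm, abs_of_nonneg this.1, Real.norm_of_nonneg (h0 x)]
      exact this.2
    refine this.trans ?_
    rw [div_lt_iff₀ hr] at hn
    rw [hδ, div_mul_eq_mul_div, div_le_iff₀ hn0]
    linarith)
  obtain ⟨hw, hle⟩ := key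
  exact ⟨by positivity, ⟨_, hw⟩, hmem2.coeFn_toLp, hle⟩

lemma EnergyLE.sq {u : X → ℝ} {c M : ℝ} (hu : E.EnergyLE u c) (hM : 0 < M)
    (h1 : ∀ x, |u x| ≤ M) : ∃ d, E.EnergyLE (fun x => u x ^ 2) d := by
  have hp := (hu.clip hM).sq_of_nonneg hM (fun x => by positivity) (fun x => min_le_right _ _)
  have hm := ((hu.smul (-1)).clip hM).sq_of_nonneg hM (fun x => by positivity)
    (fun x => min_le_right _ _)
  refine ⟨_, (hp.add hm).congr fun x => ?_⟩
  have h2 := abs_le.1 (h1 x)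
  rcases le_total 0 (u x) with h | h
  · rw [max_eq_right h, min_eq_left h2.2, max_eq_left (by linarith), min_eq_left hM.le]; ring
  · rw [max_eq_left h, min_eq_left hM.le, max_eq_right (by linarith), min_eq_left (by linarith)]
    ring

lemma EnergyLE.mul {u v : X → ℝ} {c d M : ℝ} (hu : E.EnergyLE u c) (hv : E.EnergyLE v d)
    (hM : 0 < M) (hu1 : ∀ x, |u x| ≤ M) (hv1 : ∀ x, |v x| ≤ M) :
    ∃ e, E.EnergyLE (fun x => u x * v x) e := by
  obtain ⟨d1, h1⟩ := hu.sq hM hu1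
  obtain ⟨d2, h2⟩ := hv.sq hM hv1
  obtain ⟨d3, h3⟩ := (hu.add hv).sq (M := M + M) (by positivity)
    (fun x => (abs_add_le _ _).trans (add_le_add (hu1 x) (hv1 x)))
  refine ⟨_, ((h3.add (h1.smul (-1))).add (h2.smul (-1))).smul (1 / 2) |>.congr fun x => ?_⟩
  ring

variable (E)

/-- The domain with the inner product `E / β + ⟨·,·⟩`. -/
def FormSpace (E : DirichletForm μ) (_β : Set.Ioi (0 : ℝ)) : Type _ := E.domain

noncomputable instance (β : Set.Ioi (0 : ℝ)) : AddCommGroup (E.FormSpace β) :=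
  inferInstanceAs (AddCommGroup E.domain)

noncomputable instance (β : Set.Ioi (0 : ℝ)) : Module ℝ (E.FormSpace β) :=
  inferInstanceAs (Module ℝ E.domain)

/-- The identity map from `FormSpace` to the domain. -/
noncomputable def ofFormSpace (β : Set.Ioi (0 : ℝ)) : E.FormSpace β ≃ₗ[ℝ] E.domain :=
  LinearEquiv.refl ℝ E.domain

/-- The inner product `E / β + ⟨·,·⟩` on the domain. -/
noncomputable abbrev formSpaceCore (β : Set.Ioi (0 : ℝ)) :
    InnerProductSpace.Core ℝ (E.FormSpace β) where
  inner u v := E.form (E.ofFormSpace β u) (E.ofFormSpace β v) / β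
    + inner ℝ (E.ofFormSpace β u : Lp ℝ 2 μ) (E.ofFormSpace β v : Lp ℝ 2 μ)
  conj_inner_symm u v := by
    simp only [conj_trivial]
    rw [E.symm, real_inner_comm]
  re_inner_nonneg u := by
    simp only [RCLike.re_to_real]
    exact add_nonneg (div_nonneg (E.nonneg _) (le_of_lt β.2)) real_inner_self_nonneg
  add_left u v w := by
    simp only [map_add, LinearMap.add_apply, Submodule.coe_add, inner_add_left]
    ring
  smul_left u v r := by
    simp only [map_smul, LinearMap.smul_apply, Submodule.coe_smul, real_inner_smul_left,
      smul_eq_mul, conj_trivial]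
    ring
  definite u hu := by
    have h1 : 0 ≤ E.form (E.ofFormSpace β u) (E.ofFormSpace β u) / β :=
      div_nonneg (E.nonneg _) (le_of_lt β.2)
    have h2 : 0 ≤ inner ℝ (E.ofFormSpace β u : Lp ℝ 2 μ) (E.ofFormSpace β u : Lp ℝ 2 μ) :=
      real_inner_self_nonneg
    have h3 : inner ℝ (E.ofFormSpace β u : Lp ℝ 2 μ) (E.ofFormSpace β u : Lp ℝ 2 μ) = 0 := by
      linarith
    exact (E.ofFormSpace β).map_eq_zero_iff.1 (Subtype.ext (inner_self_eq_zero.1 h3))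

noncomputable instance (β : Set.Ioi (0 : ℝ)) : NormedAddCommGroup (E.FormSpace β) :=
  (E.formSpaceCore β).toNormedAddCommGroup

noncomputable instance (β : Set.Ioi (0 : ℝ)) : InnerProductSpace ℝ (E.FormSpace β) :=
  InnerProductSpace.ofCore (E.formSpaceCore β).toCore

lemma formSpace_norm_sq (β : Set.Ioi (0 : ℝ)) (u : E.FormSpace β) :
    ‖u‖ ^ 2 = E.form (E.ofFormSpace β u) (E.ofFormSpace β u) / β
      + ‖(E.ofFormSpace β u : Lp ℝ 2 μ)‖ ^ 2 := by
  rw [← real_inner_self_eq_norm_sq, ← real_inner_self_eq_norm_sq]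
  rfl

instance (β : Set.Ioi (0 : ℝ)) : CompleteSpace (E.FormSpace β) := by
  have hβ : (0 : ℝ) < β := β.2
  refine Metric.complete_of_cauchySeq_tendsto fun u hu => ?_
  set C : ℝ := max β 1 with hC
  have hC1 : 1 ≤ C := le_max_right _ _
  have hCβ : (β : ℝ) ≤ C := le_max_left _ _
  obtain ⟨v, hv⟩ := E.complete (fun n => E.ofFormSpace β (u n)) (by
    intro ε hε
    obtain ⟨N, hN⟩ := Metric.cauchySeq_iff.1 hu (Real.sqrt (ε / C)) (by positivity)
    refine ⟨N, fun m hm n hn => ?_⟩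
    have h1 := hN m hm n hn
    rw [dist_eq_norm, Real.lt_sqrt (norm_nonneg _), formSpace_norm_sq,
      lt_div_iff₀ (by positivity)] at h1
    rw [← Submodule.coe_sub, ← map_sub]
    refine lt_of_le_of_lt ?_ h1
    have h4 := E.nonneg (E.ofFormSpace β (u m - u n))
    rw [add_mul]
    refine add_le_add ?_ ?_
    · rw [div_mul_eq_mul_div, le_div_iff₀ hβ]
      exact mul_le_mul_of_nonneg_left hCβ h4
    · exact le_mul_of_one_le_right (sq_nonneg _) hC1)
  refine ⟨(E.ofFormSpace β).symm v, ?_⟩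
  rw [tendsto_iff_norm_sub_tendsto_zero]
  have hlim : Tendsto (fun n => ‖u n - (E.ofFormSpace β).symm v‖ ^ 2) atTop (𝓝 0) := by
    have h0 := hv.const_mul (max (1 / (β : ℝ)) 1)
    rw [mul_zero] at h0
    refine squeeze_zero (fun n => sq_nonneg _) (fun n => ?_) h0
    have h4 := E.nonneg (E.ofFormSpace β (u n) - v)
    rw [formSpace_norm_sq, map_sub, LinearEquiv.apply_symm_apply, mul_add, ← Submodule.coe_sub]
    refine add_le_add ?_ ?_
    · rw [div_eq_inv_mul, ← one_div]
      exact mul_le_mul_of_nonneg_right (le_max_left _ _) h4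
    · exact le_mul_of_one_le_left (sq_nonneg _) (le_max_right _ _)
  have := hlim.sqrt
  simpa [Real.sqrt_sq] using this

/-- The (normalised) resolvent `S = β (β - L)⁻¹`. -/
lemma exists_resolvent (β : ℝ) (hβ : 0 < β) : ∃ S : Lp ℝ 2 μ →ₗ[ℝ] E.domain,
    ∀ f v, E.form (S f) v = β * inner ℝ (f - (S f : Lp ℝ 2 μ)) (v : Lp ℝ 2 μ) := by
  set b : Set.Ioi (0 : ℝ) := ⟨β, hβ⟩
  let J0 : E.FormSpace b →ₗ[ℝ] Lp ℝ 2 μ := E.domain.subtype ∘ₗ (E.ofFormSpace b).toLinearMap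
  let J : E.FormSpace b →L[ℝ] Lp ℝ 2 μ := J0.mkContinuous 1 (by
    intro u
    rw [one_mul]
    refine abs_le_of_sq_le_sq' ?_ (norm_nonneg _) |>.2
    rw [formSpace_norm_sq]
    exact le_add_of_nonneg_left (div_nonneg (E.nonneg _) hβ.le))
  let S : Lp ℝ 2 μ →ₗ[ℝ] E.domain :=
    (E.ofFormSpace b).toLinearMap ∘ₗ (J.adjoint : Lp ℝ 2 μ →ₗ[ℝ] E.FormSpace b)
  refine ⟨S, fun f v => ?_⟩
  have h : inner ℝ (J.adjoint f) ((E.ofFormSpace b).symm v)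
      = inner ℝ f (J ((E.ofFormSpace b).symm v)) :=
    ContinuousLinearMap.adjoint_inner_left J _ f
  have h' : E.form (S f) v / β + inner ℝ (S f : Lp ℝ 2 μ) (v : Lp ℝ 2 μ)
      = inner ℝ f (v : Lp ℝ 2 μ) := h
  rw [inner_sub_left, ← h']
  field_simp
  ring

variable {E} {β : ℝ} {S : Lp ℝ 2 μ →ₗ[ℝ] E.domain}

lemma resolvent_markov (hβ : 0 < β)
    (hS : ∀ f v, E.form (S f) v = β * inner ℝ (f - (S f : Lp ℝ 2 μ)) (v : Lp ℝ 2 μ))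
    (f : Lp ℝ 2 μ) (hf : ∀ᵐ x ∂μ, 0 ≤ f x ∧ f x ≤ 1) :
    ∀ᵐ x ∂μ, 0 ≤ (S f : Lp ℝ 2 μ) x ∧ (S f : Lp ℝ 2 μ) x ≤ 1 := by
  obtain ⟨w, hw, hle⟩ := E.markov (S f)
  have h1 := hS f (w - S f)
  have h2 : ‖(w : Lp ℝ 2 μ) - f‖ ≤ ‖(S f : Lp ℝ 2 μ) - f‖ := by
    refine Lp.norm_le_norm_of_ae_le ?_
    filter_upwards [hw, hf, Lp.coeFn_sub (w : Lp ℝ 2 μ) f,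
      Lp.coeFn_sub (S f : Lp ℝ 2 μ) f] with x e1 e2 e3 e4
    rw [e3, e4, Pi.sub_apply, Pi.sub_apply, e1, Real.norm_eq_abs, Real.norm_eq_abs]
    set y := (S f : Lp ℝ 2 μ) x
    rcases le_total 0 y with h | h
    · rw [max_eq_right h]
      rcases le_total y 1 with h' | h'
      · rw [min_eq_left h']
      · rw [min_eq_right h', abs_of_nonneg (by linarith), abs_of_nonneg (by linarith)]
        linarith
    · rw [max_eq_left h, min_eq_left zero_le_one, abs_of_nonpos (by linarith),
        abs_of_nonpos (by linarith)]
      linarith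
  have h3 : ‖(w : Lp ℝ 2 μ) - f‖ ^ 2 ≤ ‖(S f : Lp ℝ 2 μ) - f‖ ^ 2 := by gcongr
  have h4 : ‖(w : Lp ℝ 2 μ) - f‖ ^ 2 = ‖(w : Lp ℝ 2 μ) - (S f : Lp ℝ 2 μ)‖ ^ 2
      - 2 * inner ℝ (f - (S f : Lp ℝ 2 μ)) ((w : Lp ℝ 2 μ) - (S f : Lp ℝ 2 μ))
      + ‖(S f : Lp ℝ 2 μ) - f‖ ^ 2 := by
    have : (w : Lp ℝ 2 μ) - f = ((w : Lp ℝ 2 μ) - (S f : Lp ℝ 2 μ)) - (f - (S f : Lp ℝ 2 μ)) := by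
      abel
    rw [this, norm_sub_sq_real, norm_sub_rev f, real_inner_comm]
  have h5 : E.form w w = E.form (w - S f) (w - S f) + 2 * E.form (S f) (w - S f)
      + E.form (S f) (S f) := by
    simp only [map_sub, LinearMap.sub_apply, E.symm w (S f)]; ring
  have h6 := E.nonneg (w - S f)
  rw [Submodule.coe_sub] at h1
  have h7 : β * ‖(w : Lp ℝ 2 μ) - (S f : Lp ℝ 2 μ)‖ ^ 2 ≤ 0 := by nlinarith
  have h8 : ‖(w : Lp ℝ 2 μ) - (S f : Lp ℝ 2 μ)‖ ^ 2 ≤ 0 := by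
    by_contra hc
    push Not at hc
    have := mul_pos hβ hc
    linarith
  have h9 : (w : Lp ℝ 2 μ) = S f := by
    rw [← sub_eq_zero, ← norm_eq_zero]
    exact pow_eq_zero_iff two_ne_zero |>.1 (le_antisymm h8 (sq_nonneg _))
  rw [h9] at hw
  filter_upwards [hw] with x hx
  rw [hx]
  exact ⟨le_min (le_max_left _ _) zero_le_one, min_le_right _ _⟩

lemma resolvent_nonneg (hβ : 0 < β)
    (hS : ∀ f v, E.form (S f) v = β * inner ℝ (f - (S f : Lp ℝ 2 μ)) (v : Lp ℝ 2 μ))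
    (f : Lp ℝ 2 μ) (c : ℝ) (hf : ∀ᵐ x ∂μ, 0 ≤ f x ∧ f x ≤ c) :
    ∀ᵐ x ∂μ, 0 ≤ (S f : Lp ℝ 2 μ) x := by
  set d : ℝ := max c 1
  have hd : 0 < d := lt_of_lt_of_le one_pos (le_max_right _ _)
  have h := resolvent_markov hβ hS (d⁻¹ • f) (by
    filter_upwards [hf, Lp.coeFn_smul d⁻¹ f] with x h1 h2
    rw [h2, Pi.smul_apply, smul_eq_mul]
    refine ⟨mul_nonneg (by positivity) h1.1, ?_⟩
    rw [inv_mul_le_iff₀ hd, mul_one]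
    exact h1.2.trans (le_max_left _ _))
  rw [map_smul, Submodule.coe_smul] at h
  filter_upwards [h, Lp.coeFn_smul d⁻¹ (S f : Lp ℝ 2 μ)] with x h1 h2
  rw [h2, Pi.smul_apply, smul_eq_mul] at h1
  exact (mul_nonneg_iff_of_pos_left (by positivity)).1 h1.1

/-- `E(βG_β u, v) → E(u, v)` as `β → ∞`. -/
lemma tendsto_resolvent_form (S : ℕ → Lp ℝ 2 μ →ₗ[ℝ] E.domain)
    (hS : ∀ n f v, E.form (S n f) v
      = ((n : ℝ) + 1) * inner ℝ (f - (S n f : Lp ℝ 2 μ)) (v : Lp ℝ 2 μ)) (u v : E.domain) :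
    Tendsto (fun n => E.form (S n u) v) atTop (𝓝 (E.form u v)) := by
  set w : ℕ → E.domain := fun n => S n u with hw
  have ha : ∀ n : ℕ, ((n : ℝ) + 1) * ‖(u : Lp ℝ 2 μ) - (w n : Lp ℝ 2 μ)‖ ^ 2
      = E.form (w n) u - E.form (w n) (w n) := by
    intro n
    have := hS n u (u - w n)
    rw [Submodule.coe_sub, real_inner_self_eq_norm_sq, map_sub] at this
    exact this.symm
  have hb : ∀ n, E.form (w n) (w n) ≤ E.form (w n) u := by
    intro n
    have h1 := ha n
    have : 0 ≤ ((n : ℝ) + 1) * ‖(u : Lp ℝ 2 μ) - (w n : Lp ℝ 2 μ)‖ ^ 2 := by positivity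
    linarith
  have hsub : ∀ n, E.form (u - w n) (u - w n)
      = E.form u u - 2 * E.form (w n) u + E.form (w n) (w n) := by
    intro n
    simp only [map_sub, LinearMap.sub_apply, E.symm u (w n)]; ring
  have hc : ∀ n, E.form (w n) (w n) ≤ E.form u u := by
    intro n
    have := hsub n
    have := E.nonneg (u - w n)
    have := hb n
    linarith
  have hd : ∀ n, E.form (w n) u ≤ E.form u u := by
    intro n
    have := hsub n
    have := E.nonneg (u - w n)
    have := hc n
    linarith
  have hL2 : Tendsto (fun n => ‖(u : Lp ℝ 2 μ) - (w n : Lp ℝ 2 μ)‖ ^ 2) atTop (𝓝 0) := by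
    have h0 : Tendsto (fun n : ℕ => E.form u u * (1 / ((n : ℝ) + 1))) atTop (𝓝 0) := by
      simpa using tendsto_one_div_add_atTop_nhds_zero_nat.const_mul (E.form u u)
    refine squeeze_zero (fun n => sq_nonneg _) (fun n => ?_) h0
    rw [mul_one_div, le_div_iff₀ (by positivity), mul_comm]
    have := E.nonneg (w n)
    linarith [ha n, hd n]
  have hL2' : Tendsto (fun n => ‖(w n : Lp ℝ 2 μ) - (u : Lp ℝ 2 μ)‖) atTop (𝓝 0) := by
    have := hL2.sqrt
    simpa [Real.sqrt_sq, norm_sub_rev] using this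
  have hlow : ∀ ε > 0, ∀ᶠ n in atTop, E.form u u - ε < E.form (w n) (w n) := by
    intro ε hε
    by_contra hcon
    rw [Filter.not_eventually] at hcon
    obtain ⟨hu, hle⟩ := E.mem_of_approx (u : Lp ℝ 2 μ) (E.form u u - ε) (by
      intro r hr
      have h1 : ∀ᶠ n in atTop, ‖(w n : Lp ℝ 2 μ) - (u : Lp ℝ 2 μ)‖ < r :=
        hL2'.eventually_lt_const hr
      obtain ⟨n, hn1, hn2⟩ := (hcon.and_eventually h1).exists
      exact ⟨w n, hn2.le, not_lt.1 hn1⟩)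
    have : E.form u u ≤ E.form u u - ε := hle
    linarith
  have hE : Tendsto (fun n => E.form (u - w n) (u - w n)) atTop (𝓝 0) := by
    rw [Metric.tendsto_atTop]
    intro ε hε
    obtain ⟨N, hN⟩ := eventually_atTop.1 (hlow ε hε)
    refine ⟨N, fun n hn => ?_⟩
    rw [Real.dist_eq, sub_zero, abs_of_nonneg (E.nonneg _)]
    linarith [hsub n, hb n, hN n hn]
  rw [← tendsto_sub_nhds_zero_iff, tendsto_zero_iff_abs_tendsto_zero]
  have h0 : Tendsto (fun n => E.form (u - w n) v ^ 2) atTop (𝓝 0) := by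
    refine squeeze_zero (fun n => sq_nonneg _) (fun n => E.form_cauchy (u - w n) v) ?_
    simpa using hE.mul_const (E.form v v)
  have h1 := h0.sqrt
  rw [Real.sqrt_zero] at h1
  refine h1.congr fun n => ?_
  rw [Real.sqrt_sq_eq_abs]
  simp only [Function.comp, map_sub, LinearMap.sub_apply]
  rw [abs_sub_comm]

end Closedness

section Core

variable {X : Type*} [TopologicalSpace X] [MeasurableSpace X] {μ : Measure X} (E : DirichletForm μ)

/-- The algebra `C_c(X) ∩ F` of real functions: continuous compactly supported functions whose
a.e.-class lies in the domain. -/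
def realCore : NonUnitalSubalgebra ℝ (X → ℝ) where
  carrier := {f | Continuous f ∧ HasCompactSupport f ∧ ∃ v ∈ E.domain, v =ᵐ[μ] f}
  zero_mem' := ⟨continuous_zero, HasCompactSupport.zero, 0, zero_mem _, Lp.coeFn_zero ℝ 2 μ⟩
  add_mem' := by
    rintro f g ⟨hf1, hf2, v, hv, hvf⟩ ⟨hg1, hg2, w, hw, hwg⟩
    exact ⟨hf1.add hg1, hf2.add hg2, v + w, add_mem hv hw,
      (Lp.coeFn_add v w).trans (hvf.add hwg)⟩
  smul_mem' := by
    rintro c f ⟨hf1, hf2, v, hv, hvf⟩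
    refine ⟨hf1.const_smul c, hf2.smul_left (f := fun _ => c), c • v, E.domain.smul_mem c hv,
      (Lp.coeFn_smul c v).trans (hvf.const_smul c)⟩
  mul_mem' := by
    rintro f g ⟨hf1, hf2, v, hv, hvf⟩ ⟨hg1, hg2, w, hw, hwg⟩
    refine ⟨hf1.mul hg1, hf2.mul_right, ?_⟩
    obtain ⟨A, hA⟩ := hf2.exists_bound_of_continuous hf1
    obtain ⟨B, hB⟩ := hg2.exists_bound_of_continuous hg1
    have hf3 : E.EnergyLE f (Real.sqrt (E.form ⟨v, hv⟩ ⟨v, hv⟩)) :=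
      ⟨Real.sqrt_nonneg _, ⟨v, hv⟩, hvf, (Real.sq_sqrt (E.nonneg _)).ge⟩
    have hg3 : E.EnergyLE g (Real.sqrt (E.form ⟨w, hw⟩ ⟨w, hw⟩)) :=
      ⟨Real.sqrt_nonneg _, ⟨w, hw⟩, hwg, (Real.sq_sqrt (E.nonneg _)).ge⟩
    have hA' : ∀ x, |f x| ≤ max 1 (max A B) := fun x =>
      (hA x).trans ((le_max_left _ _).trans (le_max_right _ _))
    have hB' : ∀ x, |g x| ≤ max 1 (max A B) := fun x =>
      (hB x).trans ((le_max_right _ _).trans (le_max_right _ _))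
    obtain ⟨e, -, a, ha, -⟩ :=
      hf3.mul hg3 (lt_of_lt_of_le one_pos (le_max_left 1 (max A B))) hA' hB'
    exact ⟨a, a.2, ha⟩

lemma realCore_memLp (f : E.realCore) : MemLp (f : X → ℝ) 2 μ := by
  obtain ⟨_, _, v, _, hvf⟩ := f.2
  exact (memLp_congr_ae hvf).1 (Lp.memLp v)

/-- The inclusion `C_c(X) ∩ F → F`. -/
noncomputable def toDomain : E.realCore →ₗ[ℝ] E.domain where
  toFun f := ⟨(E.realCore_memLp f).toLp _, by
    obtain ⟨_, _, v, hv, hvf⟩ := f.2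
    have : (E.realCore_memLp f).toLp _ = v := by
      refine Lp.ext ((E.realCore_memLp f).coeFn_toLp.trans hvf.symm)
    rw [this]; exact hv⟩
  map_add' f g := Subtype.ext (MemLp.toLp_add (E.realCore_memLp f) (E.realCore_memLp g))
  map_smul' c f := Subtype.ext (MemLp.toLp_const_smul c (E.realCore_memLp f))

/-- `E(f, g)` for `f, g ∈ C_c(X) ∩ F`. -/
noncomputable def energy (f g : E.realCore) : ℝ := E.form (E.toDomain f) (E.toDomain g)

lemma toDomain_coeFn (f : E.realCore) : (E.toDomain f : Lp ℝ 2 μ) =ᵐ[μ] (f : X → ℝ) :=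
  (E.realCore_memLp f).coeFn_toLp

lemma realCore_bounded (f : E.realCore) : ∃ C, ∀ x, |(f : X → ℝ) x| ≤ C :=
  f.2.2.1.exists_bound_of_continuous f.2.1

end Core

section Positivity

variable {X : Type*} [TopologicalSpace X] [T2Space X] [MeasurableSpace X] [BorelSpace X]
  {μ : Measure X} [IsFiniteMeasureOnCompacts μ] {E : DirichletForm μ}

lemma resolvent_quadratic {β : ℝ} {S : Lp ℝ 2 μ →ₗ[ℝ] E.domain} (hβ : 0 < β)
    (hS : ∀ f v, E.form (S f) v = β * inner ℝ (f - (S f : Lp ℝ 2 μ)) (v : Lp ℝ 2 μ))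
    {ι : Type*} [Fintype ι] (a : ι → E.realCore) (q : ι → ℝ) (t : ℝ) :
    ∀ᵐ x ∂μ, 0 ≤ ∑ i, ∑ j, q i * q j * (S (E.toDomain (a i * a j) : Lp ℝ 2 μ) : Lp ℝ 2 μ) x
      - 2 * t * ∑ i, q i * (S (E.toDomain (a i) : Lp ℝ 2 μ) : Lp ℝ 2 μ) x + t ^ 2 := by
  classical
  set K : Set X := ⋃ i, tsupport (a i : X → ℝ) with hKdef
  have hK : IsCompact K := isCompact_iUnion fun i => (a i).2.2.1
  have hKm : MeasurableSet K := hK.isClosed.measurableSet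
  have hKf : μ K ≠ ⊤ := hK.measure_lt_top.ne
  set χ : Lp ℝ 2 μ := indicatorConstLp 2 hKm hKf (1 : ℝ) with hχ
  have hχ1 : ∀ᵐ x ∂μ, (S χ : Lp ℝ 2 μ) x ≤ 1 := by
    refine (resolvent_markov hβ hS χ ?_).mono fun x hx => hx.2
    filter_upwards [indicatorConstLp_coeFn (p := 2) (hs := hKm) (hμs := hKf) (c := (1 : ℝ))]
      with x hx
    rw [hχ, hx]
    by_cases h : x ∈ K <;> simp [h]
  set H : Lp ℝ 2 μ := (∑ i, ∑ j, (q i * q j) • (E.toDomain (a i * a j) : Lp ℝ 2 μ))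
    - (2 * t) • (∑ i, q i • (E.toDomain (a i) : Lp ℝ 2 μ)) + t ^ 2 • χ with hH
  choose C hC using fun i => E.realCore_bounded (a i)
  have hHx : ∀ᵐ x ∂μ, 0 ≤ H x ∧ H x ≤ (∑ i, |q i| * C i + |t|) ^ 2 := by
    have e1 : ∀ᵐ x ∂μ, ∀ i j, (E.toDomain (a i * a j) : Lp ℝ 2 μ) x
        = (a i : X → ℝ) x * (a j : X → ℝ) x := by
      rw [ae_all_iff]; intro i; rw [ae_all_iff]; intro j
      filter_upwards [E.toDomain_coeFn (a i * a j)] with x hx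
      rw [hx]; rfl
    have e2 : ∀ᵐ x ∂μ, ∀ i, (E.toDomain (a i) : Lp ℝ 2 μ) x = (a i : X → ℝ) x := by
      rw [ae_all_iff]; intro i; exact E.toDomain_coeFn (a i)
    have e3 : ∀ᵐ x ∂μ, H x = (∑ i, ∑ j, (q i * q j) * (E.toDomain (a i * a j) : Lp ℝ 2 μ) x)
        - (2 * t) * (∑ i, q i * (E.toDomain (a i) : Lp ℝ 2 μ) x) + t ^ 2 * χ x := by
      have f1 : ∀ᵐ x ∂μ, ∀ i, (∑ j, (q i * q j) • (E.toDomain (a i * a j) : Lp ℝ 2 μ) :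
          Lp ℝ 2 μ) x = ∑ j, (q i * q j) * (E.toDomain (a i * a j) : Lp ℝ 2 μ) x := by
        rw [ae_all_iff]; intro i
        have g1 := Lp.coeFn_finsetSum (p := 2) (μ := μ) Finset.univ
          (fun j => (q i * q j) • (E.toDomain (a i * a j) : Lp ℝ 2 μ))
        have g2 : ∀ᵐ x ∂μ, ∀ j, ((q i * q j) • (E.toDomain (a i * a j) : Lp ℝ 2 μ) : Lp ℝ 2 μ) x
            = (q i * q j) * (E.toDomain (a i * a j) : Lp ℝ 2 μ) x := by
          rw [ae_all_iff]; intro j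
          exact Lp.coeFn_smul _ _
        filter_upwards [g1, g2] with x h1 h2
        rw [h1, Finset.sum_apply]
        exact Finset.sum_congr rfl fun j _ => h2 j
      have f2 := Lp.coeFn_finsetSum (p := 2) (μ := μ) Finset.univ
          (fun i => ∑ j, (q i * q j) • (E.toDomain (a i * a j) : Lp ℝ 2 μ))
      have f3 := Lp.coeFn_finsetSum (p := 2) (μ := μ) Finset.univ
          (fun i => q i • (E.toDomain (a i) : Lp ℝ 2 μ))
      have f4 : ∀ᵐ x ∂μ, ∀ i, (q i • (E.toDomain (a i) : Lp ℝ 2 μ) : Lp ℝ 2 μ) x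
            = q i * (E.toDomain (a i) : Lp ℝ 2 μ) x := by
        rw [ae_all_iff]; intro j
        exact Lp.coeFn_smul _ _
      have f5 := Lp.coeFn_add ((∑ i, ∑ j, (q i * q j) • (E.toDomain (a i * a j) : Lp ℝ 2 μ))
        - (2 * t) • (∑ i, q i • (E.toDomain (a i) : Lp ℝ 2 μ))) (t ^ 2 • χ)
      have f6 := Lp.coeFn_sub (∑ i, ∑ j, (q i * q j) • (E.toDomain (a i * a j) : Lp ℝ 2 μ))
        ((2 * t) • (∑ i, q i • (E.toDomain (a i) : Lp ℝ 2 μ)))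
      have f7 := Lp.coeFn_smul (2 * t) (∑ i, q i • (E.toDomain (a i) : Lp ℝ 2 μ))
      have f8 := Lp.coeFn_smul (t ^ 2) χ
      filter_upwards [f1, f2, f3, f4, f5, f6, f7, f8] with x f1 f2 f3 f4 f5 f6 f7 f8
      rw [hH, f5, Pi.add_apply, f6, Pi.sub_apply, f7, f8, Pi.smul_apply, Pi.smul_apply, f2, f3,
        Finset.sum_apply, Finset.sum_apply, smul_eq_mul, smul_eq_mul]
      rw [Finset.sum_congr rfl fun i _ => f1 i, Finset.sum_congr rfl fun i _ => f4 i]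
    filter_upwards [e1, e2, e3,
      indicatorConstLp_coeFn (p := 2) (hs := hKm) (hμs := hKf) (c := (1 : ℝ))] with x e1 e2 e3 e4
    set χx : ℝ := K.indicator (fun _ => (1 : ℝ)) x with hχx
    have h1 : χx * χx = χx := by
      rw [hχx]; by_cases h : x ∈ K <;> simp [h]
    have h2 : ∀ i, (a i : X → ℝ) x * χx = (a i : X → ℝ) x := by
      intro i
      by_cases h : x ∈ K
      · simp [hχx, h]
      · have : (a i : X → ℝ) x = 0 :=
          image_eq_zero_of_notMem_tsupport fun h' => h (Set.mem_iUnion.2 ⟨i, h'⟩)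
        simp [this]
    have h4 : H x = (∑ i, q i * (a i : X → ℝ) x - t * χx) ^ 2 := by
      rw [e3, hχ, e4]
      have s1 : ∑ i, ∑ j, (q i * q j) * (E.toDomain (a i * a j) : Lp ℝ 2 μ) x
          = (∑ i, q i * (a i : X → ℝ) x) * (∑ i, q i * (a i : X → ℝ) x) := by
        rw [Finset.sum_mul_sum]
        refine Finset.sum_congr rfl fun i _ => Finset.sum_congr rfl fun j _ => ?_
        rw [e1]; ring
      have s2 : ∑ i, q i * (E.toDomain (a i) : Lp ℝ 2 μ) x
          = (∑ i, q i * (a i : X → ℝ) x) * χx := by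
        rw [Finset.sum_mul]
        refine Finset.sum_congr rfl fun i _ => ?_
        rw [e2, mul_assoc, h2]
      rw [s1, s2]
      linear_combination (-t ^ 2) * h1
    rw [h4]
    refine ⟨sq_nonneg _, ?_⟩
    refine sq_le_sq' ?_ ?_ <;> [skip; skip]
    all_goals
      have b1 : |∑ i, q i * (a i : X → ℝ) x - t * χx| ≤ ∑ i, |q i| * C i + |t| := by
        refine (abs_sub _ _).trans (add_le_add ?_ ?_)
        · refine (Finset.abs_sum_le_sum_abs _ _).trans (Finset.sum_le_sum fun i _ => ?_)
          rw [abs_mul]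
          exact mul_le_mul_of_nonneg_left (hC i x) (abs_nonneg _)
        · rw [abs_mul]
          refine mul_le_of_le_one_right (abs_nonneg _) ?_
          rw [hχx]; by_cases h : x ∈ K <;> simp [h]
    · exact (abs_le.1 b1).1
    · exact (abs_le.1 b1).2
  have hpos := resolvent_nonneg hβ hS H _ hHx
  have hSH : (S H : Lp ℝ 2 μ)
      = (∑ i, ∑ j, (q i * q j) • (S (E.toDomain (a i * a j) : Lp ℝ 2 μ) : Lp ℝ 2 μ))
      - (2 * t) • (∑ i, q i • (S (E.toDomain (a i) : Lp ℝ 2 μ) : Lp ℝ 2 μ))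
      + t ^ 2 • (S χ : Lp ℝ 2 μ) := by
    rw [hH]
    simp only [map_add, map_sub, map_smul, map_sum, Submodule.coe_add, Submodule.coe_sub,
      Submodule.coe_smul, Submodule.coe_sum]
  rw [hSH] at hpos
  have f1 : ∀ᵐ x ∂μ, ∀ i, (∑ j, (q i * q j) •
      (S (E.toDomain (a i * a j) : Lp ℝ 2 μ) : Lp ℝ 2 μ) : Lp ℝ 2 μ) x
      = ∑ j, (q i * q j) * (S (E.toDomain (a i * a j) : Lp ℝ 2 μ) : Lp ℝ 2 μ) x := by
    rw [ae_all_iff]; intro i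
    have g1 := Lp.coeFn_finsetSum (p := 2) (μ := μ) Finset.univ
      (fun j => (q i * q j) • (S (E.toDomain (a i * a j) : Lp ℝ 2 μ) : Lp ℝ 2 μ))
    have g2 : ∀ᵐ x ∂μ, ∀ j, ((q i * q j) •
        (S (E.toDomain (a i * a j) : Lp ℝ 2 μ) : Lp ℝ 2 μ) : Lp ℝ 2 μ) x
        = (q i * q j) * (S (E.toDomain (a i * a j) : Lp ℝ 2 μ) : Lp ℝ 2 μ) x := by
      rw [ae_all_iff]; intro j
      exact Lp.coeFn_smul _ _
    filter_upwards [g1, g2] with x h1 h2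
    rw [h1, Finset.sum_apply]
    exact Finset.sum_congr rfl fun j _ => h2 j
  have f2 := Lp.coeFn_finsetSum (p := 2) (μ := μ) Finset.univ
      (fun i => ∑ j, (q i * q j) • (S (E.toDomain (a i * a j) : Lp ℝ 2 μ) : Lp ℝ 2 μ))
  have f3 := Lp.coeFn_finsetSum (p := 2) (μ := μ) Finset.univ
      (fun i => q i • (S (E.toDomain (a i) : Lp ℝ 2 μ) : Lp ℝ 2 μ))
  have f4 : ∀ᵐ x ∂μ, ∀ i, (q i • (S (E.toDomain (a i) : Lp ℝ 2 μ) : Lp ℝ 2 μ) : Lp ℝ 2 μ) x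
        = q i * (S (E.toDomain (a i) : Lp ℝ 2 μ) : Lp ℝ 2 μ) x := by
    rw [ae_all_iff]; intro j
    exact Lp.coeFn_smul _ _
  have f5 := Lp.coeFn_add
    ((∑ i, ∑ j, (q i * q j) • (S (E.toDomain (a i * a j) : Lp ℝ 2 μ) : Lp ℝ 2 μ))
    - (2 * t) • (∑ i, q i • (S (E.toDomain (a i) : Lp ℝ 2 μ) : Lp ℝ 2 μ)))
    (t ^ 2 • (S χ : Lp ℝ 2 μ))
  have f6 := Lp.coeFn_sub
    (∑ i, ∑ j, (q i * q j) • (S (E.toDomain (a i * a j) : Lp ℝ 2 μ) : Lp ℝ 2 μ))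
    ((2 * t) • (∑ i, q i • (S (E.toDomain (a i) : Lp ℝ 2 μ) : Lp ℝ 2 μ)))
  have f7 := Lp.coeFn_smul (2 * t) (∑ i, q i • (S (E.toDomain (a i) : Lp ℝ 2 μ) : Lp ℝ 2 μ))
  have f8 := Lp.coeFn_smul (t ^ 2) (S χ : Lp ℝ 2 μ)
  filter_upwards [hpos, hχ1, f1, f2, f3, f4, f5, f6, f7, f8] with x hpos hχ1 f1 f2 f3 f4 f5 f6 f7 f8
  rw [f5, Pi.add_apply, f6, Pi.sub_apply, f7, f8, Pi.smul_apply, Pi.smul_apply, f2, f3,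
    Finset.sum_apply, Finset.sum_apply, smul_eq_mul, smul_eq_mul,
    Finset.sum_congr rfl fun i _ => f1 i, Finset.sum_congr rfl fun i _ => f4 i] at hpos
  nlinarith [sq_nonneg t]

lemma resolvent_pos {β : ℝ} {S : Lp ℝ 2 μ →ₗ[ℝ] E.domain} (hβ : 0 < β)
    (hS : ∀ f v, E.form (S f) v = β * inner ℝ (f - (S f : Lp ℝ 2 μ)) (v : Lp ℝ 2 μ))
    {ι : Type*} [Fintype ι] (a b : ι → E.realCore) :
    0 ≤ ∑ i, ∑ j, (2 * E.form (S (E.toDomain (a j) : Lp ℝ 2 μ)) (E.toDomain (b i * b j * a i))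
      - E.form (S (E.toDomain (a i * a j) : Lp ℝ 2 μ)) (E.toDomain (b i * b j))) := by
  classical
  have hint : ∀ f g : Lp ℝ 2 μ, Integrable (fun x => f x * g x) μ := by
    intro f g
    refine (L2.integrable_inner (𝕜 := ℝ) g f).congr (Eventually.of_forall fun x => ?_)
    simp
  have hin : ∀ f g : Lp ℝ 2 μ, inner ℝ f g = ∫ x, f x * g x ∂μ := by
    intro f g
    rw [L2.inner_def]
    refine integral_congr_ae (Eventually.of_forall fun x => ?_)
    simp [mul_comm]
  set A : ι → Lp ℝ 2 μ := fun i => E.toDomain (a i) with hA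
  set AA : ι → ι → Lp ℝ 2 μ := fun i j => E.toDomain (a i * a j) with hAA
  set BB : ι → ι → Lp ℝ 2 μ := fun i j => E.toDomain (b i * b j) with hBB
  set BA : ι → ι → Lp ℝ 2 μ := fun i j => E.toDomain (b i * b j * a i) with hBA
  have hsum : ∑ i, ∑ j, (2 * E.form (S (E.toDomain (a j) : Lp ℝ 2 μ))
      (E.toDomain (b i * b j * a i))
      - E.form (S (E.toDomain (a i * a j) : Lp ℝ 2 μ)) (E.toDomain (b i * b j)))
      = β * ∫ x, ∑ i, ∑ j, (2 * ((A j - (S (A j) : Lp ℝ 2 μ) : Lp ℝ 2 μ) x * BA i j x)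
        - (AA i j - (S (AA i j) : Lp ℝ 2 μ) : Lp ℝ 2 μ) x * BB i j x) ∂μ := by
    have hI : ∀ i j, Integrable (fun x => 2 * ((A j - (S (A j) : Lp ℝ 2 μ) : Lp ℝ 2 μ) x
        * BA i j x) - (AA i j - (S (AA i j) : Lp ℝ 2 μ) : Lp ℝ 2 μ) x * BB i j x) μ :=
      fun i j => ((hint _ _).const_mul 2).sub (hint _ _)
    rw [integral_finsetSum _ fun i _ => integrable_finsetSum _ fun j _ => hI i j, Finset.mul_sum]
    refine Finset.sum_congr rfl fun i _ => ?_
    rw [integral_finsetSum _ fun j _ => hI i j, Finset.mul_sum]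
    refine Finset.sum_congr rfl fun j _ => ?_
    rw [integral_sub ((hint _ _).const_mul 2) (hint _ _), integral_const_mul, ← hin, ← hin, hS, hS]
    ring
  rw [hsum]
  refine mul_nonneg hβ.le (integral_nonneg_of_ae ?_)
  obtain ⟨d, hd⟩ := TopologicalSpace.exists_dense_seq ((ι → ℝ) × ℝ)
  have hq : ∀ᵐ x ∂μ, ∀ n, 0 ≤ ∑ i, ∑ j, (d n).1 i * (d n).1 j * (S (AA i j) : Lp ℝ 2 μ) x
      - 2 * (d n).2 * ∑ i, (d n).1 i * (S (A i) : Lp ℝ 2 μ) x + (d n).2 ^ 2 := by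
    rw [ae_all_iff]; intro n
    exact resolvent_quadratic hβ hS a (d n).1 (d n).2
  have e1 : ∀ᵐ x ∂μ, ∀ i j, AA i j x = (a i : X → ℝ) x * (a j : X → ℝ) x := by
    rw [ae_all_iff]; intro i; rw [ae_all_iff]; intro j
    filter_upwards [E.toDomain_coeFn (a i * a j)] with x hx
    rw [hAA]; simp only; rw [hx]; rfl
  have e2 : ∀ᵐ x ∂μ, ∀ i, A i x = (a i : X → ℝ) x := by
    rw [ae_all_iff]; intro i; exact E.toDomain_coeFn (a i)
  have e3 : ∀ᵐ x ∂μ, ∀ i j, BB i j x = (b i : X → ℝ) x * (b j : X → ℝ) x := by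
    rw [ae_all_iff]; intro i; rw [ae_all_iff]; intro j
    filter_upwards [E.toDomain_coeFn (b i * b j)] with x hx
    rw [hBB]; simp only; rw [hx]; rfl
  have e4 : ∀ᵐ x ∂μ, ∀ i j, BA i j x
      = (b i : X → ℝ) x * (b j : X → ℝ) x * (a i : X → ℝ) x := by
    rw [ae_all_iff]; intro i; rw [ae_all_iff]; intro j
    filter_upwards [E.toDomain_coeFn (b i * b j * a i)] with x hx
    rw [hBA]; simp only; rw [hx]; rfl
  have e5 : ∀ᵐ x ∂μ, ∀ i, (A i - (S (A i) : Lp ℝ 2 μ) : Lp ℝ 2 μ) x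
      = A i x - (S (A i) : Lp ℝ 2 μ) x := by
    rw [ae_all_iff]; intro i; exact Lp.coeFn_sub _ _
  have e6 : ∀ᵐ x ∂μ, ∀ i j, (AA i j - (S (AA i j) : Lp ℝ 2 μ) : Lp ℝ 2 μ) x
      = AA i j x - (S (AA i j) : Lp ℝ 2 μ) x := by
    rw [ae_all_iff]; intro i; rw [ae_all_iff]; intro j; exact Lp.coeFn_sub _ _
  filter_upwards [hq, e1, e2, e3, e4, e5, e6] with x hq e1 e2 e3 e4 e5 e6
  have hall : ∀ p : (ι → ℝ) × ℝ, 0 ≤ ∑ i, ∑ j, p.1 i * p.1 j * (S (AA i j) : Lp ℝ 2 μ) x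
      - 2 * p.2 * ∑ i, p.1 i * (S (A i) : Lp ℝ 2 μ) x + p.2 ^ 2 := by
    intro p
    refine hd.induction_on (p := fun p : (ι → ℝ) × ℝ =>
      0 ≤ ∑ i, ∑ j, p.1 i * p.1 j * (S (AA i j) : Lp ℝ 2 μ) x
      - 2 * p.2 * ∑ i, p.1 i * (S (A i) : Lp ℝ 2 μ) x + p.2 ^ 2) p ?_ hq
    exact isClosed_le continuous_const (by fun_prop)
  have h := hall (fun i => (b i : X → ℝ) x, ∑ i, (b i : X → ℝ) x * (a i : X → ℝ) x)
  simp only at h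
  simp only [Pi.zero_apply]
  refine h.trans_eq ?_
  have s1 : (2 * ∑ i, (b i : X → ℝ) x * (a i : X → ℝ) x)
        * ∑ i, (b i : X → ℝ) x * (S (A i) : Lp ℝ 2 μ) x
      = ∑ i, ∑ j, 2 * ((b i : X → ℝ) x * (a i : X → ℝ) x
        * ((b j : X → ℝ) x * (S (A j) : Lp ℝ 2 μ) x)) := by
    rw [mul_assoc, Finset.sum_mul_sum, Finset.mul_sum]
    refine Finset.sum_congr rfl fun i _ => ?_
    rw [Finset.mul_sum]
  have s2 : (∑ i, (b i : X → ℝ) x * (a i : X → ℝ) x) ^ 2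
      = ∑ i, ∑ j, ((b i : X → ℝ) x * (a i : X → ℝ) x * ((b j : X → ℝ) x * (a j : X → ℝ) x)) := by
    rw [sq, Finset.sum_mul_sum]
  rw [s1, s2, ← Finset.sum_sub_distrib, ← Finset.sum_add_distrib]
  refine Finset.sum_congr rfl fun i _ => ?_
  rw [← Finset.sum_sub_distrib, ← Finset.sum_add_distrib]
  refine Finset.sum_congr rfl fun j _ => ?_
  rw [e5, e6, e1, e2, e3, e4]
  ring

/-- Nonnegativity of `∑ᵢⱼ ∫ bᵢ bⱼ dΓ(aᵢ, aⱼ)`. -/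
lemma sum_energy_nonneg {ι : Type*} [Fintype ι] (a b : ι → E.realCore) :
    0 ≤ ∑ i, ∑ j, (2 * E.energy (a j) (b i * b j * a i) - E.energy (a i * a j) (b i * b j)) := by
  choose S hS using fun n : ℕ => E.exists_resolvent ((n : ℝ) + 1) (by positivity)
  refine ge_of_tendsto' (tendsto_finsetSum _ fun i _ => tendsto_finsetSum _ fun j _ =>
    ((tendsto_resolvent_form S hS (E.toDomain (a j)) (E.toDomain (b i * b j * a i))).const_mul
      2).sub (tendsto_resolvent_form S hS (E.toDomain (a i * a j)) (E.toDomain (b i * b j))))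
    fun n => resolvent_pos (by positivity) (hS n) a b

end Positivity

section Complexification

variable {X : Type*} [TopologicalSpace X] [MeasurableSpace X] {μ : Measure X} (E : DirichletForm μ)

lemma energy_add_left (f g h : E.realCore) :
    E.energy (f + g) h = E.energy f h + E.energy g h := by simp [energy]

lemma energy_add_right (f g h : E.realCore) :
    E.energy f (g + h) = E.energy f g + E.energy f h := by simp [energy]

lemma energy_smul_left (c : ℝ) (f g : E.realCore) :
    E.energy (c • f) g = c * E.energy f g := by simp [energy]

lemma energy_smul_right (c : ℝ) (f g : E.realCore) :
    E.energy f (c • g) = c * E.energy f g := by simp [energy]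

lemma energy_neg_left (f g : E.realCore) : E.energy (-f) g = -E.energy f g := by simp [energy]

lemma energy_neg_right (f g : E.realCore) : E.energy f (-g) = -E.energy f g := by simp [energy]

lemma energy_sub_left (f g h : E.realCore) :
    E.energy (f - g) h = E.energy f h - E.energy g h := by simp [energy]

lemma energy_sub_right (f g h : E.realCore) :
    E.energy f (g - h) = E.energy f g - E.energy f h := by simp [energy]

lemma energy_comm (f g : E.realCore) : E.energy f g = E.energy g f := E.symm _ _

/-- The complexified Dirichlet algebra `C = C_c(X) ∩ F`, as an involutive algebra of complex
functions with real and imaginary parts in `E.realCore`. -/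
noncomputable def core : NonUnitalStarSubalgebra ℂ C₀(X, ℂ) where
  carrier := {f | (fun x => (f x).re) ∈ E.realCore ∧ (fun x => (f x).im) ∈ E.realCore}
  zero_mem' := ⟨zero_mem E.realCore, zero_mem E.realCore⟩
  add_mem' := fun hf hg => ⟨add_mem hf.1 hg.1, add_mem hf.2 hg.2⟩
  mul_mem' := by
    rintro f g ⟨hf1, hf2⟩ ⟨hg1, hg2⟩
    exact ⟨sub_mem (mul_mem hf1 hg1) (mul_mem hf2 hg2),
      add_mem (mul_mem hf1 hg2) (mul_mem hf2 hg1)⟩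
  smul_mem' := by
    rintro c f ⟨hf1, hf2⟩
    exact ⟨sub_mem (SMulMemClass.smul_mem c.re hf1) (SMulMemClass.smul_mem c.im hf2),
      add_mem (SMulMemClass.smul_mem c.re hf2) (SMulMemClass.smul_mem c.im hf1)⟩
  star_mem' := fun hf => ⟨hf.1, neg_mem hf.2⟩

variable {E}

/-- The real part of an element of the complex Dirichlet algebra. -/
noncomputable def rePart (f : E.core) : E.realCore := ⟨fun x => ((f : C₀(X, ℂ)) x).re, f.2.1⟩

/-- The imaginary part of an element of the complex Dirichlet algebra. -/
noncomputable def imPart (f : E.core) : E.realCore := ⟨fun x => ((f : C₀(X, ℂ)) x).im, f.2.2⟩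

lemma rePart_add (f g : E.core) : rePart (f + g) = rePart f + rePart g := rfl
lemma imPart_add (f g : E.core) : imPart (f + g) = imPart f + imPart g := rfl
lemma rePart_smul (c : ℂ) (f : E.core) :
    rePart (c • f) = c.re • rePart f - c.im • imPart f := rfl
lemma imPart_smul (c : ℂ) (f : E.core) :
    imPart (c • f) = c.re • imPart f + c.im • rePart f := rfl
lemma rePart_mul (f g : E.core) :
    rePart (f * g) = rePart f * rePart g - imPart f * imPart g := rfl
lemma imPart_mul (f g : E.core) :
    imPart (f * g) = rePart f * imPart g + imPart f * rePart g := rfl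
lemma rePart_star (f : E.core) : rePart (star f) = rePart f := rfl
lemma imPart_star (f : E.core) : imPart (star f) = -imPart f := rfl

/-- A real element of the Dirichlet algebra as a complex one. -/
noncomputable def ofRealCore (f : E.realCore) : E.core :=
  ⟨⟨⟨fun x => ((f : X → ℝ) x : ℂ), Complex.continuous_ofReal.comp f.2.1⟩,
    (f.2.2.1.comp_left Complex.ofReal_zero).is_zero_at_infty⟩, f.2, zero_mem E.realCore⟩

lemma rePart_ofRealCore (f : E.realCore) : rePart (ofRealCore f) = f := rfl
lemma imPart_ofRealCore (f : E.realCore) : imPart (ofRealCore f) = 0 := rfl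

lemma core_ext {f g : E.core} (h1 : rePart f = rePart g) (h2 : imPart f = imPart g) : f = g := by
  apply Subtype.ext
  ext x
  exact Complex.ext (congrFun (congrArg Subtype.val h1) x) (congrFun (congrArg Subtype.val h2) x)

variable (E)

/-- The complex bilinear extension of the energy form. -/
noncomputable def energyC : E.core →ₗ[ℂ] E.core →ₗ[ℂ] ℂ :=
  LinearMap.mk₂ ℂ (fun f g =>
    ⟨E.energy (rePart f) (rePart g) - E.energy (imPart f) (imPart g),
      E.energy (rePart f) (imPart g) + E.energy (imPart f) (rePart g)⟩)
    (fun f g h => by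
      apply Complex.ext <;>
        simp only [rePart_add, imPart_add, energy_add_left, Complex.add_re, Complex.add_im] <;> ring)
    (fun c f g => by
      apply Complex.ext <;>
        simp only [rePart_smul, imPart_smul, energy_add_left, energy_sub_left, energy_smul_left,
          smul_eq_mul, Complex.mul_re, Complex.mul_im] <;> ring)
    (fun f g h => by
      apply Complex.ext <;>
        simp only [rePart_add, imPart_add, energy_add_right, Complex.add_re, Complex.add_im] <;>
          ring)
    (fun c f g => by
      apply Complex.ext <;>
        simp only [rePart_smul, imPart_smul, energy_add_right, energy_sub_right, energy_smul_right,
          smul_eq_mul, Complex.mul_re, Complex.mul_im] <;> ring)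

lemma energyC_re (f g : E.core) : (E.energyC f g).re
    = E.energy (rePart f) (rePart g) - E.energy (imPart f) (imPart g) := rfl
lemma energyC_im (f g : E.core) : (E.energyC f g).im
    = E.energy (rePart f) (imPart g) + E.energy (imPart f) (rePart g) := rfl

lemma energyC_comm (f g : E.core) : E.energyC f g = E.energyC g f := by
  apply Complex.ext
  · rw [energyC_re, energyC_re, E.energy_comm, E.energy_comm (imPart f)]
  · rw [energyC_im, energyC_im, E.energy_comm, E.energy_comm (imPart f)]; ring

lemma energyC_star (f g : E.core) : E.energyC (star f) (star g) = star (E.energyC f g) := by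
  apply Complex.ext
  · simp only [energyC_re, rePart_star, imPart_star, energy_neg_left, energy_neg_right,
      Complex.star_def, Complex.conj_re]; ring
  · simp only [energyC_im, rePart_star, imPart_star, energy_neg_left, energy_neg_right,
      Complex.star_def, Complex.conj_im]; ring

/-- The integral `∫ φ dΓ(f, g)` of `φ ∈ C` with respect to the mutual energy measure of
`f, g ∈ C` (complex bilinear in `f, g`), i.e. the polarisation of
`∫ φ dΓ(f) = E(φ f, f) - E(φ, f²) / 2`. -/
noncomputable def gammaInt (f g φ : E.core) : ℂ :=
  (E.energyC (φ * f) g + E.energyC (φ * g) f - E.energyC φ (f * g)) / 2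

lemma gammaInt_comm (f g φ : E.core) : E.gammaInt f g φ = E.gammaInt g f φ := by
  unfold gammaInt
  rw [mul_comm f g]; ring

lemma gammaInt_star (f g φ : E.core) :
    E.gammaInt (star f) (star g) (star φ) = star (E.gammaInt f g φ) := by
  unfold gammaInt
  have h : ∀ a b : E.core, star a * star b = star (a * b) := fun a b => by
    rw [star_mul, mul_comm]
  rw [h, h, h, energyC_star, energyC_star, energyC_star]
  simp

lemma gammaInt_add_left (f f' g φ : E.core) :
    E.gammaInt (f + f') g φ = E.gammaInt f g φ + E.gammaInt f' g φ := by
  unfold gammaInt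
  simp only [mul_add, add_mul, map_add, LinearMap.add_apply]; ring

lemma gammaInt_smul_left (c : ℂ) (f g φ : E.core) :
    E.gammaInt (c • f) g φ = c * E.gammaInt f g φ := by
  unfold gammaInt
  simp only [mul_smul_comm, smul_mul_assoc, map_smul, LinearMap.smul_apply, smul_eq_mul]; ring

lemma gammaInt_add_right (f g g' φ : E.core) :
    E.gammaInt f (g + g') φ = E.gammaInt f g φ + E.gammaInt f g' φ := by
  rw [gammaInt_comm, gammaInt_add_left, gammaInt_comm, E.gammaInt_comm g']

lemma gammaInt_smul_right (c : ℂ) (f g φ : E.core) :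
    E.gammaInt f (c • g) φ = c * E.gammaInt f g φ := by
  rw [gammaInt_comm, gammaInt_smul_left, gammaInt_comm]

lemma gammaInt_add (f g φ ψ : E.core) :
    E.gammaInt f g (φ + ψ) = E.gammaInt f g φ + E.gammaInt f g ψ := by
  unfold gammaInt
  simp only [add_mul, map_add, LinearMap.add_apply]; ring

lemma gammaInt_smul (c : ℂ) (f g φ : E.core) :
    E.gammaInt f g (c • φ) = c * E.gammaInt f g φ := by
  unfold gammaInt
  simp only [smul_mul_assoc, map_smul, LinearMap.smul_apply, smul_eq_mul]; ring

/-- The bilinear form `(a ⊗ b, c ⊗ d) ↦ ∫ b d dΓ(a, c)` on `C ⊗ C`. -/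
noncomputable def tensorForm :
    (E.core ⊗[ℂ] E.core) →ₗ[ℂ] (E.core ⊗[ℂ] E.core) →ₗ[ℂ] ℂ :=
  TensorProduct.lift (LinearMap.mk₂ ℂ
    (fun a b => TensorProduct.lift (LinearMap.mk₂ ℂ (fun c d => E.gammaInt a c (b * d))
      (fun c c' d => by rw [gammaInt_add_right])
      (fun r c d => by rw [gammaInt_smul_right, smul_eq_mul])
      (fun c d d' => by rw [mul_add, gammaInt_add])
      (fun r c d => by rw [mul_smul_comm, gammaInt_smul, smul_eq_mul])))
    (fun a a' b => by
      ext c d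
      simp [gammaInt_add_left])
    (fun r a b => by
      ext c d
      simp [gammaInt_smul_left])
    (fun a b b' => by
      ext c d
      simp [add_mul, gammaInt_add])
    (fun r a b => by
      ext c d
      simp [smul_mul_assoc, gammaInt_smul]))

lemma tensorForm_tmul (a b c d : E.core) :
    E.tensorForm (a ⊗ₜ b) (c ⊗ₜ d) = E.gammaInt a c (b * d) := rfl

lemma tensorForm_comm (x y : E.core ⊗[ℂ] E.core) : E.tensorForm x y = E.tensorForm y x := by
  induction x using TensorProduct.induction_on with
  | zero => simp
  | add x x' hx hx' => rw [map_add, LinearMap.add_apply, hx, hx', map_add]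
  | tmul a b =>
    induction y using TensorProduct.induction_on with
    | zero => simp
    | add y y' hy hy' => rw [map_add, hy, hy', map_add, LinearMap.add_apply]
    | tmul c d => rw [tensorForm_tmul, tensorForm_tmul, gammaInt_comm, mul_comm]

lemma tensorForm_star (x y : E.core ⊗[ℂ] E.core) :
    E.tensorForm (star x) (star y) = star (E.tensorForm x y) := by
  induction x using TensorProduct.induction_on with
  | zero => simp
  | add x x' hx hx' =>
    rw [star_add, map_add, LinearMap.add_apply, hx, hx', map_add, LinearMap.add_apply, star_add]
  | tmul a b =>
    induction y using TensorProduct.induction_on with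
    | zero => simp
    | add y y' hy hy' => rw [star_add, map_add, hy, hy', map_add, star_add]
    | tmul c d =>
      rw [TensorProduct.star_tmul, TensorProduct.star_tmul, tensorForm_tmul, tensorForm_tmul,
        ← gammaInt_star, star_mul, mul_comm]

noncomputable instance : AddCommGroup (E.core ⊗[ℂ] E.core) :=
  Module.addCommMonoidToAddCommGroup ℂ

/-- The real tensor `∑ aᵢ ⊗ bᵢ`. -/
noncomputable def realTensor (l : List (E.realCore × E.realCore)) : E.core ⊗[ℂ] E.core :=
  (l.map fun p => ofRealCore p.1 ⊗ₜ[ℂ] ofRealCore p.2).sum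

lemma realTensor_append (l l' : List (E.realCore × E.realCore)) :
    E.realTensor (l ++ l') = E.realTensor l + E.realTensor l' := by
  simp [realTensor]

lemma star_realTensor (l : List (E.realCore × E.realCore)) :
    star (E.realTensor l) = E.realTensor l := by
  induction l with
  | nil => simp [realTensor]
  | cons p l ih =>
    have h : E.realTensor (p :: l)
        = ofRealCore p.1 ⊗ₜ[ℂ] ofRealCore p.2 + E.realTensor l := by simp [realTensor]
    have hs : ∀ f : E.realCore, star (ofRealCore f) = ofRealCore f := fun f =>
      core_ext rfl (by rw [imPart_star, imPart_ofRealCore, neg_zero])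
    rw [h, star_add, ih, TensorProduct.star_tmul, hs, hs]

lemma exists_realTensor (x : E.core ⊗[ℂ] E.core) :
    ∃ l l', x = E.realTensor l + Complex.I • E.realTensor l' := by
  induction x using TensorProduct.induction_on with
  | zero => exact ⟨[], [], by simp [realTensor]⟩
  | add x y hx hy =>
    obtain ⟨l, l', rfl⟩ := hx
    obtain ⟨m, m', rfl⟩ := hy
    refine ⟨l ++ m, l' ++ m', ?_⟩
    rw [realTensor_append, realTensor_append, smul_add]
    abel
  | tmul a b =>
    have h : ∀ f : E.core, f = ofRealCore (rePart f) + Complex.I • ofRealCore (imPart f) := by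
      intro f
      refine core_ext ?_ ?_
      · rw [rePart_add, rePart_smul]
        simp [rePart_ofRealCore, imPart_ofRealCore]
      · rw [imPart_add, imPart_smul]
        simp [rePart_ofRealCore, imPart_ofRealCore]
    have hn : ∀ (f : E.realCore) (g : E.core),
        ofRealCore (-f) ⊗ₜ[ℂ] g = (-1 : ℂ) • (ofRealCore f ⊗ₜ[ℂ] g) := by
      intro f g
      have : ofRealCore (-f) = (-1 : ℂ) • ofRealCore f := by
        apply Subtype.ext
        ext x
        exact (Complex.ofReal_neg _).trans (neg_one_mul _).symm
      rw [this, TensorProduct.smul_tmul']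
    refine ⟨[(rePart a, rePart b), (-imPart a, imPart b)],
      [(rePart a, imPart b), (imPart a, rePart b)], ?_⟩
    conv_lhs => rw [h a, h b]
    simp only [realTensor, List.map_cons, List.map_nil, List.sum_cons, List.sum_nil, hn,
      TensorProduct.add_tmul, TensorProduct.tmul_add, ← TensorProduct.smul_tmul',
      TensorProduct.tmul_smul]
    match_scalars <;> ring_nf <;> simp

end Complexification

section OneForms

variable {X : Type*} [TopologicalSpace X] [T2Space X] [MeasurableSpace X] [BorelSpace X]
  {μ : Measure X} [IsFiniteMeasureOnCompacts μ] (E : DirichletForm μ)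

lemma tensorForm_realTensor_nonneg (l : List (E.realCore × E.realCore)) :
    0 ≤ (E.tensorForm (E.realTensor l) (E.realTensor l)).re := by
  set a : Fin l.length → E.realCore := fun i => l[i].1 with ha
  set b : Fin l.length → E.realCore := fun i => l[i].2 with hb
  have h1 : E.realTensor l = ∑ i, ofRealCore (a i) ⊗ₜ[ℂ] ofRealCore (b i) := by
    rw [realTensor]
    exact (Fin.sum_univ_fun_getElem l fun p => ofRealCore p.1 ⊗ₜ[ℂ] ofRealCore p.2).symm
  have h2 : ∀ f g φ ψ : E.realCore,
      (E.gammaInt (ofRealCore f) (ofRealCore g) (ofRealCore φ * ofRealCore ψ)).re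
      = (E.energy (φ * ψ * f) g + E.energy (φ * ψ * g) f - E.energy (φ * ψ) (f * g)) / 2 := by
    intro f g φ ψ
    have hm : ∀ u v : E.realCore, ofRealCore u * ofRealCore v = ofRealCore (u * v) := by
      intro u v
      apply Subtype.ext
      ext x
      exact (Complex.ofReal_mul _ _).symm
    have he : ∀ u v : E.realCore, E.energyC (ofRealCore u) (ofRealCore v) = (E.energy u v : ℂ) := by
      intro u v
      apply Complex.ext
      · rw [energyC_re, rePart_ofRealCore, rePart_ofRealCore, imPart_ofRealCore, imPart_ofRealCore]
        simp [energy]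
      · rw [energyC_im, rePart_ofRealCore, rePart_ofRealCore, imPart_ofRealCore, imPart_ofRealCore]
        simp [energy]
    rw [gammaInt, hm, hm, hm, hm, he, he, he]
    norm_cast
  have h3 : (E.tensorForm (E.realTensor l) (E.realTensor l)).re
      = (∑ i, ∑ j, (2 * E.energy (a j) (b i * b j * a i)
        - E.energy (a i * a j) (b i * b j))) / 2 := by
    rw [h1]
    simp only [map_sum, LinearMap.sum_apply, tensorForm_tmul, Complex.re_sum, h2]
    have hB : ∑ i, ∑ j, E.energy (b j * b i * a i) (a j)
        = ∑ i, ∑ j, E.energy (a j) (b i * b j * a i) :=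
      Finset.sum_congr rfl fun i _ => Finset.sum_congr rfl fun j _ => by
        rw [E.energy_comm, mul_comm (b j)]
    have hA : ∑ i, ∑ j, E.energy (b j * b i * a j) (a i)
        = ∑ i, ∑ j, E.energy (a j) (b i * b j * a i) := by
      rw [Finset.sum_comm]
      exact Finset.sum_congr rfl fun i _ => Finset.sum_congr rfl fun j _ => E.energy_comm _ _
    have hC : ∑ i, ∑ j, E.energy (b j * b i) (a j * a i)
        = ∑ i, ∑ j, E.energy (a i * a j) (b i * b j) :=
      Finset.sum_congr rfl fun i _ => Finset.sum_congr rfl fun j _ => by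
        rw [E.energy_comm, mul_comm (b j), mul_comm (a j)]
    simp only [← Finset.sum_div, Finset.sum_sub_distrib, Finset.sum_add_distrib,
      ← Finset.mul_sum]
    rw [hA, hB, hC]
    ring
  rw [h3]
  exact div_nonneg (sum_energy_nonneg a b) zero_le_two

/-- The space `C ⊗ C` with the sesquilinear form `⟨a ⊗ b, c ⊗ d⟩ = ∫ b̄ d dΓ(ā, c)`, the
complexification of `⟨a ⊗ b, c ⊗ d⟩ = ∫ b d dΓ(a, c)`. -/
def PreForms (E : DirichletForm μ) : Type _ := E.core ⊗[ℂ] E.core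

noncomputable instance : AddCommGroup E.PreForms := 
  inferInstanceAs (AddCommGroup (E.core ⊗[ℂ] E.core))

noncomputable instance : Module ℂ E.PreForms := 
  inferInstanceAs (Module ℂ (E.core ⊗[ℂ] E.core))

/-- The identification of `C ⊗ C` with `E.PreForms`. -/
noncomputable def toPreForms : (E.core ⊗[ℂ] E.core) ≃ₗ[ℂ] E.PreForms :=
  LinearEquiv.refl ℂ (E.core ⊗[ℂ] E.core)

/-- The nonnegative definite sesquilinear form on `C ⊗ C`. -/
noncomputable abbrev preFormsCore : PreInnerProductSpace.Core ℂ E.PreForms where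
  inner x y := E.tensorForm (star (E.toPreForms.symm x)) (E.toPreForms.symm y)
  conj_inner_symm x y := by
    rw [← Complex.star_def, ← tensorForm_star, star_star, tensorForm_comm]
  re_inner_nonneg x := by
    obtain ⟨l, l', h⟩ := E.exists_realTensor (E.toPreForms.symm x)
    have h1 := E.tensorForm_realTensor_nonneg l
    have h2 := E.tensorForm_realTensor_nonneg l'
    rw [h, star_add, star_smul, star_realTensor, star_realTensor]
    simp only [map_add (E.tensorForm), map_smul (E.tensorForm), LinearMap.map_add,
      LinearMap.map_smul, LinearMap.add_apply, LinearMap.smul_apply, smul_eq_mul,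
      E.tensorForm_comm (E.realTensor l') (E.realTensor l)]
    have h3 : (E.tensorForm (E.realTensor l) (E.realTensor l)
        + star Complex.I * E.tensorForm (E.realTensor l) (E.realTensor l')
        + (Complex.I * E.tensorForm (E.realTensor l) (E.realTensor l')
        + star Complex.I * (Complex.I * E.tensorForm (E.realTensor l') (E.realTensor l'))))
        = E.tensorForm (E.realTensor l) (E.realTensor l)
        + E.tensorForm (E.realTensor l') (E.realTensor l') := by
      rw [Complex.star_def, Complex.conj_I]
      linear_combination (-E.tensorForm (E.realTensor l') (E.realTensor l')) * Complex.I_mul_I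
    rw [h3]
    exact add_nonneg h1 h2
  add_left x y z := by simp
  smul_left x y r := by simp

noncomputable instance : SeminormedAddCommGroup E.PreForms :=
  @InnerProductSpace.Core.toSeminormedAddCommGroup ℂ E.PreForms _ _ _ E.preFormsCore

noncomputable instance : InnerProductSpace ℂ E.PreForms := InnerProductSpace.ofCore E.preFormsCore

/-- The Hilbert space `H` of differential 1-forms: `C ⊗ C` with zero seminorm elements factored
out, completed. -/
abbrev OneForms : Type _ := UniformSpace.Completion E.PreForms

/-- The class of the simple tensor `a ⊗ b` in the space of 1-forms. -/
noncomputable def tensor (a b : E.core) : E.OneForms := (E.toPreForms (a ⊗ₜ[ℂ] b) : E.OneForms)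

lemma inner_tensor (a b c d : E.core) :
    inner ℂ (E.tensor a b) (E.tensor c d) = E.gammaInt (star a) c (star b * d) :=
  UniformSpace.Completion.inner_coe _ _

end OneForms

section Hypotheses

variable {X : Type*} [TopologicalSpace X] [MeasurableSpace X] {μ : Measure X} (E : DirichletForm μ)

/-- Regularity: `C = C_c(X) ∩ F` is uniformly dense in `C_c(X)` and `E₁`-dense in `F`. -/
def IsRegular : Prop :=
  (∀ f : X → ℝ, Continuous f → HasCompactSupport f → ∀ ε > 0,
    ∃ g : E.realCore, ∀ x, |f x - (g : X → ℝ) x| < ε) ∧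
  (∀ u : E.domain, ∀ ε > 0, ∃ g : E.realCore, E.energyOne (u - E.toDomain g) < ε)

/-- The killing part vanishes: the Beurling–Deny decomposition of the form on `C` consists of a
strongly local part `Ec` and a jump part, given by a symmetric Radon measure `J` off the
diagonal, only. -/
def NoKilling : Prop :=
  ∃ (Ec : E.realCore →ₗ[ℝ] E.realCore →ₗ[ℝ] ℝ) (J : Measure (X × X)),
    (∀ f g, Ec f g = Ec g f) ∧ (∀ f, 0 ≤ Ec f f) ∧
    (∀ f g : E.realCore,
      (∃ c : ℝ, ∀ᶠ x in 𝓝ˢ (tsupport (g : X → ℝ)), (f : X → ℝ) x = c) → Ec f g = 0) ∧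
    J (Set.diagonal X) = 0 ∧ J.map Prod.swap = J ∧
    (∀ K : Set (X × X), IsCompact K → Disjoint K (Set.diagonal X) → J K < ⊤) ∧
    (∀ f : E.realCore, Integrable (fun p => ((f : X → ℝ) p.1 - (f : X → ℝ) p.2) ^ 2) J) ∧
    ∀ f g : E.realCore, E.energy f g = Ec f g + (1 / 2) *
      ∫ p, ((f : X → ℝ) p.1 - (f : X → ℝ) p.2) * ((g : X → ℝ) p.1 - (g : X → ℝ) p.2) ∂J

/-- `ν` is the energy measure of `f ∈ C`: the Radon measure with
`∫ φ dν = E(φ f, f) - E(φ, f²) / 2` for all `φ ∈ C`. -/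
def IsEnergyMeasure (f : E.realCore) (ν : Measure X) : Prop :=
  ν.Regular ∧ ∀ φ : E.realCore,
    ∫ x, (φ : X → ℝ) x ∂ν = E.energy (φ * f) f - E.energy φ (f * f) / 2

open Classical in
/-- The energy measure `Γ(f)` of `f ∈ C` (for a regular form it exists and is unique). -/
noncomputable def energyMeasure (f : E.realCore) : Measure X :=
  if h : ∃ ν, E.IsEnergyMeasure f ν then h.choose else 0

/-- The energy measure `Γ(a) = Γ(a, ā) = Γ(Re a) + Γ(Im a)` of a complex `a ∈ C`. -/
noncomputable def energyMeasureC (a : E.core) : Measure X :=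
  E.energyMeasure (rePart a) + E.energyMeasure (imPart a)

/-- The reference measure is energy dominant. -/
def IsEnergyDominant : Prop := ∀ f : E.realCore, E.energyMeasure f ≪ μ

/-- `‖Γ(a)‖_∞`, the essential supremum of the density `dΓ(a)/dμ`. -/
noncomputable def gammaSup (a : E.core) : ℝ≥0∞ := essSup ((E.energyMeasureC a).rnDeriv μ) μ

/-- `A₀ = {a ∈ C : Γ(a) ∈ L^∞(X, μ)}`. -/
def boundedEnergy : Set C₀(X, ℂ) := {f | ∃ h : f ∈ E.core, E.gammaSup ⟨f, h⟩ < ⊤}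

/-- The complexified domain of the form. -/
def complexDomain : Set (Lp ℂ 2 μ) :=
  {f | ∃ u ∈ E.domain, ∃ v ∈ E.domain, f =ᵐ[μ] fun x => (u x : ℂ) + (v x : ℂ) * Complex.I}

/-- The `L²`-generator `L`: `Lf = g` iff `f ∈ F` and `E(f, v) = -⟨g, v⟩` for all `v ∈ F`. -/
noncomputable def generator : Lp ℝ 2 μ →ₗ.[ℝ] Lp ℝ 2 μ :=
  Submodule.toLinearPMap
    { carrier := {p | ∃ h : p.1 ∈ E.domain, ∀ v : E.domain,
        E.form ⟨p.1, h⟩ v = -inner ℝ p.2 (v : Lp ℝ 2 μ)}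
      zero_mem' := ⟨zero_mem _, fun v => by
        rw [show (⟨(0 : Lp ℝ 2 μ × Lp ℝ 2 μ).1, zero_mem _⟩ : E.domain) = 0 from rfl]
        simp⟩
      add_mem' := by
        rintro p q ⟨hp, hp'⟩ ⟨hq, hq'⟩
        refine ⟨add_mem hp hq, fun v => ?_⟩
        rw [show (⟨(p + q).1, add_mem hp hq⟩ : E.domain) = ⟨p.1, hp⟩ + ⟨q.1, hq⟩ from rfl,
          map_add, LinearMap.add_apply, hp', hq', Prod.snd_add, inner_add_left]
        ring
      smul_mem' := by
        rintro c p ⟨hp, hp'⟩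
        refine ⟨E.domain.smul_mem c hp, fun v => ?_⟩
        rw [show (⟨(c • p).1, E.domain.smul_mem c hp⟩ : E.domain) = c • ⟨p.1, hp⟩ from rfl,
          map_smul, LinearMap.smul_apply, hp', Prod.smul_snd, real_inner_smul_left, smul_eq_mul]
        ring }

/-- The generator has discrete spectrum: `L²(X, μ)` has an orthonormal basis of eigenfunctions of
`-L` whose eigenvalues, counted with multiplicity, tend to infinity. -/
def HasDiscreteSpectrum : Prop :=
  ∃ (ι : Type) (φ : HilbertBasis ι ℝ (Lp ℝ 2 μ)) (ev : ι → ℝ),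
    Tendsto ev cofinite atTop ∧
    ∀ i, ∃ h : φ i ∈ E.generator.domain, -E.generator ⟨φ i, h⟩ = ev i • φ i

end Hypotheses

section Dirac

variable {X : Type*} [TopologicalSpace X] [T2Space X] [MeasurableSpace X] [BorelSpace X]
  {μ : Measure X} [IsFiniteMeasureOnCompacts μ] (E : DirichletForm μ)

/-- `ω` is the 1-form `∂a = a ⊗ 1`, i.e. `⟨c ⊗ d, ω⟩ = ∫ d̄ dΓ(c̄, a)` for all `c, d ∈ C`. -/
def IsGradient (a : E.core) (ω : E.OneForms) : Prop :=
  ∀ c d : E.core, inner ℂ (E.tensor c d) ω = E.gammaInt (star c) a (star d)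

/-- The graph of `∂ : C → H`. -/
def gradientGraph : Submodule ℂ (Lp ℂ 2 μ × E.OneForms) where
  carrier := {p | ∃ a : E.core, (p.1 =ᵐ[μ] (a : C₀(X, ℂ))) ∧ E.IsGradient a p.2}
  zero_mem' := ⟨0, Lp.coeFn_zero ℂ 2 μ, fun c d => by simp [gammaInt]⟩
  add_mem' := by
    rintro p q ⟨a, ha, ha'⟩ ⟨b, hb, hb'⟩
    refine ⟨a + b, (Lp.coeFn_add p.1 q.1).trans (ha.add hb), fun c d => ?_⟩
    rw [Prod.snd_add, inner_add_right, ha', hb', gammaInt_add_right]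
  smul_mem' := by
    rintro r p ⟨a, ha, ha'⟩
    refine ⟨r • a, (Lp.coeFn_smul r p.1).trans (ha.const_smul r), fun c d => ?_⟩
    rw [Prod.smul_snd, inner_smul_right, ha', gammaInt_smul_right]

/-- The closed operator `∂ : L²(X, μ) → H`, the closure of `∂ : C → H`. -/
noncomputable def gradient : Lp ℂ 2 μ →ₗ.[ℂ] E.OneForms :=
  E.gradientGraph.topologicalClosure.toLinearPMap

/-- The Hilbert space `L²(X, μ) ⊕ H`. -/
abbrev Spinors : Type _ := WithLp 2 (Lp ℂ 2 μ × E.OneForms)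

/-- The Dirac operator `D(f, ω) = (∂* ω, ∂ f)` on `dom ∂ ⊕ dom ∂*`. -/
noncomputable def dirac : E.Spinors →ₗ.[ℂ] E.Spinors where
  domain := (E.gradient.domain.prod E.gradient.adjoint.domain).comap
    (WithLp.linearEquiv 2 ℂ (Lp ℂ 2 μ × E.OneForms)).toLinearMap
  toFun :=
    { toFun := fun v => WithLp.toLp 2
        (E.gradient.adjoint ⟨(v : E.Spinors).snd, v.2.2⟩, E.gradient ⟨(v : E.Spinors).fst, v.2.1⟩)
      map_add' := fun v w => by
        rw [← WithLp.toLp_add, Prod.mk_add_mk, ← LinearPMap.map_add, ← LinearPMap.map_add]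
        rfl
      map_smul' := fun c v => by
        rw [RingHom.id_apply, ← WithLp.toLp_smul, Prod.smul_mk, ← LinearPMap.map_smul,
          ← LinearPMap.map_smul]
        rfl }

end Dirac

end DirichletForm

section SpectralTriple

variable {H : Type*} [NormedAddCommGroup H] [InnerProductSpace ℂ H]

/-- The bounded operator `T` is the commutator `[D, P]`: `P` maps `dom D` into itself and
`D P v - P D v = T v` for `v ∈ dom D`. -/
def IsCommutator (D : H →ₗ.[ℂ] H) (P T : H →L[ℂ] H) : Prop :=
  ∀ v : D.domain, ∃ h : P v ∈ D.domain, D ⟨P v, h⟩ - P (D v) = T v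

/-- The kernel of an unbounded operator, as a subspace of the Hilbert space. -/
def kernel (D : H →ₗ.[ℂ] H) : Submodule ℂ H := (LinearMap.ker D.toFun).map D.domain.subtype

/-- The restriction of `D` to the closed subspace `K` has compact resolvents: `(D - z)⁻¹` exists as
a compact operator on `K` for every complex `z` that is not an eigenvalue of the restriction. -/
def HasCompactResolventOn (D : H →ₗ.[ℂ] H) (K : Submodule ℂ H) : Prop :=
  ∀ z : ℂ, (∀ v : D.domain, (v : H) ∈ K → D v = z • (v : H) → (v : H) = 0) →
    ∃ R : K →L[ℂ] K, IsCompactOperator R ∧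
      (∀ w : K, ∃ h : (R w : H) ∈ D.domain, D ⟨R w, h⟩ - z • (R w : H) = w) ∧
      (∀ (v : D.domain) (hv : (v : H) ∈ K) (w : K), D v - z • (v : H) = w → R w = ⟨v, hv⟩)

/-- `(A, H, D)`, with the representation `π`, is a (possibly kernel degenerate) spectral triple. -/
structure IsSpectralTriple [CompleteSpace H] {A : Type*} [NonUnitalNonAssocSemiring A]
    [Star A] [Module ℂ A] [TopologicalSpace A] (D : H →ₗ.[ℂ] H) (π : A →⋆ₙₐ[ℂ] (H →L[ℂ] H)) : Prop where
  selfAdjoint : IsSelfAdjoint D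
  faithful : Function.Injective π
  commutator : ∃ A₀ : NonUnitalStarSubalgebra ℂ A, Dense (A₀ : Set A) ∧
    ∀ a ∈ A₀, ∃ T : H →L[ℂ] H, IsCommutator D (π a) T
  compact : HasCompactResolventOn D (kernel D)ᗮ

end SpectralTriple

/-! The crux is the left multiplication a(c ⊗ d) = (ac) ⊗ d - a ⊗ (cd): its formula shows neither
that it is bounded nor that it respects null vectors. Right multiplication (c ⊗ d)a = c ⊗ (da) is
easier, and a unitary symmetry of the space of 1-forms carries one to the other. For a pure jump
form, c ⊗ d is the function (c(x) - c(y))d(y), right multiplication is by a(y) and left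
multiplication by a(x); the symmetry `flip` sends F(x, y) to -F(y, x), which on tensors reads c ⊗ d
↦ ∂(cd) - d ⊗ c and makes sense for every form considered here.

The absence of killing makes E(φ, g) small for large cutoffs φ (`exists_isCompact_energy_lt`). Hence
∂a is the limit of a ⊗ φ_n for a cutoff sequence, and ⟨∂a, ∂b⟩ = E(ā, b) (`inner_grad_grad`). The
isometry of `flip` is then a purely algebraic identity (`flip_identity`). Right multiplication is
controlled on a simple tensor c ⊗ d by integration against the positive measure Γ(c); this does not
add up over sums, but it bounds the growth of the powers of a symmetric operator at each vector,
which already bounds the operator (`LinearMap.norm_le_of_symmetric_of_growth`). Conjugating by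
`flip` gives a contractive star representation `leftRep`, which extends to the uniform closure;
faithfulness is visible on the L² component.

The Leibniz rule `grad_mul`, ∂(af) = a ∂f + a ⊗ f, governs commutators. As ‖a ⊗ f‖² = ∫ |f|² dΓ(a),
the map M_a : f ↦ a ⊗ f is bounded on L² with ‖M_a‖² ≤ ‖Γ(a)‖_∞, and conversely such a bound
controls the density (`gammaSup_le`); so A₀ is closed under products because M_(ab) f = a M_b f +
M_a(bf). The commutator of D with π(a) is (f, ω) ↦ (-M_ā* ω, M_a f).

Since ‖∂a‖² is the energy of a, completeness of the form gives closability of ∂, and together with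
regularity the domain F. For any closed densely defined T the operator (f, ω) ↦ (T* ω, T f) is
self-adjoint. An eigenbasis φ_i of T*T with eigenvalues λ_i produces the eigenvectors (φ_i, ±
λ_i^(-1/2) T φ_i)/√2 with eigenvalues ± √λ_i, which exhaust the orthogonal complement of the kernel;
the resolvent is then a norm limit of finite rank operators. -/

set_option linter.unusedSectionVars false

/-! ### Self-adjointness of off-diagonal operators. -/

namespace LinearPMap

variable {H₁ H₂ : Type*} [NormedAddCommGroup H₁] [InnerProductSpace ℂ H₁] [CompleteSpace H₁]
  [NormedAddCommGroup H₂] [InnerProductSpace ℂ H₂]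

/-- Orthogonal decomposition of `H₁ × H₂` along the graph of a closed operator. -/
lemma exists_graph_decomposition [CompleteSpace H₂] {T : H₁ →ₗ.[ℂ] H₂} (hT : T.IsClosed)
    (y : H₁) (z : H₂) :
    ∃ (g : T.domain) (p : H₁) (q : H₂), y = g + p ∧ z = T g + q ∧
      ∀ f : T.domain, inner ℂ p (f : H₁) + inner ℂ q (T f) = 0 := by
  -- The graph is moved to the L²-product, where it is a closed subspace of a Hilbert space and
  -- orthogonal projection is available.
  set G : Submodule ℂ (WithLp 2 (H₁ × H₂)) :=
    T.graph.comap (WithLp.linearEquiv 2 ℂ (H₁ × H₂)).toLinearMap with hG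
  have hGc : _root_.IsClosed (G : Set (WithLp 2 (H₁ × H₂))) :=
    _root_.IsClosed.preimage (WithLp.prod_continuous_ofLp 2 H₁ H₂) hT
  have : CompleteSpace G := hGc.completeSpace_coe
  obtain ⟨g, hg, r, hr, hgr⟩ := G.exists_add_mem_mem_orthogonal (WithLp.toLp 2 (y, z))
  obtain ⟨g', hg1, hg2⟩ := (mem_graph_iff T).1 (show WithLp.ofLp g ∈ T.graph from hg)
  refine ⟨g', r.fst, r.snd, ?_, ?_, fun f => ?_⟩
  · rw [hg1]; exact congrArg WithLp.fst hgr
  · rw [hg2]; exact congrArg WithLp.snd hgr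
  · have := (Submodule.mem_orthogonal' _ _).1 hr (WithLp.toLp 2 ((f : H₁), T f)) (T.mem_graph f)
    simpa using this

/-- A pair in the double adjoint of a closed densely defined operator belongs to its graph. -/
lemma mem_graph_of_inner_adjoint [CompleteSpace H₂] {T : H₁ →ₗ.[ℂ] H₂} (hT : T.IsClosed)
    (hd : Dense (T.domain : Set H₁)) {y : H₁} {z : H₂}
    (h : ∀ w : T.adjoint.domain, inner ℂ z (w : H₂) = inner ℂ y (T.adjoint w)) :
    ∃ g : T.domain, (g : H₁) = y ∧ T g = z := by
  obtain ⟨g, p, q, rfl, rfl, hpq⟩ := exists_graph_decomposition hT y z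
  -- Orthogonality of (p, q) to the graph of T says precisely that T* q = -p.
  have hq : q ∈ T.adjoint.domain :=
    mem_adjoint_domain_of_exists q ⟨-p, fun x => by
      rw [inner_neg_left]; linear_combination -hpq x⟩
  have hq' : T.adjoint ⟨q, hq⟩ = -p :=
    adjoint_apply_eq hd _ fun x => by rw [inner_neg_left]; linear_combination -hpq x
  have h1 := h ⟨q, hq⟩
  rw [hq', inner_neg_right, inner_add_left, inner_add_left] at h1
  have h2 := congrArg (starRingEnd ℂ) (hpq g)
  rw [RingHom.map_add, inner_conj_symm, inner_conj_symm, RingHom.map_zero] at h2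
  -- Testing the hypothesis on w = q gives ⟨Tg + q, q⟩ = -⟨g + p, p⟩, and the terms with g cancel by
  -- orthogonality, leaving ‖p‖² + ‖q‖² = 0.
  have h3 : (inner ℂ p p : ℂ) + inner ℂ q q = 0 := by linear_combination h1 - h2
  rw [inner_self_eq_norm_sq_to_K, inner_self_eq_norm_sq_to_K] at h3
  have h4 : ‖p‖ ^ 2 + ‖q‖ ^ 2 = 0 := Complex.ofReal_injective (by push_cast; exact h3)
  have hp : p = 0 := by
    rw [← norm_eq_zero]; nlinarith [sq_nonneg ‖p‖, sq_nonneg ‖q‖]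
  have hq : q = 0 := by
    rw [← norm_eq_zero]; nlinarith [sq_nonneg ‖p‖, sq_nonneg ‖q‖]
  exact ⟨g, by simp [hp], by simp [hq]⟩

/-- A vector z orthogonal to dom T* makes (0, z) a pair of the double adjoint, hence of the graph of
T, so z = T 0 = 0. -/
lemma dense_adjoint_domain [CompleteSpace H₂] {T : H₁ →ₗ.[ℂ] H₂} (hT : T.IsClosed)
    (hd : Dense (T.domain : Set H₁)) : Dense (T.adjoint.domain : Set H₂) := by
  rw [Submodule.dense_iff_topologicalClosure_eq_top, Submodule.topologicalClosure_eq_top_iff,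
    Submodule.eq_bot_iff]
  intro z hz
  obtain ⟨g, hg, hgz⟩ := mem_graph_of_inner_adjoint hT hd (y := 0) (z := z) fun w => by
    rw [inner_zero_left]
    exact (Submodule.mem_orthogonal' _ _).1 hz w w.2
  have : g = 0 := Subtype.ext hg
  rw [← hgz, this, map_zero]

/-- The operator `(f, ω) ↦ (T* ω, T f)` on `dom T ⊕ dom T*`. -/
noncomputable def offDiag (T : H₁ →ₗ.[ℂ] H₂) : WithLp 2 (H₁ × H₂) →ₗ.[ℂ] WithLp 2 (H₁ × H₂) where
  domain := (T.domain.prod T.adjoint.domain).comap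
    (WithLp.linearEquiv 2 ℂ (H₁ × H₂)).toLinearMap
  toFun :=
    { toFun := fun v => WithLp.toLp 2
        (T.adjoint ⟨(v : WithLp 2 (H₁ × H₂)).snd, v.2.2⟩, T ⟨(v : WithLp 2 (H₁ × H₂)).fst, v.2.1⟩)
      map_add' := fun v w => by
        rw [← WithLp.toLp_add, Prod.mk_add_mk, ← LinearPMap.map_add, ← LinearPMap.map_add]
        rfl
      map_smul' := fun c v => by
        rw [RingHom.id_apply, ← WithLp.toLp_smul, Prod.smul_mk, ← LinearPMap.map_smul,
          ← LinearPMap.map_smul]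
        rfl }

variable {T : H₁ →ₗ.[ℂ] H₂}

lemma offDiag_apply (v : (offDiag T).domain) : offDiag T v = WithLp.toLp 2
    (T.adjoint ⟨(v : WithLp 2 (H₁ × H₂)).snd, v.2.2⟩, T ⟨(v : WithLp 2 (H₁ × H₂)).fst, v.2.1⟩) :=
  rfl

lemma dense_offDiag_domain [CompleteSpace H₂] (hT : T.IsClosed) (hd : Dense (T.domain : Set H₁)) :
    Dense ((offDiag T).domain : Set (WithLp 2 (H₁ × H₂))) := by
  have h := (hd.prod (dense_adjoint_domain hT hd)).preimage
    (WithLp.homeomorphProd 2 H₁ H₂).isOpenMap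
  exact h

/-- Symmetry gives one inclusion. For the other, a vector y of the adjoint domain is tested on (f,
0), which puts its second component in dom T*, and on (0, w), which puts its first component in dom
T** = dom T. -/
theorem isSelfAdjoint_offDiag [CompleteSpace H₂] (hT : T.IsClosed)
    (hd : Dense (T.domain : Set H₁)) :
    IsSelfAdjoint (offDiag T) := by
  have hdD := dense_offDiag_domain hT hd
  have hf : (offDiag T).IsFormalAdjoint (offDiag T) := by
    intro v w
    have h1 := adjoint_isFormalAdjoint hd
    have e1 := h1 ⟨(v : WithLp 2 (H₁ × H₂)).snd, v.2.2⟩ ⟨(w : WithLp 2 (H₁ × H₂)).fst, w.2.1⟩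
    have e2 := h1.symm ⟨(v : WithLp 2 (H₁ × H₂)).fst, v.2.1⟩
      ⟨(w : WithLp 2 (H₁ × H₂)).snd, w.2.2⟩
    rw [offDiag_apply, offDiag_apply, WithLp.prod_inner_apply, WithLp.prod_inner_apply]
    change inner ℂ _ _ + inner ℂ _ _ = inner ℂ _ _ + inner ℂ _ _
    rw [add_comm]
    exact congrArg₂ (· + ·) e2 e1
  rw [isSelfAdjoint_def]
  refine (eq_of_le_of_domain_eq (hf.le_adjoint hdD) (le_antisymm (hf.le_adjoint hdD).1 ?_)).symm
  intro y hy
  have key := adjoint_isFormalAdjoint hdD ⟨y, hy⟩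
  set z := (offDiag T).adjoint ⟨y, hy⟩
  have k1 : ∀ f : T.domain, inner ℂ z.fst (f : H₁) = inner ℂ y.snd (T f) := by
    intro f
    have := key ⟨WithLp.toLp 2 ((f : H₁), 0), ⟨f.2, zero_mem _⟩⟩
    rw [offDiag_apply, WithLp.prod_inner_apply, WithLp.prod_inner_apply] at this
    have h0 : T.adjoint ⟨0, zero_mem _⟩ = 0 := map_zero T.adjoint
    simpa [h0] using this
  have k2 : ∀ w : T.adjoint.domain, inner ℂ z.snd (w : H₂) = inner ℂ y.fst (T.adjoint w) := by
    intro w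
    have := key ⟨WithLp.toLp 2 (0, (w : H₂)), ⟨zero_mem _, w.2⟩⟩
    rw [offDiag_apply, WithLp.prod_inner_apply, WithLp.prod_inner_apply] at this
    have h0 : T ⟨0, zero_mem _⟩ = 0 := map_zero T
    simpa [h0] using this
  refine ⟨?_, mem_adjoint_domain_of_exists _ ⟨_, k1⟩⟩
  obtain ⟨g, hg, -⟩ := mem_graph_of_inner_adjoint hT hd k2
  change y.fst ∈ T.domain
  exact hg ▸ g.2

end LinearPMap

/-! ### Compact resolvents from a complete system of eigenvectors. -/

section CompactResolvent

variable {H : Type*} [NormedAddCommGroup H] [InnerProductSpace ℂ H] [CompleteSpace H]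

/-- By Pythagoras and Bessel. The bound is uniform in the finite set, so small coefficients give
small blocks in operator norm. -/
lemma Orthonormal.norm_sum_smul_inner_le {κ K : Type*} [NormedAddCommGroup K]
    [InnerProductSpace ℂ K] {b : κ → K} (hb : Orthonormal ℂ b) (c : κ → ℂ) (t : Finset κ)
    {ε : ℝ} (hε : 0 ≤ ε) (hc : ∀ j ∈ t, ‖c j‖ ≤ ε) (w : K) :
    ‖∑ j ∈ t, (c j * inner ℂ (b j) w) • b j‖ ≤ ε * ‖w‖ := by
  refine abs_le_of_sq_le_sq' ?_ (by positivity) |>.2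
  have h1 : ‖∑ j ∈ t, (c j * inner ℂ (b j) w) • b j‖ ^ 2
      = ∑ j ∈ t, ‖c j * inner ℂ (b j) w‖ ^ 2 := by
    have := hb.inner_sum (fun j => c j * inner ℂ (b j) w) (fun j => c j * inner ℂ (b j) w) t
    rw [inner_self_eq_norm_sq_to_K] at this
    simp only [RCLike.conj_mul] at this
    exact_mod_cast this
  rw [h1, mul_pow]
  calc ∑ j ∈ t, ‖c j * inner ℂ (b j) w‖ ^ 2
      ≤ ∑ j ∈ t, ε ^ 2 * ‖inner ℂ (b j) w‖ ^ 2 := by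
        refine Finset.sum_le_sum fun j hj => ?_
        rw [norm_mul, mul_pow]
        gcongr
        exact hc j hj
    _ ≤ ε ^ 2 * ‖w‖ ^ 2 := by
        rw [← Finset.mul_sum]
        gcongr
        exact hb.sum_inner_products_le w

/-- The diagonal operator with coefficients tending to zero is compact. -/
lemma HilbertBasis.exists_diagonal {κ K : Type*} [NormedAddCommGroup K]
    [InnerProductSpace ℂ K] [CompleteSpace K] (b : HilbertBasis κ ℂ K) (c : κ → ℂ)
    (hc : Tendsto c cofinite (𝓝 0)) :
    ∃ R : K →L[ℂ] K, IsCompactOperator R ∧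
      ∀ w, HasSum (fun j => (c j * inner ℂ (b j) w) • b j) (R w) := by
  set P : κ → K →L[ℂ] K := fun j => c j • InnerProductSpace.rankOne ℂ (b j) (b j) with hP
  have hPw : ∀ j w, P j w = (c j * inner ℂ (b j) w) • b j := fun j w => by
    simp [hP, smul_smul]
  -- Cauchy criterion in operator norm: away from the finite set where ‖c j‖ ≥ ε / 2, every finite
  -- block has norm at most ε / 2. The sum is thus a norm limit of finite rank operators.
  have hsum : Summable P := by
    rw [summable_iff_vanishing_norm]
    intro ε hε
    have h1 : ∀ᶠ j in cofinite, ‖c j‖ < ε / 2 := by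
      have := hc.norm
      rw [norm_zero] at this
      exact this.eventually_lt_const (by positivity)
    refine ⟨Set.Finite.toFinset (eventually_cofinite.1 h1), fun t ht => ?_⟩
    refine lt_of_le_of_lt (ContinuousLinearMap.opNorm_le_bound _ (by positivity : 0 ≤ ε / 2)
      fun w => ?_) (by linarith)
    rw [sum_apply]
    simp only [hPw]
    refine b.orthonormal.norm_sum_smul_inner_le c t (by positivity) (fun j hj => ?_) w
    by_contra hcon
    exact Finset.disjoint_left.1 ht hj ((Set.Finite.mem_toFinset _).2 fun h => hcon h.le)
  refine ⟨∑' j, P j, ?_, fun w => ?_⟩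
  · refine isCompactOperator_of_tendsto hsum.hasSum (Eventually.of_forall fun s => ?_)
    have hs : (∑ j ∈ s, P j) ∈ compactOperator (RingHom.id ℂ) K K := by
      refine Submodule.sum_mem _ fun j _ => ?_
      refine Submodule.smul_mem _ _ ?_
      rw [InnerProductSpace.rankOne_def']
      exact ((isCompactOperator_id (E := ℂ)).comp_clm (innerSL ℂ (b j))).clm_comp
        (ContinuousLinearMap.toSpanSingleton ℂ (b j))
    exact hs
  · have := hsum.hasSum.mapL (ContinuousLinearMap.apply ℂ K w)
    simpa [hPw] using this

/-- A self-adjoint operator with a complete orthonormal system of eigenvectors in `K` whose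
eigenvalues tend to infinity in modulus has compact resolvents on `K`. -/
theorem hasCompactResolventOn_of_eigenvectors {D : H →ₗ.[ℂ] H} (hD : IsSelfAdjoint D)
    (K : Submodule ℂ H) [CompleteSpace K] {κ : Type*} (e : κ → D.domain)
    (heK : ∀ j, (e j : H) ∈ K) (he : Orthonormal ℂ fun j => (e j : H)) (r : κ → ℂ)
    (hr : ∀ j, D (e j) = r j • (e j : H)) (hlim : Tendsto (fun j => ‖r j‖) cofinite atTop)
    (hcomp : ∀ w ∈ K, (∀ j, inner ℂ (e j : H) w = 0) → w = 0) :
    HasCompactResolventOn D K := by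
  intro z hz
  have hrz : ∀ j, r j - z ≠ 0 := by
    intro j hj
    have := hz (e j) (heK j) (by rw [hr, sub_eq_zero.1 hj])
    exact he.ne_zero j this
  have hbo : Orthonormal ℂ fun j => (⟨e j, heK j⟩ : K) := by
    classical
    rw [orthonormal_iff_ite] at he ⊢
    exact he
  have hbot : (Submodule.span ℂ (Set.range fun j => (⟨e j, heK j⟩ : K)))ᗮ = ⊥ := by
    rw [Submodule.eq_bot_iff]
    intro w hw
    refine Subtype.ext (hcomp w w.2 fun j => ?_)
    exact (Submodule.mem_orthogonal _ _).1 hw ⟨e j, heK j⟩ (Submodule.subset_span ⟨j, rfl⟩)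
  set b : HilbertBasis κ ℂ K := HilbertBasis.mkOfOrthogonalEqBot hbo hbot with hb
  have hbj : ∀ j, b j = ⟨e j, heK j⟩ := fun j => by
    rw [hb, HilbertBasis.coe_mkOfOrthogonalEqBot]
  obtain ⟨R, hRc, hR⟩ := b.exists_diagonal (fun j => (r j - z)⁻¹) (by
    rw [tendsto_zero_iff_norm_tendsto_zero]
    simp only [norm_inv]
    refine tendsto_inv_atTop_zero.comp (tendsto_atTop_mono (fun j => ?_)
      (tendsto_atTop_add_const_right cofinite (-‖z‖) hlim))
    have := norm_sub_norm_le (r j) z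
    linarith)
  -- The partial sums of the two series form pairs in the graph, because r_j / (r_j - z) = 1 + z /
  -- (r_j - z); closedness of D passes this to the limit, so that D R w = w + z R w.
  have hmem : ∀ w : K, ((R w : H), (w : H) + z • (R w : H)) ∈ D.graph := by
    intro w
    have h1 : HasSum (fun j => ((((r j - z)⁻¹ * inner ℂ (b j) w) • b j : K) : H)) (R w : H) :=
      (hR w).mapL K.subtypeL
    have h2 : HasSum (fun j => ((inner ℂ (b j) w • b j : K) : H)) (w : H) := by
      have := (b.hasSum_repr w).mapL K.subtypeL
      simp only [b.repr_apply_apply] at this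
      exact this
    have h3 := h2.add (h1.const_smul z)
    refine hD.isClosed.mem_of_tendsto (h1.prodMk_nhds h3) (Eventually.of_forall fun s => ?_)
    have hsum : ∀ j, (((((r j - z)⁻¹ * inner ℂ (b j) w) • b j : K) : H),
        ((inner ℂ (b j) w • b j : K) : H)
          + z • ((((r j - z)⁻¹ * inner ℂ (b j) w) • b j : K) : H)) ∈ D.graph := by
      intro j
      have := D.graph.smul_mem ((r j - z)⁻¹ * inner ℂ (b j) w) (D.mem_graph (e j))
      convert this using 1
      rw [Prod.smul_mk, hr, Submodule.coe_smul, Submodule.coe_smul, hbj]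
      refine Prod.ext rfl ?_
      simp only
      rw [smul_smul, smul_smul, ← add_smul]
      congr 1
      field_simp [hrz j]
      ring
    have := D.graph.sum_mem (t := s) fun j _ => hsum j
    have hs : ∀ f g : κ → H, ∑ j ∈ s, (f j, g j) = (∑ j ∈ s, f j, ∑ j ∈ s, g j) := fun f g =>
      Prod.ext (Prod.fst_sum ..) (Prod.snd_sum ..)
    rwa [hs] at this
  have hdom : ∀ w : K, ∃ h : (R w : H) ∈ D.domain, D ⟨R w, h⟩ = (w : H) + z • (R w : H) := by
    intro w
    obtain ⟨y, hy1, hy2⟩ := (LinearPMap.mem_graph_iff D).1 (hmem w)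
    simp only at hy1 hy2
    exact ⟨hy1 ▸ y.2, by rw [← hy2]; congr 1; exact Subtype.ext hy1.symm⟩
  refine ⟨R, hRc, fun w => ?_, fun v hv w hvw => ?_⟩
  · obtain ⟨h, h'⟩ := hdom w
    exact ⟨h, by rw [h', add_sub_cancel_right]⟩
  · obtain ⟨h, h'⟩ := hdom w
    -- Two solutions differ by an eigenvector for z in K or by zero, and z is not an eigenvalue.
    have := hz (⟨R w, h⟩ - v) (K.sub_mem (R w).2 hv) (by
      rw [LinearPMap.map_sub, h', AddSubgroupClass.coe_sub, smul_sub, ← hvw]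
      abel)
    exact Subtype.ext (sub_eq_zero.1 this)

end CompactResolvent

/-! ### Compact resolvents of off-diagonal operators. -/

namespace LinearPMap

variable {H₁ H₂ : Type*} [NormedAddCommGroup H₁] [InnerProductSpace ℂ H₁] [CompleteSpace H₁]
  [NormedAddCommGroup H₂] [InnerProductSpace ℂ H₂] [CompleteSpace H₂]

lemma offDiag_eq_zero {T : H₁ →ₗ.[ℂ] H₂} (v : (offDiag T).domain)
    (h1 : T ⟨(v : WithLp 2 (H₁ × H₂)).fst, v.2.1⟩ = 0)
    (h2 : T.adjoint ⟨(v : WithLp 2 (H₁ × H₂)).snd, v.2.2⟩ = 0) : offDiag T v = 0 := by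
  rw [offDiag_apply, h1, h2]
  rfl

/-- This is the completeness of the eigenvectors on the second component. Writing (0, w.snd) = (g, T
g) + (p, q) with (p, q) orthogonal to the graph, and testing on φ_i, gives (1 + ev i)⟨φ_i, g⟩ = 0,
so g = 0. Then w.snd is orthogonal to the range of T, so w lies in the kernel as well as in its
orthogonal complement. -/
lemma eq_zero_of_forall_inner_eq_zero {T : H₁ →ₗ.[ℂ] H₂} (hT : T.IsClosed)
    (hd : Dense (T.domain : Set H₁)) {ι : Type*} (φ : ι → T.domain)
    (hcomp : ∀ f : H₁, (∀ i, inner ℂ (φ i : H₁) f = 0) → f = 0) (ev : ι → ℝ)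
    (hev : ∀ i (g : T.domain), inner ℂ (T (φ i)) (T g) = ev i * inner ℂ (φ i : H₁) (g : H₁))
    (hev0 : ∀ i, 0 ≤ ev i) {w : WithLp 2 (H₁ × H₂)} (hw : w ∈ (kernel (offDiag T))ᗮ)
    (hf : w.fst = 0) (h1 : ∀ i, inner ℂ (T (φ i)) w.snd = 0) : w = 0 := by
  -- `w.snd` is orthogonal to the range of `T`
  obtain ⟨g, p, q, hp, hq, hpq⟩ := exists_graph_decomposition hT 0 w.snd
  have hrange : ∀ f : T.domain, inner ℂ (g : H₁) (f : H₁) + inner ℂ (T g) (T f)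
      = inner ℂ w.snd (T f) := by
    intro f
    rw [hq, inner_add_left]
    have hgp : (g : H₁) = -p := eq_neg_of_add_eq_zero_left hp.symm
    rw [hgp, inner_neg_left]
    linear_combination -hpq f
  have hg : (g : H₁) = 0 := by
    refine hcomp _ fun i => ?_
    have h2 := hrange (φ i)
    have h3 : inner ℂ w.snd (T (φ i)) = (0 : ℂ) := by
      rw [← inner_conj_symm, h1 i, RingHom.map_zero]
    have h4 : inner ℂ (φ i : H₁) (g : H₁) + inner ℂ (T (φ i)) (T g) = (0 : ℂ) := by
      rw [← inner_conj_symm (φ i : H₁), ← inner_conj_symm (T (φ i)), ← RingHom.map_add, h2, h3,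
        RingHom.map_zero]
    rw [hev] at h4
    have h5 : (1 + ev i : ℂ) * inner ℂ (φ i : H₁) (g : H₁) = 0 := by linear_combination h4
    refine (mul_eq_zero.1 h5).resolve_left ?_
    have := hev0 i
    have h6 : (1 + ev i : ℝ) ≠ 0 := by positivity
    exact_mod_cast h6
  have hg0 : g = 0 := Subtype.ext hg
  have hort : ∀ f : T.domain, inner ℂ (0 : H₁) (f : H₁) = inner ℂ w.snd (T f) := fun f => by
    rw [← hrange f, hg0, map_zero]
    simp
  have hdom : w.snd ∈ T.adjoint.domain := mem_adjoint_domain_of_exists _ ⟨0, hort⟩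
  have hval : T.adjoint ⟨w.snd, hdom⟩ = 0 := adjoint_apply_eq hd _ hort
  have hwD : w ∈ (offDiag T).domain := ⟨(hf ▸ zero_mem _ : w.fst ∈ T.domain), hdom⟩
  have hw0 : inner ℂ w w = (0 : ℂ) := (Submodule.mem_orthogonal _ _).1 hw w
    ⟨⟨w, hwD⟩, offDiag_eq_zero _
      (by rw [show (⟨w.fst, hwD.1⟩ : T.domain) = 0 from Subtype.ext hf, map_zero]) hval, rfl⟩
  exact inner_self_eq_zero.1 hw0

set_option maxHeartbeats 1000000 in
/-- If `T* T` has a complete orthonormal system of eigenvectors with eigenvalues tending to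
infinity, then the off-diagonal operator has compact resolvents off its kernel. -/
theorem hasCompactResolventOn_offDiag {T : H₁ →ₗ.[ℂ] H₂} (hT : T.IsClosed)
    (hd : Dense (T.domain : Set H₁)) {ι : Type*} (φ : ι → T.domain)
    (hφ : Orthonormal ℂ fun i => (φ i : H₁))
    (hcomp : ∀ f : H₁, (∀ i, inner ℂ (φ i : H₁) f = 0) → f = 0) (ev : ι → ℝ)
    (hev : ∀ i (g : T.domain), inner ℂ (T (φ i)) (T g) = ev i * inner ℂ (φ i : H₁) (g : H₁))
    (hlim : Tendsto ev cofinite atTop) :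
    HasCompactResolventOn (offDiag T) (kernel (offDiag T))ᗮ := by
  classical
  have hφ1 : ∀ i, inner ℂ (φ i : H₁) (φ i : H₁) = (1 : ℂ) := fun i => by
    rw [inner_self_eq_norm_sq_to_K, hφ.norm_eq_one]; simp
  have hTT : ∀ i j, inner ℂ (T (φ i)) (T (φ j)) = if i = j then (ev i : ℂ) else 0 := fun i j => by
    rw [hev, orthonormal_iff_ite.1 hφ]; split_ifs <;> simp
  have hev0 : ∀ i, 0 ≤ ev i := fun i => by
    have h := hTT i i
    rw [if_pos rfl, inner_self_eq_norm_sq_to_K] at h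
    have : ‖T (φ i)‖ ^ 2 = ev i := Complex.ofReal_injective (by push_cast; exact h)
    rw [← this]; positivity
  have hzero : ∀ i, ev i = 0 → T (φ i) = 0 := fun i hi => by
    have h := hTT i i
    rw [if_pos rfl, hi, Complex.ofReal_zero] at h
    exact inner_self_eq_zero.1 h
  have hadj : ∀ i, T (φ i) ∈ T.adjoint.domain := fun i =>
    mem_adjoint_domain_of_exists _ ⟨(ev i : ℂ) • (φ i : H₁), fun g => by
      rw [hev, inner_smul_left, Complex.conj_ofReal]⟩
  have hadj' : ∀ i, T.adjoint ⟨T (φ i), hadj i⟩ = (ev i : ℂ) • (φ i : H₁) := fun i =>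
    adjoint_apply_eq hd _ fun g => by rw [hev, inner_smul_left, Complex.conj_ofReal]
  have hsa := isSelfAdjoint_offDiag hT hd
  let D := offDiag T
  -- the eigenvectors are `(φ i, ± (ev i)^(-1/2) T φ i) / √2`
  let κ := {i // ev i ≠ 0} × Bool
  let sg : Bool → ℝ := fun s => if s then 1 else -1
  have hsg : ∀ s, sg s * sg s = 1 := fun s => by cases s <;> simp [sg]
  let rt : κ → ℝ := fun j => sg j.2 * √(ev j.1)
  have hrt0 : ∀ j : κ, √(ev j.1) ≠ 0 := fun j =>
    (Real.sqrt_pos.2 (lt_of_le_of_ne (hev0 _) (Ne.symm j.1.2))).ne'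
  have hrt2 : ∀ j : κ, rt j * rt j = ev j.1 := fun j => by
    have h1 := Real.mul_self_sqrt (hev0 j.1)
    have h2 := hsg j.2
    simp only [rt]
    linear_combination (√(ev j.1) * √(ev j.1)) * h2 + h1
  have hrtne : ∀ j : κ, rt j ≠ 0 := fun j h => j.1.2 (by rw [← hrt2, h, mul_zero])
  -- The same i occurs exactly twice, with opposite signs; this is the only case in which
  -- orthogonality is not inherited from the φ_i.
  have hsign : ∀ j k : κ, (j.1 : ι) = k.1 → j = k ∨ j ≠ k ∧ rt k = -rt j := by
    rintro ⟨⟨i, hi⟩, s⟩ ⟨⟨i', hi'⟩, s'⟩ hjk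
    obtain rfl : i = i' := hjk
    by_cases hs : s = s'
    · exact Or.inl (by rw [hs])
    · refine Or.inr ⟨fun h => hs (congrArg Prod.snd h), ?_⟩
      cases s <;> cases s' <;> simp_all [rt, sg]
  -- For one i the two components contribute 1 + 1 when the signs agree and, in `aux'`, 1 - 1 when
  -- they differ.
  have aux : ∀ r : ℝ, (r : ℂ) ≠ 0 → (1 : ℂ) + (r : ℂ)⁻¹ * ((r : ℂ)⁻¹ * (r * r : ℝ)) = 2 := by
    intro r hr
    push_cast
    field_simp
    norm_num
  have aux' : ∀ r : ℝ, (r : ℂ) ≠ 0 →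
      (1 : ℂ) + (r : ℂ)⁻¹ * (((-r : ℝ) : ℂ)⁻¹ * (r * r : ℝ)) = 0 := by
    intro r hr
    push_cast
    field_simp
    norm_num
  let e₀ : κ → WithLp 2 (H₁ × H₂) := fun j =>
    WithLp.toLp 2 ((φ j.1 : H₁), ((rt j)⁻¹ : ℂ) • T (φ j.1))
  have he₀ : ∀ j, e₀ j ∈ D.domain := fun j => ⟨(φ j.1).2, Submodule.smul_mem _ _ (hadj _)⟩
  have hDe₀ : ∀ j, D ⟨e₀ j, he₀ j⟩ = (rt j : ℂ) • e₀ j := by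
    intro j
    have h1 : T.adjoint ⟨((rt j)⁻¹ : ℂ) • T (φ j.1), Submodule.smul_mem _ _ (hadj _)⟩
        = (rt j : ℂ) • (φ j.1 : H₁) := by
      have : (⟨((rt j)⁻¹ : ℂ) • T (φ j.1), Submodule.smul_mem _ _ (hadj _)⟩ : T.adjoint.domain)
        = ((rt j)⁻¹ : ℂ) • ⟨T (φ j.1), hadj _⟩ := rfl
      rw [this, LinearPMap.map_smul, hadj', smul_smul, ← hrt2 j]
      congr 1
      push_cast
      have := hrtne j
      field_simp
    rw [offDiag_apply, ← WithLp.toLp_smul, Prod.smul_mk, smul_smul,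
      mul_inv_cancel₀ (by exact_mod_cast hrtne j), one_smul]
    exact congrArg (WithLp.toLp 2) (Prod.ext h1 rfl)
  -- Each `e₀ j` has squared norm 2, hence this normalisation.
  let c : ℂ := ((√2)⁻¹ : ℝ)
  have hc : starRingEnd ℂ c * c = 1 / 2 := by
    simp only [c, Complex.conj_ofReal]
    rw [← Complex.ofReal_mul, ← mul_inv, Real.mul_self_sqrt zero_le_two]
    norm_num
  have hinner : ∀ j k : κ, inner ℂ (e₀ j) (e₀ k) = if j = k then (2 : ℂ) else 0 := by
    intro j k
    rw [WithLp.prod_inner_apply]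
    change inner ℂ (φ j.1 : H₁) (φ k.1 : H₁)
      + inner ℂ (((rt j)⁻¹ : ℂ) • T (φ j.1)) (((rt k)⁻¹ : ℂ) • T (φ k.1)) = _
    rw [inner_smul_left, inner_smul_right, hTT, orthonormal_iff_ite.1 hφ, map_inv₀,
      Complex.conj_ofReal]
    by_cases hjk : (j.1 : ι) = k.1
    · rw [if_pos hjk, if_pos hjk, ← hrt2 j]
      rcases hsign j k hjk with rfl | ⟨hne, hrk⟩
      · rw [if_pos rfl]
        exact aux _ (by exact_mod_cast hrtne j)
      · rw [if_neg hne, hrk]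
        exact aux' _ (by exact_mod_cast hrtne j)
    · rw [if_neg hjk, if_neg hjk, if_neg fun h => hjk (by rw [h]), mul_zero, mul_zero, add_zero]
  refine hasCompactResolventOn_of_eigenvectors hsa (kernel D)ᗮ
    (fun j => ⟨c • e₀ j, Submodule.smul_mem _ _ (he₀ j)⟩) ?_ ?_ (fun j => (rt j : ℂ)) ?_ ?_ ?_
  · intro j
    refine Submodule.smul_mem _ _ ((Submodule.mem_orthogonal _ _).2 ?_)
    rintro _ ⟨v, hv, rfl⟩
    have hv' : D v = 0 := hv
    have hsym : D.IsFormalAdjoint D := by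
      have := adjoint_isFormalAdjoint hsa.dense_domain
      rwa [isSelfAdjoint_def.1 hsa] at this
    -- By symmetry, an eigenvector with nonzero eigenvalue is orthogonal to the kernel.
    have := hsym v ⟨e₀ j, he₀ j⟩
    rw [hv', hDe₀, inner_zero_left, inner_smul_right] at this
    exact (mul_eq_zero.1 this.symm).resolve_left (by exact_mod_cast hrtne j)
  · rw [orthonormal_iff_ite]
    intro j k
    simp only
    rw [inner_smul_left, inner_smul_right, hinner, ← mul_assoc, hc]
    split_ifs <;> norm_num
  · intro j
    have : (⟨c • e₀ j, Submodule.smul_mem _ _ (he₀ j)⟩ : D.domain) = c • ⟨e₀ j, he₀ j⟩ := rfl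
    rw [this, LinearPMap.map_smul, hDe₀, smul_comm]
    rfl
  · have h1 : ∀ j : κ, ‖(rt j : ℂ)‖ = √(ev j.1) := fun j => by
      rw [Complex.norm_real]
      cases h : j.2 <;> simp [rt, sg, h, abs_of_nonneg]
    simp only [h1]
    -- Each i carries at most two signed indices, so cofinite convergence pulls back.
    have h2 : Tendsto (fun j : κ => (j.1 : ι)) cofinite cofinite := by
      refine Tendsto.cofinite_of_finite_preimage_singleton fun i => ?_
      by_cases hi : ev i = 0
      · refine Set.Finite.subset Set.finite_empty fun j hj => j.1.2 ?_
        rw [show (j.1 : ι) = i from hj, hi]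
      · refine Set.Finite.subset (Set.finite_range fun s : Bool => ((⟨i, hi⟩, s) : κ)) ?_
        rintro ⟨⟨i', hi'⟩, s⟩ hj
        obtain rfl : i' = i := hj
        exact ⟨s, rfl⟩
    exact Real.tendsto_sqrt_atTop.comp (hlim.comp h2)
  · intro w hw hw0
    have hk : ∀ v : D.domain, D v = 0 → inner ℂ (v : WithLp 2 (H₁ × H₂)) w = 0 := fun v hv =>
      (Submodule.mem_orthogonal _ _).1 hw v ⟨v, hv, rfl⟩
    have h1 : ∀ i, inner ℂ (φ i : H₁) w.fst = 0 ∧ inner ℂ (T (φ i)) w.snd = 0 := by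
      intro i
      by_cases hi : ev i = 0
      · have hmem : WithLp.toLp 2 ((φ i : H₁), (0 : H₂)) ∈ D.domain := ⟨(φ i).2, zero_mem _⟩
        have := hk ⟨_, hmem⟩ (offDiag_eq_zero _ (hzero i hi) (map_zero T.adjoint))
        rw [WithLp.prod_inner_apply] at this
        change inner ℂ (φ i : H₁) w.fst + inner ℂ (0 : H₂) w.snd = 0 at this
        rw [inner_zero_left, add_zero] at this
        exact ⟨this, by rw [hzero i hi, inner_zero_left]⟩
      -- The two signs give equations x + y = 0 and x - y = 0 for the two components. When ev i = 0,
      -- treated before, (φ_i, 0) itself lies in the kernel.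
      · have key : ∀ s, inner ℂ (φ i : H₁) w.fst
            + (rt (⟨i, hi⟩, s) : ℂ)⁻¹ * inner ℂ (T (φ i)) w.snd = 0 := by
          intro s
          have h := hw0 (⟨i, hi⟩, s)
          rw [inner_smul_left] at h
          have hc0 : starRingEnd ℂ c ≠ 0 := fun h0 => by rw [h0] at hc; norm_num at hc
          have h' := (mul_eq_zero.1 h).resolve_left hc0
          rw [WithLp.prod_inner_apply] at h'
          change inner ℂ (φ i : H₁) w.fst
            + inner ℂ ((rt (⟨i, hi⟩, s) : ℂ)⁻¹ • T (φ i)) w.snd = 0 at h'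
          rwa [inner_smul_left, map_inv₀, Complex.conj_ofReal] at h'
        have hneg : rt (⟨i, hi⟩, false) = - rt (⟨i, hi⟩, true) := by simp [rt, sg]
        have k1 := key true
        have k2 := key false
        have hj' : (rt (⟨i, hi⟩, true) : ℂ) ≠ 0 := by exact_mod_cast hrtne (⟨i, hi⟩, true)
        rw [hneg, Complex.ofReal_neg, inv_neg] at k2
        refine ⟨by linear_combination (k1 + k2) / 2, ?_⟩
        have : (rt (⟨i, hi⟩, true) : ℂ)⁻¹ * inner ℂ (T (φ i)) w.snd = 0 := by
          linear_combination (k1 - k2) / 2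
        exact (mul_eq_zero.1 this).resolve_left (inv_ne_zero hj')
    exact eq_zero_of_forall_inner_eq_zero hT hd φ hcomp ev hev hev0 hw (hcomp _ fun i => (h1 i).1)
      fun i => (h1 i).2

end LinearPMap

/-! ### Norm bounds for symmetric operators from the growth of powers. -/

section SymmetricBound

/-- If the ratio q = a 1 / a 0 exceeded M, iterated doubling would give a (2 ^ n) ≥ a 0 q^(2^n),
which eventually beats C M^(2^n) whatever C is. The constant C therefore leaves no trace in the
conclusion. -/
lemma le_mul_of_sq_le_mul_double {a : ℕ → ℝ} (ha : ∀ k, 0 ≤ a k)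
    (hsq : ∀ k, a k ^ 2 ≤ a 0 * a (2 * k)) {C M : ℝ} (hM : 0 ≤ M) (hC : ∀ k, a k ≤ C * M ^ k) :
    a 1 ≤ M * a 0 := by
  by_contra hcon
  push Not at hcon
  have h0 : 0 < a 0 := by
    refine lt_of_le_of_ne (ha 0) fun h => ?_
    have := hsq 1
    rw [← h] at this hcon
    nlinarith [ha 1]
  set q := a 1 / a 0 with hq
  have hMq : M < q := by rw [hq, lt_div_iff₀ h0]; exact hcon
  have hq0 : 0 < q := hM.trans_lt hMq
  have hlow : ∀ n : ℕ, a 0 * q ^ (2 ^ n) ≤ a (2 ^ n) := by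
    intro n
    induction n with
    | zero => rw [pow_zero, pow_one, hq, mul_div_cancel₀ _ h0.ne']
    | succ n ih =>
      have h1 := hsq (2 ^ n)
      have h2 : (a 0 * q ^ (2 ^ n)) ^ 2 ≤ a (2 ^ n) ^ 2 := by gcongr
      rw [pow_succ' 2 n, pow_mul', ← mul_le_mul_iff_right₀ h0]
      refine le_trans (le_of_eq ?_) (h2.trans h1)
      ring
  have hle : ∀ n : ℕ, a 0 ≤ C * (M / q) ^ (2 ^ n) := by
    intro n
    rw [div_pow, ← mul_div_assoc, le_div_iff₀ (by positivity)]
    exact (hlow n).trans (hC _)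
  have hlim : Tendsto (fun n : ℕ => C * (M / q) ^ (2 ^ n)) atTop (𝓝 (C * 0)) :=
    ((tendsto_pow_atTop_nhds_zero_of_lt_one (by positivity) ((div_lt_one hq0).2 hMq)).comp
      (tendsto_pow_atTop_atTop_of_one_lt one_lt_two)).const_mul C
  rw [mul_zero] at hlim
  exact absurd (ge_of_tendsto' hlim hle) (not_le.2 h0)

/-- A symmetric operator on a pre-Hilbert space whose powers have local growth rate at most `M` is
bounded by `M`. -/
lemma LinearMap.norm_le_of_symmetric_of_growth {V : Type*} [SeminormedAddCommGroup V]
    [InnerProductSpace ℂ V] (T : V →ₗ[ℂ] V) (hT : ∀ x y, inner ℂ (T x) y = inner ℂ x (T y))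
    {M : ℝ} (hM : 0 ≤ M) (x : V) {C : ℝ} (hC : ∀ k : ℕ, ‖(T ^ k) x‖ ≤ C * M ^ k) :
    ‖T x‖ ≤ M * ‖x‖ := by
  have hpow : ∀ (k : ℕ) (x y : V), inner ℂ ((T ^ k) x) y = inner ℂ x ((T ^ k) y) := by
    intro k
    induction k with
    | zero => intro x y; rfl
    | succ k ih =>
      intro x y
      rw [pow_succ', Module.End.mul_apply, hT, ih, ← Module.End.mul_apply, ← pow_succ,
        ← pow_succ']
  have := le_mul_of_sq_le_mul_double (a := fun k => ‖(T ^ k) x‖) (fun k => norm_nonneg _)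
    (fun k => ?_) hM hC
  · simpa using this
  -- Symmetry gives ‖T^k x‖² = |⟨x, T^(2k) x⟩|, and Cauchy–Schwarz is then the doubling inequality.
  · have h1 : ‖(T ^ k) x‖ ^ 2 = ‖(inner ℂ x ((T ^ (2 * k)) x) : ℂ)‖ := by
      rw [two_mul, pow_add, Module.End.mul_apply, ← hpow, inner_self_eq_norm_sq_to_K]
      simp
    rw [h1, pow_zero, Module.End.one_apply]
    exact norm_inner_le_norm _ _

end SymmetricBound

/-! ### Extension of contractive star homomorphisms to the closure. -/

section StarHomExtension

variable {A : Type*} [NonUnitalNormedRing A] [StarRing A] [NormedStarGroup A] [NormedSpace ℂ A]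
  [IsScalarTower ℂ A A] [SMulCommClass ℂ A A] [StarModule ℂ A]
  {B : Type*} [NormedRing B] [StarRing B] [NormedStarGroup B] [NormedAlgebra ℂ B] [CompleteSpace B]

/-- A contractive star homomorphism extends to the closure of its domain. -/
theorem NonUnitalStarAlgHom.exists_extension_closure (S : NonUnitalStarSubalgebra ℂ A)
    (ρ : S →⋆ₙₐ[ℂ] B) (hρ : ∀ s, ‖ρ s‖ ≤ ‖(s : A)‖) :
    ∃ σ : S.topologicalClosure →⋆ₙₐ[ℂ] B,
      ∀ s : S, σ ⟨s, S.le_topologicalClosure s.2⟩ = ρ s := by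
  let e : S →ₗ[ℂ] S.topologicalClosure :=
    { toFun := fun s => ⟨s, S.le_topologicalClosure s.2⟩
      map_add' := fun _ _ => rfl
      map_smul' := fun _ _ => rfl }
  have hd : DenseRange e := by
    rw [DenseRange, dense_iff_closure_eq, Set.eq_univ_iff_forall]
    intro x
    rw [closure_subtype]
    have hx : (x : A) ∈ closure (S : Set A) := x.2
    refine closure_mono ?_ hx
    intro s hs
    exact ⟨e ⟨s, hs⟩, ⟨⟨s, hs⟩, rfl⟩, rfl⟩
  let r : S →ₗ[ℂ] B :=
    { toFun := ρ
      map_add' := map_add ρ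
      map_smul' := fun c s => map_smul ρ c s }
  have hb : ∀ s, ‖r s‖ ≤ 1 * ‖e s‖ := fun s => by rw [one_mul]; exact hρ s
  set g := r.extendOfNorm e with hg
  have hge : ∀ s, g (e s) = ρ s := fun s => LinearMap.extendOfNorm_eq hd ⟨1, hb⟩ s
  refine ⟨{ toFun := g
            map_smul' := fun c x => map_smul g c x
            map_zero' := map_zero g
            map_add' := map_add g
            map_mul' := fun x y => ?_
            map_star' := fun x => ?_ }, fun s => hge s⟩
  · refine hd.induction_on₂ (p := fun x y => g (x * y) = g x * g y) ?_ (fun s t => ?_) x y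
    · refine isClosed_eq (g.continuous.comp continuous_mul) ?_
      exact (g.continuous.comp continuous_fst).mul (g.continuous.comp continuous_snd)
    · rw [show e s * e t = e (s * t) from rfl, hge, hge, hge, map_mul]
  · refine hd.induction_on (p := fun x => g (star x) = star (g x)) x ?_ (fun s => ?_)
    · have hs : Continuous fun y : S.topologicalClosure => star y :=
        (continuous_star.comp continuous_subtype_val).subtype_mk _
      exact isClosed_eq (g.continuous.comp hs) (continuous_star.comp g.continuous)
    · rw [show star (e s) = e (star s) from rfl, hge, hge, map_star]

end StarHomExtension

/-! ### Diagonal and off-diagonal bounded operators on a Hilbert sum. -/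

section ProdOperators

variable {H₁ H₂ : Type*} [NormedAddCommGroup H₁] [InnerProductSpace ℂ H₁]
  [NormedAddCommGroup H₂] [InnerProductSpace ℂ H₂]

/-- The operator `(f, ω) ↦ (P f, Q ω)` on the Hilbert sum. -/
noncomputable def ContinuousLinearMap.diagL (P : H₁ →L[ℂ] H₁) (Q : H₂ →L[ℂ] H₂) :
    WithLp 2 (H₁ × H₂) →L[ℂ] WithLp 2 (H₁ × H₂) :=
  ((WithLp.prodContinuousLinearEquiv 2 ℂ H₁ H₂).symm : H₁ × H₂ →L[ℂ] WithLp 2 (H₁ × H₂)) ∘L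
    (P.prodMap Q) ∘L (WithLp.prodContinuousLinearEquiv 2 ℂ H₁ H₂ : _ →L[ℂ] H₁ × H₂)

/-- The operator `(f, ω) ↦ (Q ω, P f)` on the Hilbert sum. -/
noncomputable def ContinuousLinearMap.offDiagL (P : H₁ →L[ℂ] H₂) (Q : H₂ →L[ℂ] H₁) :
    WithLp 2 (H₁ × H₂) →L[ℂ] WithLp 2 (H₁ × H₂) :=
  ((WithLp.prodContinuousLinearEquiv 2 ℂ H₁ H₂).symm : H₁ × H₂ →L[ℂ] WithLp 2 (H₁ × H₂)) ∘L
    ((Q ∘L .snd ℂ H₁ H₂).prod (P ∘L .fst ℂ H₁ H₂)) ∘L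
      (WithLp.prodContinuousLinearEquiv 2 ℂ H₁ H₂ : _ →L[ℂ] H₁ × H₂)

namespace ContinuousLinearMap

lemma diagL_apply (P : H₁ →L[ℂ] H₁) (Q : H₂ →L[ℂ] H₂) (v : WithLp 2 (H₁ × H₂)) :
    diagL P Q v = WithLp.toLp 2 (P v.fst, Q v.snd) := rfl

lemma offDiagL_apply (P : H₁ →L[ℂ] H₂) (Q : H₂ →L[ℂ] H₁) (v : WithLp 2 (H₁ × H₂)) :
    offDiagL P Q v = WithLp.toLp 2 (Q v.snd, P v.fst) := rfl

/-- The two blocks have orthogonal sources and orthogonal targets, so their norms combine as a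
maximum. This gives constant one in the commutator estimate. -/
lemma norm_offDiagL_le {P : H₁ →L[ℂ] H₂} {Q : H₂ →L[ℂ] H₁} {C : ℝ} (hP : ‖P‖ ≤ C)
    (hQ : ‖Q‖ ≤ C) : ‖offDiagL P Q‖ ≤ C := by
  have hC : 0 ≤ C := (norm_nonneg P).trans hP
  refine opNorm_le_bound _ hC fun v => abs_le_of_sq_le_sq' ?_ (by positivity) |>.2
  rw [offDiagL_apply, mul_pow, WithLp.prod_norm_sq_eq_of_L2, WithLp.prod_norm_sq_eq_of_L2]
  change ‖Q v.snd‖ ^ 2 + ‖P v.fst‖ ^ 2 ≤ C ^ 2 * (‖v.fst‖ ^ 2 + ‖v.snd‖ ^ 2)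
  have h1 : ‖Q v.snd‖ ≤ C * ‖v.snd‖ := (Q.le_opNorm _).trans (by gcongr)
  have h2 : ‖P v.fst‖ ≤ C * ‖v.fst‖ := (P.le_opNorm _).trans (by gcongr)
  have h3 : ‖Q v.snd‖ ^ 2 ≤ (C * ‖v.snd‖) ^ 2 := by gcongr
  have h4 : ‖P v.fst‖ ^ 2 ≤ (C * ‖v.fst‖) ^ 2 := by gcongr
  nlinarith

end ContinuousLinearMap

variable [CompleteSpace H₁] [CompleteSpace H₂]

/-- The direct sum of two representations. -/
noncomputable def NonUnitalStarAlgHom.diag {A : Type*} [NonUnitalNonAssocSemiring A] [Star A]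
    [Module ℂ A] (ρ₁ : A →⋆ₙₐ[ℂ] (H₁ →L[ℂ] H₁)) (ρ₂ : A →⋆ₙₐ[ℂ] (H₂ →L[ℂ] H₂)) :
    A →⋆ₙₐ[ℂ] (WithLp 2 (H₁ × H₂) →L[ℂ] WithLp 2 (H₁ × H₂)) where
  toFun a := ContinuousLinearMap.diagL (ρ₁ a) (ρ₂ a)
  map_smul' c a := by
    ext v
    simp only [ContinuousLinearMap.diagL_apply, map_smul, smul_apply]
    rfl
  map_zero' := by
    ext v
    simp [ContinuousLinearMap.diagL_apply]
  map_add' a b := by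
    ext v
    simp only [ContinuousLinearMap.diagL_apply, map_add, add_apply]
    rfl
  map_mul' a b := by
    ext v
    simp [ContinuousLinearMap.diagL_apply]
  map_star' a := by
    rw [ContinuousLinearMap.star_eq_adjoint, ContinuousLinearMap.eq_adjoint_iff]
    intro v w
    simp only [ContinuousLinearMap.diagL_apply, WithLp.prod_inner_apply, map_star,
      ContinuousLinearMap.star_eq_adjoint, ContinuousLinearMap.adjoint_inner_left]
    rfl

end ProdOperators

/-! ### Cutoff functions and existence of energy measures. -/

namespace DirichletForm

section EnergyMeasure

variable {X : Type*} [TopologicalSpace X] [T2Space X] [MeasurableSpace X] [BorelSpace X]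
  {μ : Measure X} [IsFiniteMeasureOnCompacts μ] {E : DirichletForm μ}

lemma energyLE_realCore (f : E.realCore) : E.EnergyLE (f : X → ℝ) (√(E.energy f f)) :=
  ⟨Real.sqrt_nonneg _, E.toDomain f, E.toDomain_coeFn f, (Real.sq_sqrt (E.nonneg _)).ge⟩

lemma clip_mem_realCore (f : E.realCore) {t : ℝ} (ht : 0 < t) :
    (fun x => min (max 0 ((f : X → ℝ) x)) t) ∈ E.realCore := by
  obtain ⟨-, v, hv, -⟩ := (energyLE_realCore f).clip ht
  refine ⟨(continuous_const.max f.2.1).min continuous_const, ?_, v, v.2, hv⟩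
  exact f.2.2.1.comp_left (g := fun y => min (max 0 y) t) (by simp [ht.le])

/-- Urysohn functions in the Dirichlet algebra. -/
lemma exists_cutoff [LocallyCompactSpace X] (hreg : E.IsRegular) {K U : Set X} (hK : IsCompact K)
    (hU : IsOpen U) (hKU : K ⊆ U) : ∃ g : E.realCore, (∀ x, 0 ≤ (g : X → ℝ) x) ∧
      (∀ x, (g : X → ℝ) x ≤ 1) ∧ (∀ᶠ x in 𝓝ˢ K, (g : X → ℝ) x = 1) ∧
      ∀ x, x ∉ U → (g : X → ℝ) x = 0 := by
  obtain ⟨L, hL, hKL, hLU⟩ := exists_compact_between hK hU hKU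
  obtain ⟨h, hh1, hhc, hhU⟩ := exists_continuousMap_one_of_isCompact_subset_isOpen hL hU hLU
  -- Uniform approximation controls values but not where g₀ vanishes. Within 1 of 3h, g₀ exceeds 2
  -- on L and stays below 1 off U; subtracting its clip at level 1 therefore leaves a value above 1
  -- on L and at most 0 off U, and a last clip to [0, 1] finishes.
  obtain ⟨g₀, hg₀⟩ := hreg.1 (fun x => 3 * h x) (continuous_const.mul h.continuous)
    (HasCompactSupport.mul_left (f := fun _ => (3 : ℝ)) hhc) 1 one_pos
  have hmem : (g₀ : X → ℝ) - (fun x => min (max 0 ((g₀ : X → ℝ) x)) 1) ∈ E.realCore :=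
    sub_mem g₀.2 (clip_mem_realCore g₀ one_pos)
  refine ⟨⟨_, clip_mem_realCore ⟨_, hmem⟩ one_pos⟩, fun x => ?_, fun x => min_le_right _ _, ?_,
    fun x hx => ?_⟩
  · exact le_min (le_max_left _ _) zero_le_one
  · filter_upwards [subset_interior_iff_mem_nhdsSet.1 hKL] with x hx
    have h1 := abs_lt.1 (hg₀ x)
    have h2 : h x = 1 := hh1 hx
    rw [h2] at h1
    change min (max 0 ((g₀ : X → ℝ) x - min (max 0 ((g₀ : X → ℝ) x)) 1)) 1 = 1
    rw [min_eq_right (le_max_of_le_right _)]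
    have := min_le_right (max 0 ((g₀ : X → ℝ) x)) 1
    linarith
  · have h1 := abs_lt.1 (hg₀ x)
    have h2 : h x = 0 := image_eq_zero_of_notMem_tsupport fun h' => hx (hhU.1 h')
    rw [h2] at h1
    change min (max 0 ((g₀ : X → ℝ) x - min (max 0 ((g₀ : X → ℝ) x)) 1)) 1 = 0
    rw [min_eq_left (a := max 0 ((g₀ : X → ℝ) x)) (max_le zero_le_one (by linarith)),
      max_eq_left, min_eq_left zero_le_one]
    have := le_max_right 0 ((g₀ : X → ℝ) x)
    linarith

/-- The functional `φ ↦ E(φ f, f) - E(φ, f²) / 2` is positive. -/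
lemma energy_carre_nonneg (f φ : E.realCore) (hφ : ∀ x, 0 ≤ (φ : X → ℝ) x) :
    0 ≤ E.energy (φ * f) f - E.energy φ (f * f) / 2 := by
  choose S hS using fun n : ℕ => E.exists_resolvent ((n : ℝ) + 1) (by positivity)
  have hint : ∀ f g : Lp ℝ 2 μ, Integrable (fun x => f x * g x) μ := by
    intro f g
    refine (L2.integrable_inner (𝕜 := ℝ) g f).congr (Eventually.of_forall fun x => ?_)
    simp
  have hin : ∀ f g : Lp ℝ 2 μ, inner ℝ f g = ∫ x, f x * g x ∂μ := by
    intro f g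
    rw [L2.inner_def]
    refine integral_congr_ae (Eventually.of_forall fun x => ?_)
    simp [mul_comm]
  have hpos : ∀ n, 0 ≤ 2 * E.form (S n (E.toDomain f : Lp ℝ 2 μ)) (E.toDomain (φ * f))
      - E.form (S n (E.toDomain (f * f) : Lp ℝ 2 μ)) (E.toDomain φ) := by
    intro n
    rw [hS, hS, hin, hin]
    have hI : 2 * (((n : ℝ) + 1) * ∫ x, (E.toDomain f - (S n (E.toDomain f : Lp ℝ 2 μ) :
          Lp ℝ 2 μ) : Lp ℝ 2 μ) x * (E.toDomain (φ * f) : Lp ℝ 2 μ) x ∂μ)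
        - ((n : ℝ) + 1) * ∫ x, (E.toDomain (f * f) - (S n (E.toDomain (f * f) : Lp ℝ 2 μ) :
          Lp ℝ 2 μ) : Lp ℝ 2 μ) x * (E.toDomain φ : Lp ℝ 2 μ) x ∂μ
        = ((n : ℝ) + 1) * ∫ x, (2 * ((E.toDomain f - (S n (E.toDomain f : Lp ℝ 2 μ) :
          Lp ℝ 2 μ) : Lp ℝ 2 μ) x * (E.toDomain (φ * f) : Lp ℝ 2 μ) x)
          - (E.toDomain (f * f) - (S n (E.toDomain (f * f) : Lp ℝ 2 μ) :
          Lp ℝ 2 μ) : Lp ℝ 2 μ) x * (E.toDomain φ : Lp ℝ 2 μ) x) ∂μ := by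
      rw [integral_sub ((hint _ _).const_mul 2) (hint _ _), integral_const_mul]
      ring
    rw [hI]
    refine mul_nonneg (by positivity) (integral_nonneg_of_ae ?_)
    -- The inequality S(f²) - 2t S f + t² ≥ 0 holds a.e. for each fixed t. It is needed at t = f(x),
    -- which varies with the point, so a countable dense set of t is used and continuity in t does
    -- the rest.
    obtain ⟨d, hd⟩ := TopologicalSpace.exists_dense_seq ℝ
    have hq : ∀ᵐ x ∂μ, ∀ k, 0 ≤ (S n (E.toDomain (f * f) : Lp ℝ 2 μ) : Lp ℝ 2 μ) x
        - 2 * d k * (S n (E.toDomain f : Lp ℝ 2 μ) : Lp ℝ 2 μ) x + d k ^ 2 := by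
      rw [ae_all_iff]; intro k
      filter_upwards [resolvent_quadratic (by positivity) (hS n) (fun _ : Unit => f) (fun _ => 1)
        (d k)] with x hx
      simpa using hx
    filter_upwards [hq, E.toDomain_coeFn f, E.toDomain_coeFn φ, E.toDomain_coeFn (f * f),
      E.toDomain_coeFn (φ * f),
      Lp.coeFn_sub (E.toDomain f : Lp ℝ 2 μ) (S n (E.toDomain f : Lp ℝ 2 μ) : Lp ℝ 2 μ),
      Lp.coeFn_sub (E.toDomain (f * f) : Lp ℝ 2 μ) (S n (E.toDomain (f * f) : Lp ℝ 2 μ) : Lp ℝ 2 μ)]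
      with x hq e1 e2 e3 e4 e5 e6
    have hall : 0 ≤ (S n (E.toDomain (f * f) : Lp ℝ 2 μ) : Lp ℝ 2 μ) x
        - 2 * (f : X → ℝ) x * (S n (E.toDomain f : Lp ℝ 2 μ) : Lp ℝ 2 μ) x
        + (f : X → ℝ) x ^ 2 := by
      refine hd.induction_on (p := fun t : ℝ =>
        0 ≤ (S n (E.toDomain (f * f) : Lp ℝ 2 μ) : Lp ℝ 2 μ) x
        - 2 * t * (S n (E.toDomain f : Lp ℝ 2 μ) : Lp ℝ 2 μ) x + t ^ 2) _ ?_ hq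
      exact isClosed_le continuous_const (by fun_prop)
    rw [e5, e6, Pi.sub_apply, Pi.sub_apply, e1, e2, e3, e4]
    change 0 ≤ 2 * (((f : X → ℝ) x - _) * ((φ : X → ℝ) x * (f : X → ℝ) x))
      - ((f : X → ℝ) x * (f : X → ℝ) x - _) * (φ : X → ℝ) x
    refine (mul_nonneg (hφ x) hall).trans_eq ?_
    ring
  have hlim := ge_of_tendsto' (((tendsto_resolvent_form S hS (E.toDomain f)
    (E.toDomain (φ * f))).const_mul 2).sub
    (tendsto_resolvent_form S hS (E.toDomain (f * f)) (E.toDomain φ))) hpos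
  have h1 : E.energy (φ * f) f = E.form (E.toDomain f) (E.toDomain (φ * f)) := E.symm _ _
  have h2 : E.energy φ (f * f) = E.form (E.toDomain (f * f)) (E.toDomain φ) := E.symm _ _
  rw [h1, h2]
  linarith

/-- Existence of the energy measure. -/
lemma exists_energyMeasure [LocallyCompactSpace X] (hreg : E.IsRegular) (f : E.realCore) :
    ∃ ν, E.IsEnergyMeasure f ν := by
  let V : Submodule ℝ (CompactlySupportedContinuousMap X ℝ) :=
    { carrier := {φ | (φ : X → ℝ) ∈ E.realCore}
      zero_mem' := zero_mem E.realCore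
      add_mem' := fun {φ ψ} h1 h2 =>
        (add_mem h1 h2 : (φ : X → ℝ) + (ψ : X → ℝ) ∈ E.realCore)
      smul_mem' := fun c φ h =>
        (SMulMemClass.smul_mem c h : c • (φ : X → ℝ) ∈ E.realCore) }
  let Λ : V →ₗ[ℝ] ℝ :=
    { toFun := fun φ => E.energy (⟨(φ : CompactlySupportedContinuousMap X ℝ), φ.2⟩ * f) f
        - E.energy ⟨(φ : CompactlySupportedContinuousMap X ℝ), φ.2⟩ (f * f) / 2
      map_add' := fun φ ψ => by
        have : (⟨((φ + ψ : V) : CompactlySupportedContinuousMap X ℝ), (φ + ψ).2⟩ : E.realCore)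
          = ⟨(φ : CompactlySupportedContinuousMap X ℝ), φ.2⟩
            + ⟨(ψ : CompactlySupportedContinuousMap X ℝ), ψ.2⟩ := rfl
        rw [this, add_mul, energy_add_left, energy_add_left]; ring
      map_smul' := fun c φ => by
        have : (⟨((c • φ : V) : CompactlySupportedContinuousMap X ℝ), (c • φ).2⟩ : E.realCore)
          = c • ⟨(φ : CompactlySupportedContinuousMap X ℝ), φ.2⟩ := rfl
        rw [this, smul_mul_assoc, energy_smul_left, energy_smul_left, RingHom.id_apply,
          smul_eq_mul]
        ring }
  have : PosSMulMono ℝ (CompactlySupportedContinuousMap X ℝ) :=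
    ⟨fun c hc φ ψ h x => mul_le_mul_of_nonneg_left (h x) hc⟩
  -- The functional is only given on the subspace C of `C_c(X)`. It extends to a positive functional
  -- by M. Riesz, because a large multiple of a cutoff in C dominates any given ψ; the Riesz–Markov
  -- theorem then yields the measure.
  obtain ⟨g, hg, hgpos⟩ := riesz_extension
    (PointedCone.positive ℝ (CompactlySupportedContinuousMap X ℝ)) ⟨V, Λ⟩ (fun φ hφ =>
      energy_carre_nonneg f ⟨_, φ.2⟩ fun x => hφ x) (fun ψ => by
      obtain ⟨M, hM⟩ := ψ.hasCompactSupport.exists_bound_of_continuous ψ.continuous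
      obtain ⟨c, hc0, hc1, hcK, -⟩ := exists_cutoff hreg ψ.hasCompactSupport isOpen_univ
        (Set.subset_univ _)
      have hmem : (|M| • (c : X → ℝ)) ∈ E.realCore := SMulMemClass.smul_mem |M| c.2
      refine ⟨⟨⟨⟨|M| • (c : X → ℝ), hmem.1⟩, hmem.2.1⟩, hmem⟩, fun x => ?_⟩
      change 0 ≤ |M| * (c : X → ℝ) x + ψ x
      by_cases hx : x ∈ tsupport ψ
      · rw [hcK.self_of_nhdsSet x hx, mul_one]
        have h1 := (abs_le.1 (hM x)).1
        have := le_abs_self M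
        linarith
      · rw [image_eq_zero_of_notMem_tsupport hx, add_zero]
        exact mul_nonneg (abs_nonneg _) (hc0 x))
  refine ⟨RealRMK.rieszMeasure (PositiveLinearMap.mk₀ g hgpos), inferInstance, fun φ => ?_⟩
  have := RealRMK.integral_rieszMeasure (PositiveLinearMap.mk₀ g hgpos)
    ⟨⟨(φ : X → ℝ), φ.2.1⟩, φ.2.2.1⟩
  refine this.trans ?_
  exact hg ⟨⟨⟨(φ : X → ℝ), φ.2.1⟩, φ.2.2.1⟩, φ.2⟩

lemma isEnergyMeasure_energyMeasure [LocallyCompactSpace X] (hreg : E.IsRegular)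
    (f : E.realCore) : E.IsEnergyMeasure f (E.energyMeasure f) := by
  have h := exists_energyMeasure hreg f
  rw [energyMeasure, dif_pos h]
  exact h.choose_spec

end EnergyMeasure

end DirichletForm

/-! ### Vanishing energy of large cutoffs in the absence of killing. -/

namespace DirichletForm

section Cutoff

variable {X : Type*} [TopologicalSpace X] [T2Space X] [LocallyCompactSpace X] [SigmaCompactSpace X]
  [MeasurableSpace X] [BorelSpace X]
  {μ : Measure X} [IsFiniteMeasureOnCompacts μ] {E : DirichletForm μ}

/-- Without killing, the energy of a fixed function against large cutoff functions is small. -/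
lemma exists_isCompact_energy_lt (hreg : E.IsRegular) (hkill : E.NoKilling) (g : E.realCore)
    {ε : ℝ} (hε : 0 < ε) : ∃ K : Set X, IsCompact K ∧ ∀ φ : E.realCore,
      (∀ x, 0 ≤ (φ : X → ℝ) x) → (∀ x, (φ : X → ℝ) x ≤ 1) →
      (∀ᶠ x in 𝓝ˢ K, (φ : X → ℝ) x = 1) → |E.energy φ g| < ε := by
  obtain ⟨Ec, J, -, -, hloc, -, -, -, hJint, hE⟩ := hkill
  obtain ⟨C, hC⟩ := E.realCore_bounded g
  -- The cutoff χ, equal to 1 near the support of g, provides a J-integrable majorant (χ(x) - χ(y))²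
  -- whose integral over the complement of K_n × K_n tends to zero.
  obtain ⟨χ, hχ0, hχ1, hχK, -⟩ := exists_cutoff hreg g.2.2.1 isOpen_univ (Set.subset_univ _)
  set F : X × X → ℝ := fun p => ((χ : X → ℝ) p.1 - (χ : X → ℝ) p.2) ^ 2 with hF
  have hFi : Integrable F J := hJint χ
  let Kn := CompactExhaustion.choice X
  have hmeas : ∀ n, MeasurableSet (Kn n ×ˢ Kn n)ᶜ := fun n =>
    ((Kn.isCompact n).isClosed.measurableSet.prod (Kn.isCompact n).isClosed.measurableSet).compl
  have hanti : Antitone fun n => (Kn n ×ˢ Kn n)ᶜ := fun m n hmn =>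
    Set.compl_subset_compl.2 (Set.prod_mono (Kn.subset hmn) (Kn.subset hmn))
  have hlim := tendsto_setIntegral_of_antitone (μ := J) (f := F) hmeas hanti ⟨0, hFi.integrableOn⟩
  have hempty : ⋂ n, (Kn n ×ˢ Kn n)ᶜ = ∅ := by
    rw [Set.eq_empty_iff_forall_notMem]
    rintro ⟨x, y⟩ hxy
    obtain ⟨n, hn⟩ := Kn.exists_mem x
    obtain ⟨m, hm⟩ := Kn.exists_mem y
    exact Set.mem_iInter.1 hxy (max n m)
      ⟨Kn.subset (le_max_left _ _) hn, Kn.subset (le_max_right _ _) hm⟩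
  rw [hempty, setIntegral_empty] at hlim
  have hlim' := hlim.const_mul |C|
  rw [mul_zero] at hlim'
  obtain ⟨N, hN⟩ := Kn.exists_superset_of_isCompact χ.2.2.1
  obtain ⟨n, hn, hnN⟩ := ((hlim'.eventually_lt_const hε).and (eventually_ge_atTop N)).exists
  have hχn : tsupport (χ : X → ℝ) ⊆ Kn n := hN.trans (Kn.subset hnN)
  have hgχ : tsupport (g : X → ℝ) ⊆ tsupport (χ : X → ℝ) := fun x hx =>
    subset_tsupport _ (by
      rw [Function.mem_support, hχK.self_of_nhdsSet x hx]; exact one_ne_zero)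
  refine ⟨Kn n, Kn.isCompact n, fun φ hφ0 hφ1 hφK => ?_⟩
  -- Strong locality applies because φ = 1 near the support of g.
  have hEc : Ec φ g = 0 :=
    hloc φ g ⟨1, hφK.filter_mono (nhdsSet_mono (hgχ.trans hχn))⟩
  -- If one of the two points is outside K_n and g differs at them, then one is in the support of g,
  -- where χ = 1, and the other is outside K_n, where χ = 0. So the square on the right equals 1.
  have hpt : ∀ x y, x ∉ Kn n ∨ y ∉ Kn n →
      |(φ : X → ℝ) x - (φ : X → ℝ) y| * |(g : X → ℝ) x - (g : X → ℝ) y|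
        ≤ |C| * ((χ : X → ℝ) x - (χ : X → ℝ) y) ^ 2 := by
    intro x y hxy
    have hnn : 0 ≤ |C| * ((χ : X → ℝ) x - (χ : X → ℝ) y) ^ 2 := by positivity
    have hout : ∀ z, z ∉ Kn n → (g : X → ℝ) z = 0 ∧ (χ : X → ℝ) z = 0 := fun z hz =>
      ⟨image_eq_zero_of_notMem_tsupport fun h => hz (hχn (hgχ h)),
        image_eq_zero_of_notMem_tsupport fun h => hz (hχn h)⟩
    have hin : ∀ z, (g : X → ℝ) z ≠ 0 → (χ : X → ℝ) z = 1 := fun z hz =>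
      hχK.self_of_nhdsSet z (subset_tsupport _ hz)
    have hφ : |(φ : X → ℝ) x - (φ : X → ℝ) y| ≤ 1 :=
      abs_le.2 ⟨by linarith [hφ0 x, hφ1 y], by linarith [hφ0 y, hφ1 x]⟩
    have hgC : ∀ z, |(g : X → ℝ) z| ≤ |C| := fun z => (hC z).trans (le_abs_self C)
    by_cases hx : (g : X → ℝ) x = 0
    · by_cases hy : (g : X → ℝ) y = 0
      · rw [hx, hy, sub_zero, abs_zero, mul_zero]; exact hnn
      · have hxn := hxy.resolve_right fun h => hy (hout y h).1
        rw [(hout x hxn).1, (hout x hxn).2, hin y hy, zero_sub, abs_neg]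
        norm_num
        nlinarith [hgC y, abs_nonneg ((g : X → ℝ) y), abs_nonneg C]
    · have hyn := hxy.resolve_left fun h => hx (hout x h).1
      rw [(hout y hyn).1, (hout y hyn).2, hin x hx, sub_zero]
      norm_num
      nlinarith [hgC x, abs_nonneg ((g : X → ℝ) x), abs_nonneg C]
  have hbound : ‖∫ p, ((φ : X → ℝ) p.1 - (φ : X → ℝ) p.2)
      * ((g : X → ℝ) p.1 - (g : X → ℝ) p.2) ∂J‖
      ≤ ∫ p, (Kn n ×ˢ Kn n)ᶜ.indicator (fun p => |C| * F p) p ∂J := by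
    refine norm_integral_le_of_norm_le ((hFi.const_mul _).indicator (hmeas n))
      (Eventually.of_forall fun p => ?_)
    rw [Real.norm_eq_abs, abs_mul]
    by_cases hp : p ∈ (Kn n ×ˢ Kn n)ᶜ
    · rw [Set.indicator_of_mem hp]
      refine hpt _ _ ?_
      by_contra hcon
      push Not at hcon
      exact hp hcon
    · rw [Set.indicator_of_notMem hp]
      have hp' := Set.notMem_compl_iff.1 hp
      rw [hφK.self_of_nhdsSet _ hp'.1, hφK.self_of_nhdsSet _ hp'.2, sub_self, abs_zero, zero_mul]
  rw [integral_indicator (hmeas n), integral_const_mul, Real.norm_eq_abs] at hbound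
  rw [hE, hEc, zero_add, abs_mul, abs_of_pos (by norm_num : (0 : ℝ) < 1 / 2)]
  have := abs_nonneg (∫ p, ((φ : X → ℝ) p.1 - (φ : X → ℝ) p.2)
      * ((g : X → ℝ) p.1 - (g : X → ℝ) p.2) ∂J)
  linarith

lemma ofRealCore_mul (f g : E.realCore) : ofRealCore f * ofRealCore g = ofRealCore (f * g) :=
  Subtype.ext (ZeroAtInftyContinuousMap.ext fun _ => (Complex.ofReal_mul _ _).symm)

lemma star_ofRealCore (f : E.realCore) : star (ofRealCore f) = ofRealCore f :=
  core_ext rfl (by rw [imPart_star, imPart_ofRealCore, neg_zero])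

lemma energyC_ofRealCore_left (f : E.realCore) (g : E.core) : E.energyC (ofRealCore f) g
    = E.energy f (rePart g) + E.energy f (imPart g) * Complex.I := by
  apply Complex.ext
  · rw [energyC_re, rePart_ofRealCore, imPart_ofRealCore]
    simp [energy]
  · rw [energyC_im, rePart_ofRealCore, imPart_ofRealCore]
    simp [energy]

/-- A sequence of cutoff functions with vanishing energy against every fixed function. -/
lemma exists_cutoff_seq (hreg : E.IsRegular) (hkill : E.NoKilling) :
    ∃ φ : ℕ → E.core, (∀ n, star (φ n) = φ n) ∧ (∀ f : E.core, ∀ᶠ n in atTop, φ n * f = f) ∧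
      (∀ g : E.core, Tendsto (fun n => E.energyC (φ n) g) atTop (𝓝 0)) ∧
      ∀ g : E.core, Tendsto (fun p : ℕ × ℕ => E.energyC (φ p.1 * φ p.2) g) atTop (𝓝 0) := by
  let Kn := CompactExhaustion.choice X
  choose φ hφ0 hφ1 hφK _ using fun n =>
    exists_cutoff hreg (Kn.isCompact n) isOpen_univ (Set.subset_univ _)
  have hK : ∀ K : Set X, IsCompact K → ∀ᶠ n in atTop, ∀ᶠ x in 𝓝ˢ K, (φ n : X → ℝ) x = 1 := by
    intro K hK
    obtain ⟨N, hN⟩ := Kn.exists_superset_of_isCompact hK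
    filter_upwards [eventually_ge_atTop N] with n hn
    exact (hφK n).filter_mono (nhdsSet_mono (hN.trans (Kn.subset hn)))
  have h1 : ∀ g : E.realCore, Tendsto (fun n => E.energy (φ n) g) atTop (𝓝 0) := by
    intro g
    rw [Metric.tendsto_nhds]
    intro ε hε
    obtain ⟨K, hKc, hKε⟩ := exists_isCompact_energy_lt hreg hkill g hε
    filter_upwards [hK K hKc] with n hn
    rw [Real.dist_eq, sub_zero]
    exact hKε _ (hφ0 n) (hφ1 n) hn
  -- A product of two cutoffs is again a cutoff. The double sequence is needed because the norm of a
  -- ⊗ (φ_m - φ_n) contains the mixed term φ_m φ_n.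
  have h2 : ∀ g : E.realCore,
      Tendsto (fun p : ℕ × ℕ => E.energy (φ p.1 * φ p.2) g) atTop (𝓝 0) := by
    intro g
    rw [Metric.tendsto_nhds]
    intro ε hε
    obtain ⟨K, hKc, hKε⟩ := exists_isCompact_energy_lt hreg hkill g hε
    rw [← prod_atTop_atTop_eq]
    filter_upwards [(hK K hKc).prod_mk (hK K hKc)] with p hp
    rw [Real.dist_eq, sub_zero]
    refine hKε _ (fun x => mul_nonneg (hφ0 _ x) (hφ0 _ x))
      (fun x => mul_le_one₀ (hφ1 _ x) (hφ0 _ x) (hφ1 _ x)) ?_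
    filter_upwards [hp.1, hp.2] with x hx hy
    change (φ p.1 : X → ℝ) x * (φ p.2 : X → ℝ) x = 1
    rw [hx, hy, one_mul]
  have hC : ∀ {α : Type} {l : Filter α} (ψ : α → E.realCore),
      (∀ g : E.realCore, Tendsto (fun n => E.energy (ψ n) g) l (𝓝 0)) →
      ∀ g : E.core, Tendsto (fun n => E.energyC (ofRealCore (ψ n)) g) l (𝓝 0) := by
    intro α l ψ hψ g
    simp only [energyC_ofRealCore_left]
    have := ((Complex.continuous_ofReal.tendsto 0).comp (hψ (rePart g))).add
      (((Complex.continuous_ofReal.tendsto 0).comp (hψ (imPart g))).mul_const Complex.I)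
    simpa using this
  refine ⟨fun n => ofRealCore (φ n), fun n => star_ofRealCore _, fun f => ?_, hC _ h1, fun g => ?_⟩
  · filter_upwards [hK _ (rePart f).2.2.1, hK _ (imPart f).2.2.1] with n hn hn'
    refine Subtype.ext (ZeroAtInftyContinuousMap.ext fun x => ?_)
    change ((φ n : X → ℝ) x : ℂ) * (f : C₀(X, ℂ)) x = (f : C₀(X, ℂ)) x
    by_cases hx : (f : C₀(X, ℂ)) x = 0
    · rw [hx, mul_zero]
    · have h3 : (φ n : X → ℝ) x = 1 := by
        by_cases hre : ((f : C₀(X, ℂ)) x).re = 0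
        · exact hn'.self_of_nhdsSet x (subset_tsupport _ fun him => hx (Complex.ext hre him))
        · exact hn.self_of_nhdsSet x (subset_tsupport _ hre)
      rw [h3, Complex.ofReal_one, one_mul]
  · simp only [ofRealCore_mul]
    exact hC (fun p : ℕ × ℕ => φ p.1 * φ p.2) h2 g

end Cutoff

end DirichletForm

/-! ### The gradient and the flip symmetry of the space of 1-forms. -/

namespace DirichletForm

section Gradient

variable {X : Type*} [TopologicalSpace X] [T2Space X] [LocallyCompactSpace X] [SigmaCompactSpace X]
  [MeasurableSpace X] [BorelSpace X]
  {μ : Measure X} [IsFiniteMeasureOnCompacts μ] (E : DirichletForm μ)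

/-- The canonical map from `C ⊗ C` to the space of 1-forms. -/
noncomputable def tensorMap : (E.core ⊗[ℂ] E.core) →ₗ[ℂ] E.OneForms :=
  (UniformSpace.Completion.toComplL (𝕜 := ℂ) (E := E.PreForms) : E.PreForms →ₗ[ℂ] E.OneForms) ∘ₗ
    E.toPreForms.toLinearMap

lemma tensorMap_tmul (a b : E.core) : E.tensorMap (a ⊗ₜ b) = E.tensor a b := rfl

lemma inner_tensorMap (x y : E.core ⊗[ℂ] E.core) :
    inner ℂ (E.tensorMap x) (E.tensorMap y) = E.tensorForm (star x) y :=
  UniformSpace.Completion.inner_coe _ _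

lemma denseRange_tensorMap : DenseRange E.tensorMap :=
  UniformSpace.Completion.denseRange_coe (α := E.PreForms)

variable {E}

lemma forms_ext {ω η : E.OneForms}
    (h : ∀ c d, inner ℂ (E.tensor c d) ω = inner ℂ (E.tensor c d) η) : ω = η := by
  refine E.denseRange_tensorMap.eq_of_inner_right ℂ fun x => ?_
  induction x using TensorProduct.induction_on with
  | zero => simp
  | add x y hx hy => rw [map_add, inner_add_left, inner_add_left, hx, hy]
  | tmul a b => exact h a b

lemma clm_ext {F : Type*} [NormedAddCommGroup F] [NormedSpace ℂ F] {S T : E.OneForms →L[ℂ] F}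
    (h : ∀ c d, S (E.tensor c d) = T (E.tensor c d)) : S = T := by
  refine ContinuousLinearMap.coeFn_injective
    (E.denseRange_tensorMap.equalizer S.continuous T.continuous (funext fun x => ?_))
  simp only [Function.comp]
  induction x using TensorProduct.induction_on with
  | zero => simp
  | add x y hx hy => rw [map_add, map_add, map_add, hx, hy]
  | tmul a b => exact h a b

lemma tensor_add_left (a a' b : E.core) :
    E.tensor (a + a') b = E.tensor a b + E.tensor a' b := by
  simp only [← tensorMap_tmul, TensorProduct.add_tmul, map_add]

lemma tensor_add_right (a b b' : E.core) :
    E.tensor a (b + b') = E.tensor a b + E.tensor a b' := by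
  simp only [← tensorMap_tmul, TensorProduct.tmul_add, map_add]

lemma tensor_smul_left (r : ℂ) (a b : E.core) : E.tensor (r • a) b = r • E.tensor a b := by
  simp only [← tensorMap_tmul, ← TensorProduct.smul_tmul', map_smul]

lemma tensor_smul_right (r : ℂ) (a b : E.core) : E.tensor a (r • b) = r • E.tensor a b := by
  simp only [← tensorMap_tmul, TensorProduct.tmul_smul, map_smul]

lemma tensor_sub_tensor (a b b' : E.core) :
    E.tensor a b - E.tensor a b' = E.tensor a (b + (-1 : ℂ) • b') := by
  rw [tensor_add_right, tensor_smul_right, neg_one_smul, sub_eq_add_neg]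

/-- An approximate unit of cutoff functions whose energy against fixed functions vanishes. -/
structure IsCutoffSeq (φ : ℕ → E.core) : Prop where
  star_eq : ∀ n, star (φ n) = φ n
  mul_eq : ∀ f : E.core, ∀ᶠ n in atTop, φ n * f = f
  energy_tendsto : ∀ g : E.core, Tendsto (fun n => E.energyC (φ n) g) atTop (𝓝 0)
  energy_mul_tendsto : ∀ g : E.core,
    Tendsto (fun p : ℕ × ℕ => E.energyC (φ p.1 * φ p.2) g) atTop (𝓝 0)

variable {φ : ℕ → E.core}

/-- The total mass of Γ(f, g) is E(f, g): once φ_n acts as a unit on f and g, the integral equals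
E(f, g) - E(φ_n, fg)/2, and the last term vanishes in the limit. -/
lemma IsCutoffSeq.gammaInt_tendsto (hφ : IsCutoffSeq φ) (f g : E.core) :
    Tendsto (fun n => E.gammaInt f g (φ n)) atTop (𝓝 (E.energyC f g)) := by
  have h1 : Tendsto (fun n => (E.energyC f g + E.energyC g f - E.energyC (φ n) (f * g)) / 2)
      atTop (𝓝 ((E.energyC f g + E.energyC g f - 0) / 2)) :=
    ((hφ.energy_tendsto (f * g)).const_sub _).div_const 2
  rw [E.energyC_comm g f, sub_zero, add_self_div_two] at h1
  refine h1.congr' ?_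
  filter_upwards [hφ.mul_eq f, hφ.mul_eq g] with n hf hg
  rw [gammaInt, hf, hg, E.energyC_comm g f]

lemma IsCutoffSeq.gammaInt_mul_tendsto (hφ : IsCutoffSeq φ) (f g : E.core) :
    Tendsto (fun p : ℕ × ℕ => E.gammaInt f g (φ p.1 * φ p.2)) atTop (𝓝 (E.energyC f g)) := by
  have h1 : Tendsto (fun p : ℕ × ℕ =>
      (E.energyC f g + E.energyC g f - E.energyC (φ p.1 * φ p.2) (f * g)) / 2)
      atTop (𝓝 ((E.energyC f g + E.energyC g f - 0) / 2)) :=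
    ((hφ.energy_mul_tendsto (f * g)).const_sub _).div_const 2
  rw [E.energyC_comm g f, sub_zero, add_self_div_two] at h1
  refine h1.congr' ?_
  rw [← prod_atTop_atTop_eq]
  filter_upwards [((hφ.mul_eq f).and (hφ.mul_eq g)).prod_mk ((hφ.mul_eq f).and (hφ.mul_eq g))]
    with p hp
  rw [gammaInt, mul_assoc, mul_assoc, hp.2.1, hp.2.2, hp.1.1, hp.1.2, E.energyC_comm g f]

lemma norm_tensor_sq (a b : E.core) :
    ((‖E.tensor a b‖ ^ 2 : ℝ) : ℂ) = E.gammaInt (star a) a (star b * b) := by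
  rw [← inner_tensor, inner_self_eq_norm_sq_to_K]
  push_cast
  rfl

/-- If the complex numbers `‖v n‖²` tend to zero, so do the vectors `v n`. -/
lemma tendsto_zero_of_norm_sq {α F : Type*} [NormedAddCommGroup F] {l : Filter α} {v : α → F}
    (h : Tendsto (fun n => ((‖v n‖ ^ 2 : ℝ) : ℂ)) l (𝓝 0)) : Tendsto v l (𝓝 0) := by
  rw [tendsto_zero_iff_norm_tendsto_zero]
  have h1 := h.norm.sqrt
  simpa [Complex.norm_real, Real.sqrt_sq] using h1

/-- The vectors a ⊗ φ_n form a Cauchy sequence, since the squared norm of a difference is the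
integral of φ_m² - 2 φ_m φ_n + φ_n² against Γ(ā, a), with limit E - 2E + E = 0. Pairing with c ⊗ d
is eventually constant, because φ_n acts as a unit on d̄. -/
lemma IsCutoffSeq.exists_isGradient (hφ : IsCutoffSeq φ) (a : E.core) :
    ∃ ω, E.IsGradient a ω ∧ Tendsto (fun n => E.tensor a (φ n)) atTop (𝓝 ω) := by
  have hC : CauchySeq fun n => E.tensor a (φ n) := by
    rw [cauchySeq_iff_tendsto_dist_atTop_0]
    simp only [dist_eq_norm, tensor_sub_tensor]
    rw [← tendsto_zero_iff_norm_tendsto_zero]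
    refine tendsto_zero_of_norm_sq ?_
    simp only [norm_tensor_sq]
    have h1 := hφ.gammaInt_mul_tendsto (star a) a
    have hf : Tendsto (Prod.fst : ℕ × ℕ → ℕ) atTop atTop := by
      rw [← prod_atTop_atTop_eq]; exact tendsto_fst
    have hs : Tendsto (Prod.snd : ℕ × ℕ → ℕ) atTop atTop := by
      rw [← prod_atTop_atTop_eq]; exact tendsto_snd
    have hd : Tendsto (fun n : ℕ => (n, n)) atTop atTop := by
      rw [← prod_atTop_atTop_eq]; exact tendsto_id.prodMk tendsto_id
    have h2 := ((h1.comp (hd.comp hf)).sub (h1.const_mul 2)).add (h1.comp (hd.comp hs))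
    rw [show E.energyC (star a) a - 2 * E.energyC (star a) a + E.energyC (star a) a = 0 by ring]
      at h2
    refine h2.congr fun p => ?_
    have : star (φ p.1 + (-1 : ℂ) • φ p.2) * (φ p.1 + (-1 : ℂ) • φ p.2)
        = φ p.1 * φ p.1 + (-2 : ℂ) • (φ p.1 * φ p.2) + φ p.2 * φ p.2 := by
      rw [star_add, star_smul, hφ.star_eq, hφ.star_eq, add_mul, mul_add, mul_add, smul_mul_smul,
        smul_mul_assoc, mul_smul_comm, mul_comm (φ p.2) (φ p.1), star_neg, star_one]
      module
    rw [this, gammaInt_add, gammaInt_add, gammaInt_smul]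
    simp only [Function.comp]
    ring
  obtain ⟨ω, hω⟩ := cauchySeq_tendsto_of_complete hC
  refine ⟨ω, fun c d => ?_, hω⟩
  refine tendsto_nhds_unique ((tendsto_const_nhds (x := E.tensor c d)).inner (𝕜 := ℂ) hω) ?_
  refine tendsto_const_nhds.congr' ?_
  filter_upwards [hφ.mul_eq (star d)] with n hn
  rw [inner_tensor, mul_comm, hn]

lemma exists_isCutoffSeq (hreg : E.IsRegular) (hkill : E.NoKilling) :
    ∃ φ : ℕ → E.core, IsCutoffSeq φ := by
  obtain ⟨φ, h1, h2, h3, h4⟩ := exists_cutoff_seq hreg hkill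
  exact ⟨φ, h1, h2, h3, h4⟩

variable (hreg : E.IsRegular) (hkill : E.NoKilling)

/-- The gradient `∂ : C → H`. -/
noncomputable def grad : E.core →ₗ[ℂ] E.OneForms :=
  have h : ∀ a, ∃ ω, E.IsGradient a ω := fun a =>
    (((exists_isCutoffSeq hreg hkill).choose_spec).exists_isGradient a).imp fun _ h => h.1
  { toFun := fun a => (h a).choose
    map_add' := fun a b => forms_ext fun c d => by
      rw [inner_add_right, (h _).choose_spec, (h _).choose_spec, (h _).choose_spec,
        gammaInt_add_right]
    map_smul' := fun r a => forms_ext fun c d => by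
      rw [RingHom.id_apply, inner_smul_right, (h _).choose_spec, (h _).choose_spec,
        gammaInt_smul_right] }

lemma isGradient_grad (a : E.core) : E.IsGradient a (grad hreg hkill a) :=
  ((((exists_isCutoffSeq hreg hkill).choose_spec).exists_isGradient a).imp fun _ h =>
    h.1 : ∃ ω, E.IsGradient a ω).choose_spec

lemma IsGradient.eq_grad {a : E.core} {ω : E.OneForms} (h : E.IsGradient a ω) :
    ω = grad hreg hkill a :=
  forms_ext fun c d => by rw [h, isGradient_grad]

lemma inner_tensor_grad (a c d : E.core) :
    inner ℂ (E.tensor c d) (grad hreg hkill a) = E.gammaInt (star c) a (star d) :=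
  isGradient_grad hreg hkill a c d

lemma inner_grad_tensor (a c d : E.core) :
    inner ℂ (grad hreg hkill a) (E.tensor c d) = E.gammaInt c (star a) d := by
  rw [← inner_conj_symm, inner_tensor_grad, ← Complex.star_def, ← gammaInt_star]
  simp only [star_star]

lemma IsCutoffSeq.tendsto_tensor (hφ : IsCutoffSeq φ) (a : E.core) :
    Tendsto (fun n => E.tensor a (φ n)) atTop (𝓝 (grad hreg hkill a)) := by
  obtain ⟨ω, h1, h2⟩ := hφ.exists_isGradient a
  rwa [← h1.eq_grad hreg hkill]

/-- Replacing ∂a by a ⊗ φ_n turns the inner product into the integral of φ_n against Γ(ā, b), which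
exhausts the full energy. This is how the absence of killing enters the geometry of 1-forms. -/
lemma inner_grad_grad (a b : E.core) :
    inner ℂ (grad hreg hkill a) (grad hreg hkill b) = E.energyC (star a) b := by
  obtain ⟨φ, hφ⟩ := exists_isCutoffSeq hreg hkill
  refine tendsto_nhds_unique ((hφ.tendsto_tensor hreg hkill a).inner (𝕜 := ℂ)
    (tendsto_const_nhds (x := grad hreg hkill b))) ?_
  refine (hφ.gammaInt_tendsto (star a) b).congr fun n => ?_
  rw [inner_tensor_grad, hφ.star_eq]

/-- Pure algebra: after expansion every term is an energy, and symmetry of E and commutativity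
suffice. With conjugates inserted, it is the isometry of the flip on simple tensors. -/
lemma flip_identity (a b p q : E.core) : E.energyC (a * b) (p * q) - E.gammaInt q (a * b) p
    - E.gammaInt b (p * q) a + E.gammaInt b q (a * p) = E.gammaInt a p (b * q) := by
  have h1 := E.energyC_comm p (b * q * a)
  have h2 := E.energyC_comm a (b * q * p)
  have h3 := E.energyC_comm (a * p) (b * q)
  have h4 := E.energyC_comm (p * q) (a * b)
  simp only [gammaInt, mul_comm, mul_left_comm] at h1 h2 h3 h4 ⊢
  linear_combination (1 / 2) * h1 + (1 / 2) * h2 - (1 / 2) * h3 - (1 / 2) * h4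

/-- The map `c ⊗ d ↦ ∂(c d) - d ⊗ c`. -/
noncomputable def preFlip : (E.core ⊗[ℂ] E.core) →ₗ[ℂ] E.OneForms :=
  TensorProduct.lift (LinearMap.mk₂ ℂ (fun c d => grad hreg hkill (c * d) - E.tensor d c)
    (fun c c' d => by rw [add_mul, map_add, tensor_add_right]; abel)
    (fun r c d => by rw [smul_mul_assoc, map_smul, tensor_smul_right, smul_sub])
    (fun c d d' => by rw [mul_add, map_add, tensor_add_left]; abel)
    (fun r c d => by rw [mul_smul_comm, map_smul, tensor_smul_left, smul_sub]))

lemma inner_preFlip (x y : E.core ⊗[ℂ] E.core) :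
    inner ℂ (preFlip hreg hkill x) (preFlip hreg hkill y)
      = inner ℂ (E.tensorMap x) (E.tensorMap y) := by
  induction x using TensorProduct.induction_on with
  | zero => simp
  | add x x' hx hx' => simp only [map_add, inner_add_left, hx, hx']
  | tmul c d =>
    induction y using TensorProduct.induction_on with
    | zero => simp
    | add y y' hy hy' => simp only [map_add, inner_add_right, hy, hy']
    | tmul p q =>
      change inner ℂ (grad hreg hkill (c * d) - E.tensor d c)
        (grad hreg hkill (p * q) - E.tensor q p) = inner ℂ (E.tensor c d) (E.tensor p q)
      rw [inner_sub_left, inner_sub_right, inner_sub_right, inner_grad_grad, inner_grad_tensor,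
        inner_tensor_grad, inner_tensor, inner_tensor, star_mul,
        mul_comm (star d) (star c), ← flip_identity (star c) (star d) p q]
      ring

lemma norm_preFlip (x : E.core ⊗[ℂ] E.core) : ‖preFlip hreg hkill x‖ = ‖E.tensorMap x‖ := by
  rw [norm_eq_sqrt_re_inner (𝕜 := ℂ), norm_eq_sqrt_re_inner (𝕜 := ℂ) (E.tensorMap x),
    inner_preFlip]

/-- The symmetry `c ⊗ d ↦ ∂(c d) - d ⊗ c` of the space of 1-forms. -/
noncomputable def flip : E.OneForms →L[ℂ] E.OneForms :=
  (preFlip hreg hkill).extendOfNorm E.tensorMap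

lemma flip_tensorMap (x : E.core ⊗[ℂ] E.core) :
    flip hreg hkill (E.tensorMap x) = preFlip hreg hkill x :=
  LinearMap.extendOfNorm_eq E.denseRange_tensorMap
    ⟨1, fun x => by rw [norm_preFlip, one_mul]⟩ x

lemma flip_tensor (c d : E.core) :
    flip hreg hkill (E.tensor c d) = grad hreg hkill (c * d) - E.tensor d c :=
  flip_tensorMap hreg hkill (c ⊗ₜ d)

lemma inner_flip_flip (ω η : E.OneForms) :
    inner ℂ (flip hreg hkill ω) (flip hreg hkill η) = inner ℂ ω η := by
  refine E.denseRange_tensorMap.induction_on₂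
    (p := fun ω η => inner ℂ (flip hreg hkill ω) (flip hreg hkill η) = inner ℂ ω η)
    (isClosed_eq (by fun_prop) (by fun_prop)) (fun x y => ?_) ω η
  rw [flip_tensorMap, flip_tensorMap, inner_preFlip]

lemma norm_flip (ω : E.OneForms) : ‖flip hreg hkill ω‖ = ‖ω‖ := by
  rw [norm_eq_sqrt_re_inner (𝕜 := ℂ), norm_eq_sqrt_re_inner (𝕜 := ℂ) ω, inner_flip_flip]

/-- The flip of f ⊗ φ_n is eventually ∂f - φ_n ⊗ f, and ‖φ_n ⊗ f‖² = E(φ_n, |f|²) - E(φ_n², |f|²)/2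
eventually, which tends to zero. -/
lemma flip_grad (f : E.core) : flip hreg hkill (grad hreg hkill f) = grad hreg hkill f := by
  obtain ⟨φ, hφ⟩ := exists_isCutoffSeq hreg hkill
  have h1 := ((flip hreg hkill).continuous.tendsto _).comp (hφ.tendsto_tensor hreg hkill f)
  refine tendsto_nhds_unique h1 ?_
  have h0 : Tendsto (fun n => E.tensor (φ n) f) atTop (𝓝 0) := by
    refine tendsto_zero_of_norm_sq ?_
    simp only [norm_tensor_sq, hφ.star_eq]
    have hd : Tendsto (fun n : ℕ => (n, n)) atTop atTop := by
      rw [← prod_atTop_atTop_eq]; exact tendsto_id.prodMk tendsto_id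
    have h2 := ((hφ.energy_tendsto (star f * f)).add (hφ.energy_tendsto (star f * f))).sub
      ((hφ.energy_mul_tendsto (star f * f)).comp hd) |>.div_const 2
    rw [add_zero, sub_zero, zero_div] at h2
    refine h2.congr' ?_
    filter_upwards [hφ.mul_eq (star f * f)] with n hn
    simp only [Function.comp]
    rw [gammaInt, mul_comm (star f * f) (φ n), hn, E.energyC_comm (star f * f) (φ n),
      E.energyC_comm (star f * f) (φ n * φ n)]
  have h3 : Tendsto (fun n => grad hreg hkill f - E.tensor (φ n) f) atTop
      (𝓝 (grad hreg hkill f - 0)) := tendsto_const_nhds.sub h0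
  rw [sub_zero] at h3
  refine h3.congr' ?_
  filter_upwards [hφ.mul_eq f] with n hn
  rw [Function.comp, flip_tensor, mul_comm, hn]

/-- On a simple tensor, flipping ∂(cd) - d ⊗ c gives ∂(cd) - (∂(dc) - c ⊗ d), as gradients are
fixed. -/
lemma flip_flip (ω : E.OneForms) : flip hreg hkill (flip hreg hkill ω) = ω := by
  have : flip hreg hkill ∘L flip hreg hkill = ContinuousLinearMap.id ℂ E.OneForms := by
    refine clm_ext fun c d => ?_
    rw [ContinuousLinearMap.comp_apply, flip_tensor, map_sub, flip_grad, flip_tensor, mul_comm d c,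
      sub_sub_cancel, ContinuousLinearMap.id_apply]
  exact congrFun (congrArg DFunLike.coe this) ω

lemma inner_flip_left (ω η : E.OneForms) :
    inner ℂ (flip hreg hkill ω) η = inner ℂ ω (flip hreg hkill η) := by
  rw [← inner_flip_flip hreg hkill ω, flip_flip]

end Gradient

end DirichletForm

lemma ZeroAtInftyContinuousMap.norm_apply_le {X : Type*} [TopologicalSpace X] (a : C₀(X, ℂ))
    (x : X) : ‖a x‖ ≤ ‖a‖ := by
  rw [← ZeroAtInftyContinuousMap.norm_toBCF_eq_norm]
  exact a.toBCF.norm_coe_le_norm x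

/-! ### Right and left multiplication on 1-forms. -/

namespace DirichletForm

section Representation

variable {X : Type*} [TopologicalSpace X] [T2Space X] [LocallyCompactSpace X] [SigmaCompactSpace X]
  [MeasurableSpace X] [BorelSpace X]
  {μ : Measure X} [IsFiniteMeasureOnCompacts μ] {E : DirichletForm μ}

lemma energyC_ofRealCore (f g : E.realCore) :
    E.energyC (ofRealCore f) (ofRealCore g) = (E.energy f g : ℂ) := by
  rw [energyC_ofRealCore_left, rePart_ofRealCore, imPart_ofRealCore]
  simp [energy]

lemma eq_ofRealCore_add (a : E.core) :
    a = ofRealCore (rePart a) + Complex.I • ofRealCore (imPart a) := by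
  refine Subtype.ext (ZeroAtInftyContinuousMap.ext fun x => ?_)
  change (a : C₀(X, ℂ)) x
    = (((a : C₀(X, ℂ)) x).re : ℂ) + Complex.I * (((a : C₀(X, ℂ)) x).im : ℂ)
  rw [mul_comm, Complex.re_add_im]

lemma integrable_realCore (f φ : E.realCore) : Integrable (φ : X → ℝ) (E.energyMeasure f) := by
  have : IsFiniteMeasureOnCompacts (E.energyMeasure f) := by
    by_cases h : ∃ ν, E.IsEnergyMeasure f ν
    · rw [energyMeasure, dif_pos h]
      have := h.choose_spec.1
      infer_instance
    · rw [energyMeasure, dif_neg h]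
      infer_instance
  exact φ.2.1.integrable_of_hasCompactSupport φ.2.2.1

/-- The link between the algebraic functional and a positive measure: for a = u + iv the cross terms
± i Γ(u, v) cancel. -/
lemma gammaInt_star_self (hreg : E.IsRegular) (a : E.core) (φ : E.realCore) :
    E.gammaInt (star a) a (ofRealCore φ) = ((∫ x, (φ : X → ℝ) x ∂E.energyMeasureC a : ℝ) : ℂ) := by
  have hre : ∀ f : E.realCore, E.gammaInt (ofRealCore f) (ofRealCore f) (ofRealCore φ)
      = ((∫ x, (φ : X → ℝ) x ∂E.energyMeasure f : ℝ) : ℂ) := by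
    intro f
    rw [(isEnergyMeasure_energyMeasure hreg f).2 φ, gammaInt, ofRealCore_mul, ofRealCore_mul,
      energyC_ofRealCore, energyC_ofRealCore]
    push_cast
    ring
  rw [energyMeasureC, integral_add_measure (integrable_realCore _ _) (integrable_realCore _ _),
    Complex.ofReal_add, ← hre, ← hre]
  have h1 := eq_ofRealCore_add a
  have h2 : star a = ofRealCore (rePart a) + (-Complex.I) • ofRealCore (imPart a) := by
    conv_lhs => rw [h1]
    rw [star_add, star_smul, star_ofRealCore, star_ofRealCore, Complex.star_def, Complex.conj_I]
  rw [h2]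
  nth_rewrite 3 [h1]
  rw [gammaInt_add_left, gammaInt_add_right, gammaInt_add_right, gammaInt_smul_left,
    gammaInt_smul_right, gammaInt_smul_left, gammaInt_smul_right,
    E.gammaInt_comm (ofRealCore (imPart a)) (ofRealCore (rePart a))]
  linear_combination (-E.gammaInt (ofRealCore (imPart a)) (ofRealCore (imPart a)) (ofRealCore φ))
    * Complex.I_mul_I

lemma star_mul_self_eq (b : E.core) : star b * b
    = ofRealCore (rePart b * rePart b + imPart b * imPart b) := by
  refine Subtype.ext (ZeroAtInftyContinuousMap.ext fun x => ?_)
  change (starRingEnd ℂ) ((b : C₀(X, ℂ)) x) * (b : C₀(X, ℂ)) x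
    = ((((b : C₀(X, ℂ)) x).re * ((b : C₀(X, ℂ)) x).re
      + ((b : C₀(X, ℂ)) x).im * ((b : C₀(X, ℂ)) x).im : ℝ) : ℂ)
  rw [← Complex.normSq_eq_conj_mul_self, Complex.normSq_apply]

lemma norm_sq_eq (b : E.core) (x : X) : ‖(b : C₀(X, ℂ)) x‖ ^ 2
    = ((rePart b * rePart b + imPart b * imPart b : E.realCore) : X → ℝ) x := by
  rw [← Complex.normSq_eq_norm_sq, Complex.normSq_apply]
  rfl

lemma integrable_norm_sq (a b : E.core) :
    Integrable (fun x => ‖(b : C₀(X, ℂ)) x‖ ^ 2) (E.energyMeasureC a) := by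
  simp only [norm_sq_eq]
  exact (integrable_realCore _ _).add_measure (integrable_realCore _ _)

lemma norm_tensor_sq_eq_integral (hreg : E.IsRegular) (a b : E.core) :
    ‖E.tensor a b‖ ^ 2 = ∫ x, ‖(b : C₀(X, ℂ)) x‖ ^ 2 ∂E.energyMeasureC a := by
  apply Complex.ofReal_injective
  rw [norm_tensor_sq, star_mul_self_eq, gammaInt_star_self hreg]
  simp only [norm_sq_eq]

/-- A pointwise comparison under a positive measure. It is confined to simple tensors: for a sum,
mixed energy measures of no definite sign appear. -/
lemma norm_tensor_mul_le (hreg : E.IsRegular) (a b h : E.core) {M : ℝ} (hM : 0 ≤ M)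
    (hh : ∀ x, ‖(h : C₀(X, ℂ)) x‖ ≤ M) : ‖E.tensor a (b * h)‖ ≤ M * ‖E.tensor a b‖ := by
  refine abs_le_of_sq_le_sq' ?_ (by positivity) |>.2
  rw [mul_pow, norm_tensor_sq_eq_integral hreg, norm_tensor_sq_eq_integral hreg,
    ← integral_const_mul]
  refine integral_mono (integrable_norm_sq _ _) ((integrable_norm_sq _ _).const_mul _) fun x => ?_
  change ‖(b : C₀(X, ℂ)) x * (h : C₀(X, ℂ)) x‖ ^ 2 ≤ M ^ 2 * ‖(b : C₀(X, ℂ)) x‖ ^ 2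
  rw [norm_mul, mul_pow, mul_comm]
  have := hh x
  gcongr

/-- The right multiplication `c ⊗ d ↦ c ⊗ (d a)` on `C ⊗ C`. -/
noncomputable def preRight (a : E.core) : (E.core ⊗[ℂ] E.core) →ₗ[ℂ] (E.core ⊗[ℂ] E.core) :=
  TensorProduct.map LinearMap.id (LinearMap.mulRight ℂ a)

lemma preRight_tmul (a c d : E.core) : preRight a (c ⊗ₜ[ℂ] d) = c ⊗ₜ (d * a) := rfl

lemma inner_preRight (a : E.core) (x y : E.core ⊗[ℂ] E.core) :
    inner ℂ (E.tensorMap (preRight a x)) (E.tensorMap y)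
      = inner ℂ (E.tensorMap x) (E.tensorMap (preRight (star a) y)) := by
  induction x using TensorProduct.induction_on with
  | zero => simp
  | add x x' hx hx' => simp only [map_add, inner_add_left, hx, hx']
  | tmul c d =>
    induction y using TensorProduct.induction_on with
    | zero => simp
    | add y y' hy hy' => simp only [map_add, inner_add_right, hy, hy']
    | tmul p q =>
      rw [preRight_tmul, preRight_tmul, tensorMap_tmul, tensorMap_tmul, tensorMap_tmul,
        tensorMap_tmul, inner_tensor, inner_tensor, star_mul, mul_comm (star a), mul_assoc,
        mul_comm (star a)]

lemma preRight_preRight (a b : E.core) (x : E.core ⊗[ℂ] E.core) :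
    preRight a (preRight b x) = preRight (b * a) x := by
  induction x using TensorProduct.induction_on with
  | zero => simp
  | add x y hx hy => simp only [map_add, hx, hy]
  | tmul c d => rw [preRight_tmul, preRight_tmul, preRight_tmul, mul_assoc]

/-- On each simple tensor the k-th power grows at most like M^k; hence on every tensor it is at most
C M^k, with C depending on the tensor. For a symmetric operator this growth already forces the bound
M. -/
lemma norm_preRight_le_of_isSelfAdjoint (hreg : E.IsRegular) (h : E.core) (hs : star h = h) {M : ℝ}
    (hM : 0 ≤ M) (hh : ∀ x, ‖(h : C₀(X, ℂ)) x‖ ≤ M) (x : E.core ⊗[ℂ] E.core) :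
    ‖E.tensorMap (preRight h x)‖ ≤ M * ‖E.tensorMap x‖ := by
  let T : E.PreForms →ₗ[ℂ] E.PreForms :=
    E.toPreForms.toLinearMap ∘ₗ preRight h ∘ₗ E.toPreForms.symm.toLinearMap
  have hnorm : ∀ y : E.PreForms, ‖y‖ = ‖E.tensorMap (E.toPreForms.symm y)‖ := fun y =>
    (UniformSpace.Completion.norm_coe y).symm
  have hTk : ∀ (k : ℕ) (y : E.core ⊗[ℂ] E.core),
      (T ^ k) (E.toPreForms y) = E.toPreForms ((preRight h ^ k) y) := by
    intro k
    induction k with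
    | zero => intro y; rfl
    | succ k ih =>
      intro y
      rw [pow_succ, pow_succ, Module.End.mul_apply, Module.End.mul_apply, ← ih]
      rfl
  have hgrowth : ∃ C, ∀ k : ℕ, ‖E.tensorMap ((preRight h ^ k) x)‖ ≤ C * M ^ k := by
    induction x using TensorProduct.induction_on with
    | zero => exact ⟨0, fun k => by simp⟩
    | add x y hx hy =>
      obtain ⟨C, hC⟩ := hx
      obtain ⟨D, hD⟩ := hy
      refine ⟨C + D, fun k => ?_⟩
      rw [map_add, map_add, add_mul]
      exact (norm_add_le _ _).trans (add_le_add (hC k) (hD k))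
    | tmul c d =>
      refine ⟨‖E.tensor c d‖, fun k => ?_⟩
      suffices ∃ d', (preRight h ^ k) (c ⊗ₜ d) = c ⊗ₜ d' ∧
          ‖E.tensor c d'‖ ≤ ‖E.tensor c d‖ * M ^ k by
        obtain ⟨d', h1, h2⟩ := this
        rw [h1]; exact h2
      induction k with
      | zero => exact ⟨d, rfl, by simp⟩
      | succ k ih =>
        obtain ⟨d', h1, h2⟩ := ih
        refine ⟨d' * h, ?_, ?_⟩
        · rw [pow_succ', Module.End.mul_apply, h1, preRight_tmul]
        · refine (norm_tensor_mul_le hreg c d' h hM hh).trans ?_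
          rw [pow_succ, ← mul_assoc, mul_comm M]
          gcongr
  obtain ⟨C, hC⟩ := hgrowth
  have := T.norm_le_of_symmetric_of_growth (fun y z => ?_) hM (E.toPreForms x) (C := C) fun k => ?_
  · rw [hnorm, hnorm] at this
    exact this
  · have h1 := inner_preRight h (E.toPreForms.symm y) (E.toPreForms.symm z)
    rw [hs, inner_tensorMap, inner_tensorMap] at h1
    exact h1
  · rw [hTk, hnorm]
    exact hC k

/-- The C*-identity reduces to the self-adjoint multiplier |a|², since ‖xa‖² = ⟨x, x|a|²⟩. -/
lemma norm_preRight_le (hreg : E.IsRegular) (a : E.core) (x : E.core ⊗[ℂ] E.core) :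
    ‖E.tensorMap (preRight a x)‖ ≤ ‖(a : C₀(X, ℂ))‖ * ‖E.tensorMap x‖ := by
  refine abs_le_of_sq_le_sq' ?_ (by positivity) |>.2
  have h1 : ‖E.tensorMap (preRight a x)‖ ^ 2
      = ‖(inner ℂ (E.tensorMap x) (E.tensorMap (preRight (a * star a) x)) : ℂ)‖ := by
    rw [← preRight_preRight, ← inner_preRight, inner_self_eq_norm_sq_to_K]
    simp
  have h2 := norm_preRight_le_of_isSelfAdjoint hreg (a * star a) (by rw [star_mul, star_star])
    (M := ‖(a : C₀(X, ℂ))‖ ^ 2) (by positivity) (fun y => by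
      change ‖(a : C₀(X, ℂ)) y * (starRingEnd ℂ) ((a : C₀(X, ℂ)) y)‖ ≤ _
      rw [norm_mul, RCLike.norm_conj, ← sq]
      have := (a : C₀(X, ℂ)).norm_apply_le y
      gcongr) x
  rw [h1, mul_pow]
  refine (norm_inner_le_norm _ _).trans ?_
  nlinarith [norm_nonneg (E.tensorMap x)]

/-- The right action of `C` on the space of 1-forms, `(c ⊗ d) a = c ⊗ (d a)`. -/
noncomputable def rightMul (a : E.core) : E.OneForms →L[ℂ] E.OneForms :=
  (E.tensorMap ∘ₗ preRight a).extendOfNorm E.tensorMap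

lemma rightMul_tensorMap (hreg : E.IsRegular) (a : E.core) (x : E.core ⊗[ℂ] E.core) :
    rightMul a (E.tensorMap x) = E.tensorMap (preRight a x) :=
  LinearMap.extendOfNorm_eq E.denseRange_tensorMap ⟨_, norm_preRight_le hreg a⟩ x

lemma rightMul_tensor (hreg : E.IsRegular) (a c d : E.core) :
    rightMul a (E.tensor c d) = E.tensor c (d * a) :=
  rightMul_tensorMap hreg a (c ⊗ₜ d)

lemma norm_rightMul_le (hreg : E.IsRegular) (a : E.core) :
    ‖rightMul a‖ ≤ ‖(a : C₀(X, ℂ))‖ :=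
  LinearMap.opNorm_extendOfNorm_le E.denseRange_tensorMap (norm_nonneg _) (norm_preRight_le hreg a)

lemma inner_rightMul (hreg : E.IsRegular) (a : E.core) (ω η : E.OneForms) :
    inner ℂ (rightMul a ω) η = inner ℂ ω (rightMul (star a) η) := by
  refine E.denseRange_tensorMap.induction_on₂
    (p := fun ω η => inner ℂ (rightMul a ω) η = inner ℂ ω (rightMul (star a) η))
    (isClosed_eq (by fun_prop) (by fun_prop)) (fun x y => ?_) ω η
  rw [rightMul_tensorMap hreg, rightMul_tensorMap hreg, inner_preRight]

variable (hreg : E.IsRegular) (hkill : E.NoKilling)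

lemma rightMul_grad (a f : E.core) : rightMul a (grad hreg hkill f) = E.tensor f a := by
  obtain ⟨φ, hφ⟩ := exists_isCutoffSeq hreg hkill
  refine tendsto_nhds_unique (((rightMul a).continuous.tendsto _).comp
    (hφ.tendsto_tensor hreg hkill f)) (tendsto_const_nhds.congr' ?_)
  filter_upwards [hφ.mul_eq a] with n hn
  rw [Function.comp, rightMul_tensor hreg, hn]

/-- The left action of `C` on the space of 1-forms,
`a (c ⊗ d) = (a c) ⊗ d - a ⊗ (c d)`, as a star representation. -/
noncomputable def leftRep : E.core →⋆ₙₐ[ℂ] (E.OneForms →L[ℂ] E.OneForms) where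
  -- Conjugation by the flip, a self-adjoint unitary, transports boundedness, multiplicativity and
  -- the star from right multiplication.
  toFun a := flip hreg hkill ∘L rightMul a ∘L flip hreg hkill
  map_smul' r a := by
    have h : rightMul (r • a) = r • rightMul a := clm_ext fun c d => by
      rw [smul_apply, rightMul_tensor hreg, rightMul_tensor hreg,
        mul_smul_comm, tensor_smul_right]
    rw [h]
    ext ω
    simp
  map_zero' := by
    have h : rightMul (0 : E.core) = 0 := clm_ext fun c d => by
      rw [rightMul_tensor hreg, mul_zero, ← tensorMap_tmul, TensorProduct.tmul_zero, map_zero,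
        zero_apply]
    rw [h]
    ext ω
    simp
  map_add' a b := by
    have h : rightMul (a + b) = rightMul a + rightMul b := clm_ext fun c d => by
      rw [add_apply, rightMul_tensor hreg, rightMul_tensor hreg,
        rightMul_tensor hreg, mul_add, tensor_add_right]
    rw [h]
    ext ω
    simp
  map_mul' a b := by
    have h : rightMul (a * b) = rightMul a ∘L rightMul b := clm_ext fun c d => by
      rw [ContinuousLinearMap.comp_apply, rightMul_tensor hreg, rightMul_tensor hreg,
        rightMul_tensor hreg, mul_comm a, mul_assoc]
    rw [h]
    ext ω
    simp [flip_flip]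
  map_star' a := by
    rw [ContinuousLinearMap.star_eq_adjoint, ContinuousLinearMap.eq_adjoint_iff]
    intro ω η
    simp only [ContinuousLinearMap.comp_apply]
    rw [inner_flip_left, inner_rightMul hreg, star_star, inner_flip_left]

lemma leftRep_apply (a : E.core) (ω : E.OneForms) :
    leftRep hreg hkill a ω = flip hreg hkill (rightMul a (flip hreg hkill ω)) := rfl

lemma norm_leftRep_le (a : E.core) : ‖leftRep hreg hkill a‖ ≤ ‖(a : C₀(X, ℂ))‖ := by
  refine ContinuousLinearMap.opNorm_le_bound _ (norm_nonneg _) fun ω => ?_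
  rw [leftRep_apply, norm_flip]
  refine ((rightMul a).le_of_opNorm_le (norm_rightMul_le hreg a) _).trans_eq ?_
  rw [norm_flip]

/-- Right multiplication sends ∂(cd) - d ⊗ c to (cd) ⊗ a - d ⊗ (ca). Flipping this, the two
gradients ∂(cda) cancel. -/
lemma leftRep_tensor (a c d : E.core) : leftRep hreg hkill a (E.tensor c d)
    = E.tensor (a * c) d - E.tensor a (c * d) := by
  rw [leftRep_apply, flip_tensor, map_sub, rightMul_grad, rightMul_tensor hreg, map_sub,
    flip_tensor, flip_tensor, mul_comm d (c * a), mul_right_comm c d a, mul_comm c a]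
  abel

/-- The Leibniz rule. -/
lemma grad_mul (a f : E.core) : grad hreg hkill (a * f)
    = leftRep hreg hkill a (grad hreg hkill f) + E.tensor a f := by
  rw [leftRep_apply, flip_grad, rightMul_grad, flip_tensor, mul_comm f, sub_add_cancel]

/-- The product rule in the form used to show that bounded energy density passes to products. -/
lemma tensor_mul_left (a f g : E.core) : E.tensor (f * g) a
    = leftRep hreg hkill f (E.tensor g a) + E.tensor f (g * a) := by
  rw [leftRep_tensor, sub_add_cancel]

end Representation

end DirichletForm

/-! ### The density of Γ(a) as the best constant for b ↦ a ⊗ b. -/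

namespace DirichletForm

section Density

variable {X : Type*} [MetricSpace X] [LocallyCompactSpace X] [SigmaCompactSpace X]
  [MeasurableSpace X] [BorelSpace X]
  {μ : Measure X} [IsFiniteMeasureOnCompacts μ] {E : DirichletForm μ}

lemma continuous_core (a : E.core) : Continuous (a : C₀(X, ℂ)) := (a : C₀(X, ℂ)).continuous

lemma hasCompactSupport_core (a : E.core) : HasCompactSupport (a : C₀(X, ℂ)) := by
  refine ((rePart a).2.2.1.isCompact.union (imPart a).2.2.1.isCompact).of_isClosed_subset
    (isClosed_tsupport _) (closure_minimal (fun x hx => ?_)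
      ((isClosed_tsupport _).union (isClosed_tsupport _)))
  by_contra hcon
  rw [Set.mem_union, not_or] at hcon
  have h1 : (rePart a : X → ℝ) x = 0 := image_eq_zero_of_notMem_tsupport hcon.1
  have h2 : (imPart a : X → ℝ) x = 0 := image_eq_zero_of_notMem_tsupport hcon.2
  exact hx (Complex.ext h1 h2)

/-- The inclusion of `C` into `L²(X, μ)`. -/
noncomputable def coreLp (E : DirichletForm μ) : E.core →ₗ[ℂ] Lp ℂ 2 μ where
  toFun a := ((continuous_core a).memLp_of_hasCompactSupport (hasCompactSupport_core a)).toLp _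
  map_add' _ _ := rfl
  map_smul' _ _ := rfl

lemma coreLp_coeFn (a : E.core) : E.coreLp a =ᵐ[μ] (a : C₀(X, ℂ)) :=
  ((continuous_core a).memLp_of_hasCompactSupport (hasCompactSupport_core a)).coeFn_toLp

lemma enorm_coreLp_sq (a : E.core) :
    ‖E.coreLp a‖ₑ ^ 2 = ∫⁻ x, ‖(a : C₀(X, ℂ)) x‖ₑ ^ 2 ∂μ := by
  rw [Lp.enorm_def, eLpNorm_congr_ae (coreLp_coeFn a),
    eLpNorm_eq_lintegral_rpow_enorm_toReal two_ne_zero ENNReal.ofNat_ne_top]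
  rw [← ENNReal.rpow_natCast, ← ENNReal.rpow_mul]
  simp

lemma enorm_tensor_sq (hreg : E.IsRegular) (a b : E.core) :
    ‖E.tensor a b‖ₑ ^ 2 = ∫⁻ x, ‖(b : C₀(X, ℂ)) x‖ₑ ^ 2 ∂E.energyMeasureC a := by
  rw [← ofReal_norm, ← ENNReal.ofReal_pow (norm_nonneg _), norm_tensor_sq_eq_integral hreg,
    ofReal_integral_eq_lintegral_ofReal (integrable_norm_sq a b)
      (Eventually.of_forall fun x => by positivity)]
  refine lintegral_congr fun x => ?_
  rw [← ofReal_norm, ← ENNReal.ofReal_pow (norm_nonneg _)]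

lemma isFiniteMeasureOnCompacts_energyMeasureC (hreg : E.IsRegular) (a : E.core) :
    IsFiniteMeasureOnCompacts (E.energyMeasureC a) := by
  have h1 := (isEnergyMeasure_energyMeasure hreg (rePart a)).1
  have h2 := (isEnergyMeasure_energyMeasure hreg (imPart a)).1
  refine ⟨fun K hK => ?_⟩
  rw [energyMeasureC, Measure.add_apply]
  exact ENNReal.add_lt_top.2 ⟨hK.measure_lt_top, hK.measure_lt_top⟩

/-- Energy dominance writes Γ(a) as a density times μ, and the density is a.e. at most its essential
supremum. -/
lemma enorm_tensor_sq_le (hreg : E.IsRegular) (hdom : E.IsEnergyDominant) (a b : E.core) :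
    ‖E.tensor a b‖ₑ ^ 2 ≤ E.gammaSup a * ‖E.coreLp b‖ₑ ^ 2 := by
  have := isFiniteMeasureOnCompacts_energyMeasureC hreg a
  have hac : E.energyMeasureC a ≪ μ :=
    Measure.AbsolutelyContinuous.add_left (hdom _) (hdom _)
  have hm : Measurable fun x => ‖(b : C₀(X, ℂ)) x‖ₑ ^ 2 :=
    (continuous_core b).measurable.enorm.pow_const 2
  rw [enorm_tensor_sq hreg, enorm_coreLp_sq, ← Measure.withDensity_rnDeriv_eq _ _ hac,
    lintegral_withDensity_eq_lintegral_mul _ (Measure.measurable_rnDeriv _ _) hm,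
    ← lintegral_const_mul _ hm]
  refine lintegral_mono_ae ?_
  filter_upwards [ENNReal.ae_le_essSup ((E.energyMeasureC a).rnDeriv μ)] with x hx
  rw [Pi.mul_apply]
  gcongr
  exact hx

/-- Cutoffs b between a compact K and an open U give Γ(a)(K) ≤ k μ(U). Outer regularity of μ
replaces U by K, and inner regularity of Γ(a) passes to all measurable sets. -/
lemma energyMeasureC_le (hreg : E.IsRegular) (a : E.core) {k : ℝ≥0∞} (hk : k ≠ ∞)
    (h : ∀ b, ‖E.tensor a b‖ₑ ^ 2 ≤ k * ‖E.coreLp b‖ₑ ^ 2) : E.energyMeasureC a ≤ k • μ := by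
  have := isFiniteMeasureOnCompacts_energyMeasureC hreg a
  have hKU : ∀ K U : Set X, IsCompact K → IsOpen U → K ⊆ U →
      E.energyMeasureC a K ≤ k * μ U := by
    intro K U hK hU hKU
    obtain ⟨g, hg0, hg1, hgK, hgU⟩ := exists_cutoff hreg hK hU hKU
    have hval : ∀ x, ((ofRealCore g : E.core) : C₀(X, ℂ)) x = ((g : X → ℝ) x : ℂ) := fun x => rfl
    calc E.energyMeasureC a K = ∫⁻ x, K.indicator 1 x ∂E.energyMeasureC a :=
          (lintegral_indicator_one hK.measurableSet).symm
      _ ≤ ∫⁻ x, ‖((ofRealCore g : E.core) : C₀(X, ℂ)) x‖ₑ ^ 2 ∂E.energyMeasureC a := by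
          refine lintegral_mono fun x => ?_
          by_cases hx : x ∈ K
          · rw [hval, hgK.self_of_nhdsSet x hx, Set.indicator_of_mem hx]
            simp
          · simp [hx]
      _ ≤ k * ∫⁻ x, ‖((ofRealCore g : E.core) : C₀(X, ℂ)) x‖ₑ ^ 2 ∂μ := by
          rw [← enorm_tensor_sq hreg, ← enorm_coreLp_sq]
          exact h _
      _ ≤ k * ∫⁻ x, U.indicator 1 x ∂μ := by
          gcongr with x
          by_cases hx : x ∈ U
          · rw [hval, Set.indicator_of_mem hx, Pi.one_apply]
            refine pow_le_one₀ zero_le (?_ : ‖((g : X → ℝ) x : ℂ)‖ₑ ≤ 1)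
            rw [← ofReal_norm, Complex.norm_real, Real.norm_of_nonneg (hg0 x)]
            exact ENNReal.ofReal_le_one.2 (hg1 x)
          · rw [hval, hgU x hx]
            simp
      _ = k * μ U := by rw [lintegral_indicator_one hU.measurableSet]
  have hK : ∀ K : Set X, IsCompact K → E.energyMeasureC a K ≤ k * μ K := by
    intro K hK
    -- Moving k inside the infimum over U needs k ≠ 0, as μ(U) may be infinite. For k = 0 the choice
    -- U = X is enough.
    rcases eq_or_ne k 0 with rfl | hk0
    · simpa using hKU K Set.univ hK isOpen_univ (Set.subset_univ K)
    · rw [K.measure_eq_iInf_isOpen μ]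
      simp only [ENNReal.mul_iInf_of_ne hk0 hk]
      exact le_iInf fun U => le_iInf fun hU => le_iInf fun hUo => hKU K U hK hUo hU
  refine Measure.le_iff.2 fun s hs => ?_
  rw [hs.measure_eq_iSup_isCompact]
  refine iSup₂_le fun K hKs => iSup_le fun hKc => (hK K hKc).trans ?_
  rw [Measure.smul_apply, smul_eq_mul]
  gcongr

/-- The converse of `enorm_tensor_sq_le`: finiteness of ‖Γ(a)‖_∞ becomes an operator bound for b ↦ a
⊗ b, which is easy to combine algebraically. -/
lemma gammaSup_le (hreg : E.IsRegular) (hdom : E.IsEnergyDominant) (a : E.core) {k : ℝ≥0∞}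
    (hk : k ≠ ∞) (h : ∀ b, ‖E.tensor a b‖ₑ ^ 2 ≤ k * ‖E.coreLp b‖ₑ ^ 2) : E.gammaSup a ≤ k := by
  have := isFiniteMeasureOnCompacts_energyMeasureC hreg a
  have hac : E.energyMeasureC a ≪ μ :=
    Measure.AbsolutelyContinuous.add_left (hdom _) (hdom _)
  refine essSup_le_of_ae_le _ (?_ : (E.energyMeasureC a).rnDeriv μ ≤ᵐ[μ] fun _ => k)
  refine ae_le_of_forall_setLIntegral_le_of_sigmaFinite (Measure.measurable_rnDeriv _ _)
    fun s hs _ => ?_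
  rw [← withDensity_apply _ hs, Measure.withDensity_rnDeriv_eq _ _ hac, setLIntegral_const]
  exact energyMeasureC_le hreg a hk h s

end Density

end DirichletForm

/-! ### Multiplication operators on L². -/

namespace ZeroAtInftyContinuousMap

variable {X : Type*} [TopologicalSpace X] [MeasurableSpace X] [BorelSpace X] {μ : Measure X}

lemma memLp_mul (a : C₀(X, ℂ)) (f : Lp ℂ 2 μ) : MemLp (fun x => a x * f x) 2 μ :=
  (Lp.memLp f).of_le_mul (c := ‖a‖)
    (a.continuous.aestronglyMeasurable.mul (Lp.aestronglyMeasurable f))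
    (Eventually.of_forall fun x => by
      rw [norm_mul]
      gcongr
      exact a.norm_apply_le x)

/-- Multiplication by `a` on `L²`. -/
noncomputable def mulLp (a : C₀(X, ℂ)) : Lp ℂ 2 μ →L[ℂ] Lp ℂ 2 μ :=
  LinearMap.mkContinuous
    { toFun := fun f => (memLp_mul a f).toLp _
      map_add' := fun f g => Lp.ext (by
        filter_upwards [(memLp_mul a (f + g)).coeFn_toLp, (memLp_mul a f).coeFn_toLp,
          (memLp_mul a g).coeFn_toLp, Lp.coeFn_add f g,
          Lp.coeFn_add ((memLp_mul a f).toLp _) ((memLp_mul a g).toLp _)] with x h1 h2 h3 h4 h5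
        rw [h1, h5, Pi.add_apply, h2, h3, h4, Pi.add_apply, mul_add])
      map_smul' := fun c f => Lp.ext (by
        filter_upwards [(memLp_mul a (c • f)).coeFn_toLp, (memLp_mul a f).coeFn_toLp,
          Lp.coeFn_smul c f, Lp.coeFn_smul c ((memLp_mul a f).toLp _)] with x h1 h2 h3 h4
        rw [h1, RingHom.id_apply, h4, Pi.smul_apply, h2, h3, Pi.smul_apply, mul_smul_comm]) }
    ‖a‖ fun f => Lp.norm_le_mul_norm_of_ae_le_mul (by
      filter_upwards [(memLp_mul a f).coeFn_toLp] with x h1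
      change ‖((memLp_mul a f).toLp _ : Lp ℂ 2 μ) x‖ ≤ _
      rw [h1, norm_mul]
      gcongr
      exact a.norm_apply_le x)

lemma mulLp_coeFn (a : C₀(X, ℂ)) (f : Lp ℂ 2 μ) : mulLp a f =ᵐ[μ] fun x => a x * f x :=
  (memLp_mul a f).coeFn_toLp

lemma norm_mulLp_le (a : C₀(X, ℂ)) : ‖(mulLp a : Lp ℂ 2 μ →L[ℂ] Lp ℂ 2 μ)‖ ≤ ‖a‖ :=
  LinearMap.mkContinuous_norm_le _ (norm_nonneg _) _

/-- The representation of `C₀(X)` on `L²` by multiplication. -/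
noncomputable def mulRep (μ : Measure X) : C₀(X, ℂ) →⋆ₙₐ[ℂ] (Lp ℂ 2 μ →L[ℂ] Lp ℂ 2 μ) where
  toFun a := mulLp a
  map_smul' c a := ContinuousLinearMap.ext fun f => Lp.ext (by
    filter_upwards [mulLp_coeFn (c • a) f, mulLp_coeFn a f, Lp.coeFn_smul c (mulLp a f)]
      with x h1 h2 h3
    change (mulLp (c • a) f) x = (c • mulLp a f : Lp ℂ 2 μ) x
    rw [h1, h3, Pi.smul_apply, h2, smul_apply, smul_mul_assoc])
  map_zero' := ContinuousLinearMap.ext fun f => Lp.ext (by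
    filter_upwards [mulLp_coeFn 0 f, Lp.coeFn_zero ℂ 2 μ] with x h1 h2
    change (mulLp 0 f) x = (0 : Lp ℂ 2 μ) x
    rw [h1, h2, coe_zero, Pi.zero_apply, zero_mul])
  map_add' a b := ContinuousLinearMap.ext fun f => Lp.ext (by
    filter_upwards [mulLp_coeFn (a + b) f, mulLp_coeFn a f, mulLp_coeFn b f,
      Lp.coeFn_add (mulLp a f) (mulLp b f)] with x h1 h2 h3 h4
    change (mulLp (a + b) f) x = (mulLp a f + mulLp b f : Lp ℂ 2 μ) x
    rw [h1, h4, Pi.add_apply, h2, h3, add_apply, add_mul])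
  map_mul' a b := ContinuousLinearMap.ext fun f => Lp.ext (by
    filter_upwards [mulLp_coeFn (a * b) f, mulLp_coeFn b f, mulLp_coeFn a (mulLp b f)]
      with x h1 h2 h3
    change (mulLp (a * b) f) x = (mulLp a (mulLp b f) : Lp ℂ 2 μ) x
    rw [h1, h3, h2, mul_apply, mul_assoc])
  map_star' a := by
    rw [ContinuousLinearMap.star_eq_adjoint, ContinuousLinearMap.eq_adjoint_iff]
    intro f g
    rw [L2.inner_def, L2.inner_def]
    refine integral_congr_ae ?_
    filter_upwards [mulLp_coeFn (star a) f, mulLp_coeFn a g] with x h1 h2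
    rw [h1, h2, star_apply, RCLike.inner_apply, RCLike.inner_apply, map_mul, Complex.star_def,
      Complex.conj_conj]
    ring

lemma mulRep_coeFn (a : C₀(X, ℂ)) (f : Lp ℂ 2 μ) : mulRep μ a f =ᵐ[μ] fun x => a x * f x :=
  mulLp_coeFn a f

/-- Multiplication operators determine the function if the measure charges open sets. -/
lemma mulRep_injective [LocallyCompactSpace X] [T2Space X] [IsFiniteMeasureOnCompacts μ]
    [μ.IsOpenPosMeasure] : Function.Injective (mulRep μ) := by
  rw [injective_iff_map_eq_zero]
  intro a ha
  ext x
  by_contra hx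
  have hU : IsOpen {y | a y ≠ 0} := isOpen_ne_fun a.continuous continuous_const
  -- The test function is the indicator of a compact neighbourhood K of x on which a does not
  -- vanish; its interior would be a null set.
  obtain ⟨K, hK, hxK, hKU⟩ := exists_compact_subset hU hx
  have h1 : MemLp (K.indicator fun _ => (1 : ℂ)) 2 μ :=
    memLp_indicator_const 2 hK.measurableSet 1 (Or.inr hK.measure_lt_top.ne)
  have h2 : mulRep μ a (h1.toLp _) = 0 := by rw [ha]; rfl
  have h3 : μ (interior K) = 0 := by
    refine measure_mono_null (fun y hy => ?_) ((ae_iff (p := fun y =>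
      a y * K.indicator (fun _ => (1 : ℂ)) y = 0)).1 ?_)
    · change ¬ (a y * K.indicator (fun _ => (1 : ℂ)) y = 0)
      rw [Set.indicator_of_mem (interior_subset hy), mul_one]
      exact hKU (interior_subset hy)
    · filter_upwards [mulRep_coeFn a (h1.toLp _), h1.coeFn_toLp, Lp.coeFn_zero ℂ 2 μ]
        with y e1 e2 e3
      rw [h2, e3, e2] at e1
      exact e1.symm
  exact (isOpen_interior.measure_pos μ ⟨x, hxK⟩).ne' h3

end ZeroAtInftyContinuousMap

lemma exists_extension_of_denseRange {V F G : Type*} [AddCommMonoid V] [Module ℂ V]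
    [NormedAddCommGroup F] [NormedSpace ℂ F] [CompleteSpace F] [NormedAddCommGroup G]
    [NormedSpace ℂ G] (f : V →ₗ[ℂ] F) (e : V →ₗ[ℂ] G) (he : DenseRange e) {C : ℝ} (hC : 0 ≤ C)
    (h : ∀ x, ‖f x‖ ≤ C * ‖e x‖) : ∃ T : G →L[ℂ] F, (∀ x, T (e x) = f x) ∧ ‖T‖ ≤ C := by
  let _ : AddCommGroup V := Module.addCommMonoidToAddCommGroup ℂ
  exact ⟨f.extendOfNorm e, LinearMap.extendOfNorm_eq he ⟨C, h⟩,
    LinearMap.opNorm_extendOfNorm_le he hC h⟩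

/-! ### The algebra of functions with bounded energy density. -/

namespace DirichletForm

section BoundedEnergy

variable {X : Type*} [MetricSpace X] [LocallyCompactSpace X] [SigmaCompactSpace X]
  [MeasurableSpace X] [BorelSpace X]
  {μ : Measure X} [IsFiniteMeasureOnCompacts μ] {E : DirichletForm μ}

lemma coreLp_mul (a b : E.core) : E.coreLp (a * b) =
    ZeroAtInftyContinuousMap.mulRep μ (a : C₀(X, ℂ)) (E.coreLp b) := Lp.ext (by
  filter_upwards [coreLp_coeFn (a * b), coreLp_coeFn b,
    ZeroAtInftyContinuousMap.mulRep_coeFn (a : C₀(X, ℂ)) (E.coreLp b)] with x h1 h2 h3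
  rw [h1, h3, h2]
  rfl)

lemma norm_coreLp_mul_le (a b : E.core) :
    ‖E.coreLp (a * b)‖ ≤ ‖(a : C₀(X, ℂ))‖ * ‖E.coreLp b‖ := by
  rw [coreLp_mul]
  exact ContinuousLinearMap.le_of_opNorm_le _ (ZeroAtInftyContinuousMap.norm_mulLp_le _) _

/-- The inclusion of the real into the complex `L²` space. -/
noncomputable def ofRealLp (μ : Measure X) : Lp ℝ 2 μ →L[ℝ] Lp ℂ 2 μ :=
  Complex.ofRealCLM.compLpL 2 μ

lemma ofRealLp_coeFn (f : Lp ℝ 2 μ) : ofRealLp μ f =ᵐ[μ] fun x => (f x : ℂ) :=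
  Complex.ofRealCLM.coeFn_compLpL f

lemma coreLp_ofRealCore (g : E.realCore) :
    E.coreLp (ofRealCore g) = ofRealLp μ (E.toDomain g : Lp ℝ 2 μ) := Lp.ext (by
  filter_upwards [coreLp_coeFn (ofRealCore g), ofRealLp_coeFn (E.toDomain g : Lp ℝ 2 μ),
    E.toDomain_coeFn g] with x h1 h2 h3
  rw [h1, h2, h3]
  rfl)

lemma exists_ofRealLp_add (f : Lp ℂ 2 μ) :
    ∃ u v : Lp ℝ 2 μ, f = ofRealLp μ u + Complex.I • ofRealLp μ v := by
  refine ⟨Complex.reCLM.compLpL 2 μ f, Complex.imCLM.compLpL 2 μ f, Lp.ext ?_⟩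
  filter_upwards [ofRealLp_coeFn (Complex.reCLM.compLpL 2 μ f),
    ofRealLp_coeFn (Complex.imCLM.compLpL 2 μ f), Complex.reCLM.coeFn_compLpL f,
    Complex.imCLM.coeFn_compLpL f, Lp.coeFn_add (ofRealLp μ (Complex.reCLM.compLpL 2 μ f))
      (Complex.I • ofRealLp μ (Complex.imCLM.compLpL 2 μ f)),
    Lp.coeFn_smul Complex.I (ofRealLp μ (Complex.imCLM.compLpL 2 μ f))] with x h1 h2 h3 h4 h5 h6
  rw [h5, Pi.add_apply, h6, Pi.smul_apply, h1, h2, h3, h4, smul_eq_mul, mul_comm]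
  exact (Complex.re_add_im _).symm

lemma exists_realCore_norm_lt (hreg : E.IsRegular) (w : Lp ℝ 2 μ) {ε : ℝ} (hε : 0 < ε) :
    ∃ g : E.realCore, ‖w - (E.toDomain g : Lp ℝ 2 μ)‖ < ε := by
  obtain ⟨u, hu, hus⟩ := Metric.dense_iff.1 E.dense_domain w (ε / 2) (half_pos hε)
  obtain ⟨g, hg⟩ := hreg.2 ⟨u, hus⟩ ((ε / 2) ^ 2) (by positivity)
  refine ⟨g, ?_⟩
  have h1 : ‖u - (E.toDomain g : Lp ℝ 2 μ)‖ < ε / 2 := by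
    refine lt_of_pow_lt_pow_left₀ 2 (by positivity) (lt_of_le_of_lt ?_ hg)
    exact le_add_of_nonneg_left (E.nonneg _)
  have h2 : ‖w - u‖ < ε / 2 := by rwa [← dist_eq_norm, dist_comm]
  calc ‖w - (E.toDomain g : Lp ℝ 2 μ)‖ = ‖(w - u) + (u - (E.toDomain g : Lp ℝ 2 μ))‖ := by
        rw [sub_add_sub_cancel]
    _ < ε := (norm_add_le _ _).trans_lt (by linarith)

lemma denseRange_coreLp (hreg : E.IsRegular) : DenseRange E.coreLp := by
  have hS : (E.coreLp.range : Set (Lp ℂ 2 μ)) = Set.range E.coreLp := rfl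
  have hre : ∀ w : Lp ℝ 2 μ, ofRealLp μ w ∈ E.coreLp.range.topologicalClosure := by
    intro w
    have hw : w ∈ closure (Set.range fun g => (E.toDomain g : Lp ℝ 2 μ)) := by
      rw [Metric.mem_closure_range_iff]
      intro ε hε
      obtain ⟨g, hg⟩ := exists_realCore_norm_lt hreg w hε
      exact ⟨g, by rwa [dist_eq_norm]⟩
    refine map_mem_closure (ofRealLp μ).continuous hw ?_
    rintro _ ⟨g, rfl⟩
    exact ⟨ofRealCore g, coreLp_ofRealCore g⟩
  intro f
  obtain ⟨u, v, rfl⟩ := exists_ofRealLp_add f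
  exact add_mem (hre u) (Submodule.smul_mem _ _ (hre v))

variable (hreg : E.IsRegular) (hkill : E.NoKilling) (hdom : E.IsEnergyDominant)

lemma norm_tensor_le (hreg : E.IsRegular) (hdom : E.IsEnergyDominant) (a b : E.core)
    (ha : E.gammaSup a < ⊤) : ‖E.tensor a b‖ ≤ √(E.gammaSup a).toReal * ‖E.coreLp b‖ := by
  refine abs_le_of_sq_le_sq' ?_ (by positivity) |>.2
  have h := ENNReal.toReal_mono (ENNReal.mul_ne_top ha.ne (by simp))
    (enorm_tensor_sq_le hreg hdom a b)
  rw [mul_pow, Real.sq_sqrt ENNReal.toReal_nonneg]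
  simpa using h

/-- Reduces the closure properties of A₀ to norm estimates in the space of 1-forms, with no calculus
of densities. -/
lemma gammaSup_lt_top (hreg : E.IsRegular) (hdom : E.IsEnergyDominant) {a : E.core} {C : ℝ}
    (h : ∀ b, ‖E.tensor a b‖ ≤ C * ‖E.coreLp b‖) :
    E.gammaSup a < ⊤ := by
  refine (gammaSup_le hreg hdom a (k := ENNReal.ofReal C ^ 2) (by simp) fun b => ?_).trans_lt
    (by simp)
  rw [← mul_pow]
  gcongr
  rw [← ofReal_norm, ← ofReal_norm, ← ENNReal.ofReal_mul' (norm_nonneg _)]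
  exact ENNReal.ofReal_le_ofReal (h b)

lemma norm_tensor_star (a b : E.core) : ‖E.tensor (star a) b‖ = ‖E.tensor a b‖ := by
  have : ‖E.tensor (star a) b‖ ^ 2 = ‖E.tensor a b‖ ^ 2 := by
    apply Complex.ofReal_injective
    rw [norm_tensor_sq, norm_tensor_sq, star_star, gammaInt_comm]
  exact (sq_eq_sq₀ (norm_nonneg _) (norm_nonneg _)).1 this

lemma gammaSup_add_lt_top (hreg : E.IsRegular) (hdom : E.IsEnergyDominant) {a b : E.core}
    (ha : E.gammaSup a < ⊤) (hb : E.gammaSup b < ⊤) : E.gammaSup (a + b) < ⊤ := by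
  refine gammaSup_lt_top hreg hdom
    (C := √(E.gammaSup a).toReal + √(E.gammaSup b).toReal) fun c => ?_
  rw [tensor_add_left, add_mul]
  exact (norm_add_le _ _).trans
    (add_le_add (norm_tensor_le hreg hdom _ _ ha) (norm_tensor_le hreg hdom _ _ hb))

/-- From (ab) ⊗ c = a(b ⊗ c) + a ⊗ (bc): the left action is bounded by the sup norm of a, and
multiplication by b on L² by that of b. -/
lemma gammaSup_mul_lt_top (hreg : E.IsRegular) (hkill : E.NoKilling) (hdom : E.IsEnergyDominant)
    {a b : E.core} (ha : E.gammaSup a < ⊤) (hb : E.gammaSup b < ⊤) : E.gammaSup (a * b) < ⊤ := by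
  refine gammaSup_lt_top hreg hdom (C := ‖(a : C₀(X, ℂ))‖ * √(E.gammaSup b).toReal
    + √(E.gammaSup a).toReal * ‖(b : C₀(X, ℂ))‖) fun c => ?_
  rw [tensor_mul_left hreg hkill, add_mul, mul_assoc, mul_assoc]
  refine (norm_add_le _ _).trans (add_le_add ?_ ?_)
  · refine (ContinuousLinearMap.le_of_opNorm_le _ (norm_leftRep_le hreg hkill _) _).trans ?_
    gcongr
    exact norm_tensor_le hreg hdom _ _ hb
  · refine (norm_tensor_le hreg hdom _ _ ha).trans ?_
    gcongr
    exact norm_coreLp_mul_le _ _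

lemma gammaSup_zero_lt_top (hreg : E.IsRegular) (hdom : E.IsEnergyDominant) :
    E.gammaSup (0 : E.core) < ⊤ := by
  refine gammaSup_lt_top hreg hdom (C := 0) fun b => ?_
  rw [← tensorMap_tmul, TensorProduct.zero_tmul, map_zero, norm_zero, zero_mul]

lemma gammaSup_smul_lt_top (hreg : E.IsRegular) (hdom : E.IsEnergyDominant) (c : ℂ) {a : E.core}
    (ha : E.gammaSup a < ⊤) : E.gammaSup (c • a) < ⊤ := by
  refine gammaSup_lt_top hreg hdom (C := ‖c‖ * √(E.gammaSup a).toReal) fun b => ?_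
  rw [tensor_smul_left, norm_smul, mul_assoc]
  gcongr
  exact norm_tensor_le hreg hdom _ _ ha

lemma gammaSup_star_lt_top (hreg : E.IsRegular) (hdom : E.IsEnergyDominant) {a : E.core}
    (ha : E.gammaSup a < ⊤) : E.gammaSup (star a) < ⊤ := by
  refine gammaSup_lt_top hreg hdom (C := √(E.gammaSup a).toReal) fun b => ?_
  rw [norm_tensor_star]
  exact norm_tensor_le hreg hdom _ _ ha

/-- The algebra `A₀` of functions of bounded energy density. -/
noncomputable def boundedSubalgebra : NonUnitalStarSubalgebra ℂ C₀(X, ℂ) where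
  carrier := E.boundedEnergy
  zero_mem' := by
    have h2 := gammaSup_zero_lt_top hreg hdom
    exact ⟨zero_mem _, h2⟩
  add_mem' := by
    rintro f g ⟨hf, hf'⟩ ⟨hg, hg'⟩
    have h1 : f + g ∈ E.core := add_mem hf hg
    have h2 := gammaSup_add_lt_top hreg hdom hf' hg'
    have h3 : (⟨f, hf⟩ + ⟨g, hg⟩ : E.core) = ⟨f + g, h1⟩ := rfl
    rw [h3] at h2
    exact ⟨h1, h2⟩
  smul_mem' := by
    rintro c f ⟨hf, hf'⟩
    have h1 : c • f ∈ E.core := SMulMemClass.smul_mem c hf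
    have h2 := gammaSup_smul_lt_top hreg hdom c hf'
    have h3 : (c • ⟨f, hf⟩ : E.core) = ⟨c • f, h1⟩ := rfl
    rw [h3] at h2
    exact ⟨h1, h2⟩
  mul_mem' := by
    rintro f g ⟨hf, hf'⟩ ⟨hg, hg'⟩
    have h1 : f * g ∈ E.core := mul_mem hf hg
    have h2 := gammaSup_mul_lt_top hreg hkill hdom hf' hg'
    have h3 : (⟨f, hf⟩ * ⟨g, hg⟩ : E.core) = ⟨f * g, h1⟩ := rfl
    rw [h3] at h2
    exact ⟨h1, h2⟩
  star_mem' := by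
    rintro f ⟨hf, hf'⟩
    have h1 : star f ∈ E.core := star_mem hf
    have h2 := gammaSup_star_lt_top hreg hdom hf'
    have h3 : (star ⟨f, hf⟩ : E.core) = ⟨star f, h1⟩ := rfl
    rw [h3] at h2
    exact ⟨h1, h2⟩

/-- The bounded operator `M_a : L² → H`, `f ↦ a ⊗ f`, for `a` of bounded energy density. -/
lemma exists_tensorL (hreg : E.IsRegular) {a : E.core} {C : ℝ} (hC : 0 ≤ C)
    (h : ∀ b, ‖E.tensor a b‖ ≤ C * ‖E.coreLp b‖) :
    ∃ M : Lp ℂ 2 μ →L[ℂ] E.OneForms, (∀ b, M (E.coreLp b) = E.tensor a b) ∧ ‖M‖ ≤ C :=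
  exists_extension_of_denseRange
    { toFun := fun b => E.tensor a b
      map_add' := tensor_add_right a
      map_smul' := fun r b => tensor_smul_right r a b } E.coreLp (denseRange_coreLp hreg) hC h

end BoundedEnergy

end DirichletForm

/-! ### Closability of the gradient and its domain. -/

namespace DirichletForm

section Closable

variable {X : Type*} [MetricSpace X] [LocallyCompactSpace X] [SigmaCompactSpace X]
  [MeasurableSpace X] [BorelSpace X]
  {μ : Measure X} [IsFiniteMeasureOnCompacts μ] {E : DirichletForm μ}

lemma norm_sq_ofRealLp_add (u v : Lp ℝ 2 μ) :
    ‖ofRealLp μ u + Complex.I • ofRealLp μ v‖ ^ 2 = ‖u‖ ^ 2 + ‖v‖ ^ 2 := by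
  have hC : ∀ f : Lp ℂ 2 μ, ‖f‖ ^ 2 = ∫ x, ‖f x‖ ^ 2 ∂μ := fun f => by
    apply Complex.ofReal_injective
    have := inner_self_eq_norm_sq_to_K (𝕜 := ℂ) f
    rw [L2.inner_def] at this
    push_cast
    refine this.symm.trans ?_
    rw [← integral_complex_ofReal]
    refine integral_congr_ae (Eventually.of_forall fun x => ?_)
    change inner ℂ (f x) (f x) = _
    rw [inner_self_eq_norm_sq_to_K]
    push_cast
    rfl
  have hR : ∀ f : Lp ℝ 2 μ, ‖f‖ ^ 2 = ∫ x, f x ^ 2 ∂μ := fun f => by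
    rw [← real_inner_self_eq_norm_sq, L2.inner_def]
    refine integral_congr_ae (Eventually.of_forall fun x => ?_)
    change inner ℝ (f x) (f x) = _
    rw [real_inner_self_eq_norm_sq, Real.norm_eq_abs, sq_abs]
  rw [hC, hR, hR, ← integral_add (Lp.memLp u).integrable_sq (Lp.memLp v).integrable_sq]
  refine integral_congr_ae ?_
  filter_upwards [ofRealLp_coeFn u, ofRealLp_coeFn v,
    Lp.coeFn_add (ofRealLp μ u) (Complex.I • ofRealLp μ v),
    Lp.coeFn_smul Complex.I (ofRealLp μ v)] with x h1 h2 h3 h4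
  rw [h3, Pi.add_apply, h4, Pi.smul_apply, h1, h2, ← Complex.normSq_eq_norm_sq,
    Complex.normSq_apply]
  simp
  ring

lemma ofRealLp_add_eq_zero {u v : Lp ℝ 2 μ} (h : ofRealLp μ u + Complex.I • ofRealLp μ v = 0) :
    u = 0 ∧ v = 0 := by
  have h1 := norm_sq_ofRealLp_add u v
  rw [h, norm_zero] at h1
  constructor <;> rw [← norm_eq_zero] <;> nlinarith [sq_nonneg ‖u‖, sq_nonneg ‖v‖]

lemma coreLp_eq (a : E.core) : E.coreLp a = ofRealLp μ (E.toDomain (rePart a) : Lp ℝ 2 μ)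
    + Complex.I • ofRealLp μ (E.toDomain (imPart a) : Lp ℝ 2 μ) := by
  conv_lhs => rw [eq_ofRealCore_add a]
  rw [map_add, map_smul, coreLp_ofRealCore, coreLp_ofRealCore]

lemma norm_grad_sq (hreg : E.IsRegular) (hkill : E.NoKilling)
    (a : E.core) : ‖grad hreg hkill a‖ ^ 2
    = E.energy (rePart a) (rePart a) + E.energy (imPart a) (imPart a) := by
  have h := inner_grad_grad hreg hkill a a
  rw [inner_self_eq_norm_sq_to_K] at h
  have h2 := congrArg Complex.re h
  rw [energyC_re, rePart_star, imPart_star] at h2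
  have h3 : ((‖grad hreg hkill a‖ : ℂ) ^ 2).re = ‖grad hreg hkill a‖ ^ 2 := by
    rw [← Complex.ofReal_pow, Complex.ofReal_re]
  refine h3.symm.trans (h2.trans ?_)
  simp [energy]

lemma mem_gradientGraph_iff (hreg : E.IsRegular) (hkill : E.NoKilling)
    {p : Lp ℂ 2 μ × E.OneForms} :
    p ∈ E.gradientGraph ↔ ∃ a : E.core, p = (E.coreLp a, grad hreg hkill a) := by
  constructor
  · rintro ⟨a, h1, h2⟩
    exact ⟨a, Prod.ext (Lp.ext (h1.trans (coreLp_coeFn a).symm)) (h2.eq_grad hreg hkill)⟩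
  · rintro ⟨a, rfl⟩
    exact ⟨a, coreLp_coeFn a, isGradient_grad hreg hkill a⟩

lemma mem_closure_gradientGraph (hreg : E.IsRegular) (hkill : E.NoKilling)
    {p : Lp ℂ 2 μ × E.OneForms}
    (hp : p ∈ E.gradientGraph.topologicalClosure) : ∃ a : ℕ → E.core,
      Tendsto (fun n => E.coreLp (a n)) atTop (𝓝 p.1) ∧
      Tendsto (fun n => grad hreg hkill (a n)) atTop (𝓝 p.2) := by
  obtain ⟨x, hx, hlim⟩ := mem_closure_iff_seq_limit.1 hp
  choose a ha using fun n => (mem_gradientGraph_iff hreg hkill).1 (hx n)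
  have : x = fun n => (E.coreLp (a n), grad hreg hkill (a n)) := funext ha
  rw [this] at hlim
  exact ⟨a, (continuous_fst.tendsto _).comp hlim, (continuous_snd.tendsto _).comp hlim⟩

/-- The closure of the gradient lives on the complexified domain of the form, and is single
valued. -/
lemma exists_of_mem_closure_gradientGraph (hreg : E.IsRegular) (hkill : E.NoKilling)
    {p : Lp ℂ 2 μ × E.OneForms}
    (hp : p ∈ E.gradientGraph.topologicalClosure) : ∃ u v : E.domain,
      p.1 = ofRealLp μ u + Complex.I • ofRealLp μ v ∧ (u = 0 → v = 0 → p.2 = 0) := by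
  obtain ⟨a, h1, h2⟩ := mem_closure_gradientGraph hreg hkill hp
  have hre : ∀ a b : E.core, E.toDomain (rePart (a + (-1 : ℂ) • b))
      = E.toDomain (rePart a) - E.toDomain (rePart b) := fun a b => by
    rw [rePart_add, rePart_smul, map_add]
    simp [sub_eq_add_neg]
  have him : ∀ a b : E.core, E.toDomain (imPart (a + (-1 : ℂ) • b))
      = E.toDomain (imPart a) - E.toDomain (imPart b) := fun a b => by
    rw [imPart_add, imPart_smul, map_add]
    simp [sub_eq_add_neg]
  -- The squared graph norm of a ∈ C is the sum of the E₁-energies of its real and imaginary parts,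
  -- so Cauchy in the graph means Cauchy for E₁.
  have hC : ∀ ε > 0, ∃ N, ∀ m ≥ N, ∀ n ≥ N,
      E.energyOne (E.toDomain (rePart (a m)) - E.toDomain (rePart (a n)))
      + E.energyOne (E.toDomain (imPart (a m)) - E.toDomain (imPart (a n))) < ε := by
    intro ε hε
    obtain ⟨N₁, hN₁⟩ := Metric.cauchySeq_iff.1 h1.cauchySeq √(ε / 2) (by positivity)
    obtain ⟨N₂, hN₂⟩ := Metric.cauchySeq_iff.1 h2.cauchySeq √(ε / 2) (by positivity)
    refine ⟨max N₁ N₂, fun m hm n hn => ?_⟩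
    have e1 := hN₁ m (le_of_max_le_left hm) n (le_of_max_le_left hn)
    have e2 := hN₂ m (le_of_max_le_right hm) n (le_of_max_le_right hn)
    rw [dist_eq_norm, Real.lt_sqrt (norm_nonneg _), sub_eq_add_neg, ← neg_one_smul ℂ, ← map_smul,
      ← map_add] at e1 e2
    rw [coreLp_eq, norm_sq_ofRealLp_add, hre, him] at e1
    rw [norm_grad_sq, energy, energy, hre, him] at e2
    simp only [energyOne]
    linarith
  have hlimit : ∀ w : ℕ → E.domain, (∀ ε > 0, ∃ N, ∀ m ≥ N, ∀ n ≥ N,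
      E.energyOne (w m - w n) < ε) → ∃ u : E.domain,
      Tendsto (fun n => E.form (w n - u) (w n - u)) atTop (𝓝 0) ∧
      Tendsto (fun n => (w n : Lp ℝ 2 μ)) atTop (𝓝 (u : Lp ℝ 2 μ)) := by
    intro w hw
    obtain ⟨u, hu⟩ := E.complete w hw
    refine ⟨u, squeeze_zero (fun n => E.nonneg _)
      (fun n => le_add_of_nonneg_right (sq_nonneg _)) hu, ?_⟩
    rw [tendsto_iff_norm_sub_tendsto_zero]
    have h3 := squeeze_zero (fun n => sq_nonneg _)
      (fun n => le_add_of_nonneg_left (E.nonneg (w n - u))) hu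
    simpa [Real.sqrt_sq] using h3.sqrt
  obtain ⟨u, hu, hu'⟩ := hlimit (fun n => E.toDomain (rePart (a n))) fun ε hε => by
    obtain ⟨N, hN⟩ := hC ε hε
    exact ⟨N, fun m hm n hn => lt_of_le_of_lt
      (le_add_of_nonneg_right (E.energyOne_nonneg _)) (hN m hm n hn)⟩
  obtain ⟨v, hv, hv'⟩ := hlimit (fun n => E.toDomain (imPart (a n))) fun ε hε => by
    obtain ⟨N, hN⟩ := hC ε hε
    exact ⟨N, fun m hm n hn => lt_of_le_of_lt
      (le_add_of_nonneg_left (E.energyOne_nonneg _)) (hN m hm n hn)⟩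
  refine ⟨u, v, ?_, ?_⟩
  · refine tendsto_nhds_unique h1 ?_
    simp only [coreLp_eq]
    exact (((ofRealLp μ).continuous.tendsto _).comp hu').add
      ((((ofRealLp μ).continuous.tendsto _).comp hv').const_smul Complex.I)
  -- If the L² limit is zero then so is the E₁ limit, and ‖∂a_n‖² is the energy of a_n.
  · rintro rfl rfl
    refine tendsto_nhds_unique h2 ?_
    refine tendsto_zero_of_norm_sq ?_
    simp only [norm_grad_sq]
    have h3 := hu.add hv
    simp only [sub_zero, add_zero] at h3
    exact_mod_cast (Complex.continuous_ofReal.tendsto _).comp h3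

/-- Every element of the domain of the form has a gradient. -/
lemma exists_gradient_ofRealLp (hreg : E.IsRegular) (hkill : E.NoKilling)
    (u : E.domain) : ∃ ω : E.OneForms,
    (ofRealLp μ (u : Lp ℝ 2 μ), ω) ∈ E.gradientGraph.topologicalClosure ∧
    ∀ b : E.core, inner ℂ ω (grad hreg hkill b)
      = E.form u (E.toDomain (rePart b)) + E.form u (E.toDomain (imPart b)) * Complex.I := by
  -- The tolerance is a square because E₁ is quadratic: the distance to u in L² and in energy norm
  -- is then at most 1/(n + 1).
  choose g hg using fun n : ℕ => hreg.2 u ((1 / ((n : ℝ) + 1)) ^ 2) (by positivity)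
  have hr : Tendsto (fun n : ℕ => 1 / ((n : ℝ) + 1)) atTop (𝓝 0) :=
    tendsto_one_div_add_atTop_nhds_zero_nat
  have hr2 : Tendsto (fun n : ℕ => (1 / ((n : ℝ) + 1)) ^ 2) atTop (𝓝 0) := by
    simpa using hr.pow 2
  have hform : ∀ n, E.form (u - E.toDomain (g n)) (u - E.toDomain (g n))
      ≤ (1 / ((n : ℝ) + 1)) ^ 2 := fun n =>
    (le_add_of_nonneg_right (sq_nonneg _)).trans (hg n).le
  have hL : Tendsto (fun n => (E.toDomain (g n) : Lp ℝ 2 μ)) atTop (𝓝 (u : Lp ℝ 2 μ)) := by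
    rw [tendsto_iff_norm_sub_tendsto_zero]
    refine squeeze_zero (fun n => norm_nonneg _) (fun n => ?_) hr
    rw [norm_sub_rev]
    refine abs_le_of_sq_le_sq' ((le_add_of_nonneg_left (E.nonneg _)).trans (hg n).le)
      (by positivity) |>.2
  -- The factor 2 comes from the parallelogram law: the energy of g_n - g_m is at most twice the sum
  -- of the energies of u - g_n and u - g_m.
  have hC : CauchySeq fun n => grad hreg hkill (ofRealCore (g n)) := by
    refine cauchySeq_of_le_tendsto_0 (fun n : ℕ => 2 * (1 / ((n : ℝ) + 1))) (fun n m N hn hm => ?_)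
      (by simpa using hr.const_mul 2)
    refine abs_le_of_sq_le_sq' ?_ (by positivity) |>.2
    have e1 : E.toDomain (g n - g m)
        = (u - E.toDomain (g m)) - (u - E.toDomain (g n)) := by
      rw [map_sub]; abel
    have e2 : rePart (ofRealCore (g n) + (-1 : ℂ) • ofRealCore (g m)) = g n - g m := by
      rw [rePart_add, rePart_smul]
      simp [rePart_ofRealCore, sub_eq_add_neg]
    have e3 : imPart (ofRealCore (g n) + (-1 : ℂ) • ofRealCore (g m)) = 0 := by
      rw [imPart_add, imPart_smul]
      simp [imPart_ofRealCore]
    have hmono : ∀ k, N ≤ k → (1 / ((k : ℝ) + 1)) ^ 2 ≤ (1 / ((N : ℝ) + 1)) ^ 2 := by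
      intro k hk
      have : (N : ℝ) ≤ k := by exact_mod_cast hk
      gcongr
    rw [dist_eq_norm, sub_eq_add_neg, ← neg_one_smul ℂ, ← map_smul, ← map_add, norm_grad_sq, e2,
      e3, energy, energy, e1, map_zero (E.toDomain), map_zero (E.form 0), add_zero]
    have h1 := E.form_parallelogram (u - E.toDomain (g m)) (u - E.toDomain (g n))
    have h2 := E.nonneg ((u - E.toDomain (g m)) + (u - E.toDomain (g n)))
    have h3 := (hform n).trans (hmono n hn)
    have h4 := (hform m).trans (hmono m hm)
    rw [mul_pow]
    linarith
  obtain ⟨ω, hω⟩ := cauchySeq_tendsto_of_complete hC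
  refine ⟨ω, ?_, fun b => ?_⟩
  · refine mem_closure_of_tendsto (f := fun n =>
      (E.coreLp (ofRealCore (g n)), grad hreg hkill (ofRealCore (g n)))) (b := atTop) ?_
      (Eventually.of_forall fun n => (mem_gradientGraph_iff hreg hkill).2 ⟨_, rfl⟩)
    refine Tendsto.prodMk_nhds ?_ hω
    simp only [coreLp_ofRealCore]
    exact ((ofRealLp μ).continuous.tendsto _).comp hL
  · refine tendsto_nhds_unique (hω.inner (𝕜 := ℂ) tendsto_const_nhds) ?_
    have hw : ∀ w : E.domain, Tendsto (fun n => ((E.form (E.toDomain (g n)) w : ℝ) : ℂ)) atTop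
        (𝓝 (E.form u w : ℂ)) := by
      intro w
      refine (Complex.continuous_ofReal.tendsto _).comp ?_
      rw [tendsto_iff_norm_sub_tendsto_zero]
      have h0 : Tendsto (fun n => ‖E.form (E.toDomain (g n)) w - E.form u w‖ ^ 2) atTop (𝓝 0) := by
        refine squeeze_zero (fun n => sq_nonneg _) (fun n => ?_)
          (by simpa only [zero_mul] using hr2.mul_const (E.form w w))
        rw [Real.norm_eq_abs, sq_abs, ← neg_sq, neg_sub, ← LinearMap.sub_apply, ← map_sub]
        exact (E.form_cauchy _ _).trans (mul_le_mul_of_nonneg_right (hform n) (E.nonneg w))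
      simpa [Real.sqrt_sq_eq_abs] using h0.sqrt
    refine ((hw _).add ((hw _).mul_const Complex.I)).congr fun n => ?_
    rw [inner_grad_grad, star_ofRealCore, energyC_ofRealCore_left]
    rfl

/-- `Submodule.toLinearPMap` has the prescribed graph as soon as this is single valued, which is the
closability of ∂ and comes from the closedness of the form. -/
lemma graph_gradient (hreg : E.IsRegular) (hkill : E.NoKilling) :
    E.gradient.graph = E.gradientGraph.topologicalClosure := by
  refine Submodule.toLinearPMap_graph_eq _ fun p hp h0 => ?_
  obtain ⟨u, v, h1, h2⟩ := exists_of_mem_closure_gradientGraph hreg hkill hp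
  rw [h0] at h1
  obtain ⟨hu, hv⟩ := ofRealLp_add_eq_zero h1.symm
  exact h2 (Subtype.ext hu) (Subtype.ext hv)

lemma isClosed_gradient (hreg : E.IsRegular) (hkill : E.NoKilling) : E.gradient.IsClosed := by
  rw [LinearPMap.IsClosed, graph_gradient hreg hkill]
  exact Submodule.isClosed_topologicalClosure _

lemma exists_gradient_eq (hreg : E.IsRegular) (hkill : E.NoKilling)
    {f : Lp ℂ 2 μ} {ω : E.OneForms}
    (h : (f, ω) ∈ E.gradientGraph.topologicalClosure) :
    ∃ hf : f ∈ E.gradient.domain, E.gradient ⟨f, hf⟩ = ω := by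
  rw [← graph_gradient hreg hkill, LinearPMap.mem_graph_iff] at h
  obtain ⟨⟨y, hy⟩, rfl, h2⟩ := h
  exact ⟨hy, h2⟩

lemma gradient_mem (hreg : E.IsRegular) (hkill : E.NoKilling)
    (f : E.gradient.domain) :
    ((f : Lp ℂ 2 μ), E.gradient f) ∈ E.gradientGraph.topologicalClosure := by
  rw [← graph_gradient hreg hkill]
  exact E.gradient.mem_graph f

/-- Completeness of the form puts limits of graph-Cauchy sequences in F; the E₁-density of C in F
gives the opposite inclusion. -/
lemma gradient_domain (hreg : E.IsRegular) (hkill : E.NoKilling) :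
    (E.gradient.domain : Set (Lp ℂ 2 μ)) = E.complexDomain := by
  ext f
  constructor
  · intro hf
    obtain ⟨u, v, h, -⟩ := exists_of_mem_closure_gradientGraph hreg hkill
      (gradient_mem hreg hkill ⟨f, hf⟩)
    refine ⟨u, u.2, v, v.2, ?_⟩
    have h' : f = ofRealLp μ u + Complex.I • ofRealLp μ v := h
    filter_upwards [ofRealLp_coeFn (u : Lp ℝ 2 μ), ofRealLp_coeFn (v : Lp ℝ 2 μ),
      Lp.coeFn_add (ofRealLp μ (u : Lp ℝ 2 μ)) (Complex.I • ofRealLp μ (v : Lp ℝ 2 μ)),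
      Lp.coeFn_smul Complex.I (ofRealLp μ (v : Lp ℝ 2 μ))] with x h1 h2 h3 h4
    rw [h', h3, Pi.add_apply, h4, Pi.smul_apply, h1, h2, smul_eq_mul, mul_comm]
  · rintro ⟨u, hu, v, hv, h⟩
    obtain ⟨ω, hω, -⟩ := exists_gradient_ofRealLp hreg hkill ⟨u, hu⟩
    obtain ⟨η, hη, -⟩ := exists_gradient_ofRealLp hreg hkill ⟨v, hv⟩
    have hf : f = ofRealLp μ u + Complex.I • ofRealLp μ v := Lp.ext (by
      filter_upwards [h, ofRealLp_coeFn u, ofRealLp_coeFn v,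
        Lp.coeFn_add (ofRealLp μ u) (Complex.I • ofRealLp μ v),
        Lp.coeFn_smul Complex.I (ofRealLp μ v)] with x h0 h1 h2 h3 h4
      rw [h0, h3, Pi.add_apply, h4, Pi.smul_apply, h1, h2, smul_eq_mul, mul_comm Complex.I])
    rw [hf]
    exact (exists_gradient_eq hreg hkill
      (add_mem hω (Submodule.smul_mem _ Complex.I hη))).1

lemma dense_gradient_domain (hreg : E.IsRegular) (hkill : E.NoKilling) :
    Dense (E.gradient.domain : Set (Lp ℂ 2 μ)) := by
  refine (denseRange_coreLp hreg).mono ?_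
  rintro _ ⟨a, rfl⟩
  exact (exists_gradient_eq hreg hkill (Submodule.le_topologicalClosure _
    ((mem_gradientGraph_iff hreg hkill).2 ⟨a, rfl⟩))).1

end Closable

end DirichletForm

/-! ### Bounded commutators from the Leibniz rule. -/

open ContinuousLinearMap in
/-- A Leibniz rule for `T` and bounded operators gives a bounded commutator with the off-diagonal
operator of `T`. -/
lemma isCommutator_offDiag {H₁ H₂ : Type*} [NormedAddCommGroup H₁]
    [InnerProductSpace ℂ H₁] [CompleteSpace H₁] [NormedAddCommGroup H₂] [InnerProductSpace ℂ H₂]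
    [CompleteSpace H₂] {T : H₁ →ₗ.[ℂ] H₂} (hd : Dense (T.domain : Set H₁)) {P : H₁ →L[ℂ] H₁}
    {Q : H₂ →L[ℂ] H₂} {M M' : H₁ →L[ℂ] H₂}
    (h : ∀ f : T.domain, ∃ hf : P f ∈ T.domain, T ⟨P f, hf⟩ = Q (T f) + M f)
    (h' : ∀ f : T.domain, ∃ hf : adjoint P f ∈ T.domain,
      T ⟨adjoint P f, hf⟩ = adjoint Q (T f) + M' f) :
    IsCommutator (LinearPMap.offDiag T) (diagL P Q) (offDiagL M (-adjoint M')) := by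
  intro v
  -- The Leibniz rule for the adjoints gives ⟨Q ω, T x⟩ = ⟨ω, T P* x⟩ - ⟨ω, M' x⟩ = ⟨P T* ω - M'* ω,
  -- x⟩, so Q preserves dom T* and T* Q = P T* - M'* there.
  have hadj : ∀ x : T.domain,
      inner ℂ (P (T.adjoint ⟨(v : WithLp 2 (H₁ × H₂)).snd, v.2.2⟩)
        - adjoint M' (v : WithLp 2 (H₁ × H₂)).snd) (x : H₁)
      = inner ℂ (Q (v : WithLp 2 (H₁ × H₂)).snd) (T x) := by
    intro x
    obtain ⟨hx, hx'⟩ := h' x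
    have h1 := LinearPMap.adjoint_isFormalAdjoint hd ⟨(v : WithLp 2 (H₁ × H₂)).snd, v.2.2⟩
      ⟨adjoint P x, hx⟩
    rw [hx', inner_add_right, adjoint_inner_right, adjoint_inner_right] at h1
    rw [inner_sub_left, h1, adjoint_inner_left]
    exact add_sub_cancel_right _ _
  obtain ⟨h1, h2⟩ := h ⟨(v : WithLp 2 (H₁ × H₂)).fst, v.2.1⟩
  have h3 : Q (v : WithLp 2 (H₁ × H₂)).snd ∈ T.adjoint.domain :=
    LinearPMap.mem_adjoint_domain_of_exists _ ⟨_, hadj⟩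
  have h4 := LinearPMap.adjoint_apply_eq hd ⟨_, h3⟩ hadj
  refine ⟨⟨h1, h3⟩, ?_⟩
  change WithLp.toLp 2
    (T.adjoint ⟨_, h3⟩ - P (T.adjoint ⟨(v : WithLp 2 (H₁ × H₂)).snd, v.2.2⟩),
      T ⟨_, h1⟩ - Q (T ⟨(v : WithLp 2 (H₁ × H₂)).fst, v.2.1⟩)) = WithLp.toLp 2
    (-adjoint M' (v : WithLp 2 (H₁ × H₂)).snd, M (v : WithLp 2 (H₁ × H₂)).fst)
  rw [h2, h4, sub_sub_cancel_left, add_sub_cancel_left]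

namespace DirichletForm

section Commutator

variable {X : Type*} [MetricSpace X] [LocallyCompactSpace X] [SigmaCompactSpace X]
  [MeasurableSpace X] [BorelSpace X]
  {μ : Measure X} [IsFiniteMeasureOnCompacts μ] {E : DirichletForm μ}

open ZeroAtInftyContinuousMap (mulRep)

/-- The Leibniz rule on the domain of the closed gradient. -/
lemma gradient_mul (hreg : E.IsRegular) (hkill : E.NoKilling) {a : E.core}
    {M : Lp ℂ 2 μ →L[ℂ] E.OneForms} (hM : ∀ b, M (E.coreLp b) = E.tensor a b)
    (f : E.gradient.domain) : ∃ hf : mulRep μ (a : C₀(X, ℂ)) f ∈ E.gradient.domain,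
      E.gradient ⟨mulRep μ (a : C₀(X, ℂ)) f, hf⟩
        = leftRep hreg hkill a (E.gradient f) + M f := by
  refine exists_gradient_eq hreg hkill ?_
  -- The rule holds on the graph over C, and the bounded map (f, ω) ↦ (af, aω + M f) carries it to
  -- the closure.
  refine map_mem_closure (f := fun p : Lp ℂ 2 μ × E.OneForms =>
    (mulRep μ (a : C₀(X, ℂ)) p.1, leftRep hreg hkill a p.2 + M p.1)) (by fun_prop)
    (gradient_mem hreg hkill f) ?_
  intro p hp
  obtain ⟨b, rfl⟩ := (mem_gradientGraph_iff hreg hkill).1 hp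
  exact (mem_gradientGraph_iff hreg hkill).2 ⟨a * b, by
    rw [coreLp_mul, grad_mul, ← hM]⟩

/-- The commutator is built from M = a ⊗ · and N = ā ⊗ ·, the latter for the adjoint multiplication.
Both have norm at most the square root of ‖Γ(a)‖_∞. -/
lemma exists_isCommutator (hreg : E.IsRegular) (hkill : E.NoKilling) (hdom : E.IsEnergyDominant)
    {a : E.core} (ha : E.gammaSup a < ⊤) : ∃ T : E.Spinors →L[ℂ] E.Spinors,
      IsCommutator E.dirac
        (ContinuousLinearMap.diagL (mulRep μ (a : C₀(X, ℂ))) (leftRep hreg hkill a)) T ∧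
      ENNReal.ofReal (‖T‖ ^ 2) ≤ E.gammaSup a := by
  obtain ⟨M, hM, hM'⟩ := exists_tensorL hreg (Real.sqrt_nonneg _) fun b =>
    norm_tensor_le hreg hdom a b ha
  obtain ⟨N, hN, hN'⟩ := exists_tensorL (a := star a) hreg (Real.sqrt_nonneg _) fun b =>
    (norm_tensor_star a b).trans_le (norm_tensor_le hreg hdom a b ha)
  refine ⟨_, isCommutator_offDiag (M' := N) (dense_gradient_domain hreg hkill)
    (gradient_mul hreg hkill hM) fun f => ?_, ?_⟩
  · rw [← ContinuousLinearMap.star_eq_adjoint, ← ContinuousLinearMap.star_eq_adjoint, ← map_star,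
      ← map_star]
    exact gradient_mul hreg hkill hN f
  · have h1 := ContinuousLinearMap.norm_offDiagL_le (P := M) (Q := -ContinuousLinearMap.adjoint N)
      hM' (by rwa [norm_neg, LinearIsometryEquiv.norm_map])
    refine (ENNReal.ofReal_le_ofReal (pow_le_pow_left₀ (norm_nonneg _) h1 2)).trans ?_
    rw [Real.sq_sqrt ENNReal.toReal_nonneg]
    exact ENNReal.ofReal_toReal_le

end Commutator

end DirichletForm

/-! ### Discrete spectrum of the generator and compact resolvents. -/

namespace DirichletForm

section Spectrum

variable {X : Type*} [MetricSpace X] [LocallyCompactSpace X] [SigmaCompactSpace X]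
  [MeasurableSpace X] [BorelSpace X]
  {μ : Measure X} [IsFiniteMeasureOnCompacts μ] {E : DirichletForm μ}

lemma inner_ofRealLp (u v : Lp ℝ 2 μ) :
    inner ℂ (ofRealLp μ u) (ofRealLp μ v) = ((inner ℝ u v : ℝ) : ℂ) := by
  rw [L2.inner_def, L2.inner_def, ← integral_complex_ofReal]
  refine integral_congr_ae ?_
  filter_upwards [ofRealLp_coeFn u, ofRealLp_coeFn v] with x h1 h2
  rw [h1, h2]
  simp

/-- An element of the domain of the generator solves the weak eigenvalue equation. -/
lemma form_eq_of_generator {u : Lp ℝ 2 μ} (hu : u ∈ E.generator.domain) :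
    ∃ h : u ∈ E.domain, ∀ v : E.domain,
      E.form ⟨u, h⟩ v = -inner ℝ (E.generator ⟨u, hu⟩) (v : Lp ℝ 2 μ) := by
  refine Submodule.mem_graph_toLinearPMap ?_ ⟨u, hu⟩
  -- The generator is single valued: for x = 0, the value y is orthogonal to the dense domain of the
  -- form.
  rintro ⟨x, y⟩ ⟨hx, hxy⟩ (rfl : x = 0)
  refine E.dense_domain.eq_zero_of_inner_left ℝ fun v hv => ?_
  have h1 := hxy ⟨v, hv⟩
  have h2 : (⟨0, hx⟩ : E.domain) = 0 := rfl
  change E.form ⟨0, hx⟩ ⟨v, hv⟩ = -inner ℝ y v at h1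
  rw [h2, map_zero, LinearMap.zero_apply] at h1
  linarith

/-- The real eigenbasis is also an orthonormal basis of the complex L², and weakly ⟨∂φ_i, ∂g⟩ = ev_i
⟨φ_i, g⟩, so the φ_i are eigenvectors of ∂*∂. -/
lemma hasCompactResolventOn_dirac (hreg : E.IsRegular) (hkill : E.NoKilling)
    (hL : E.HasDiscreteSpectrum) : HasCompactResolventOn E.dirac (kernel E.dirac)ᗮ := by
  obtain ⟨ι, φ, ev, hev, hφ⟩ := hL
  choose h1 h2 using hφ
  choose h3 h4 using fun i => form_eq_of_generator (h1 i)
  have hform : ∀ i (v : E.domain), E.form ⟨φ i, h3 i⟩ v = ev i * inner ℝ (φ i) (v : Lp ℝ 2 μ) := by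
    intro i v
    rw [h4, ← inner_neg_left, h2, real_inner_smul_left]
  choose ω hω hω' using fun i => exists_gradient_ofRealLp hreg hkill ⟨φ i, h3 i⟩
  choose hd hT using fun i => exists_gradient_eq hreg hkill (hω i)
  refine LinearPMap.hasCompactResolventOn_offDiag (isClosed_gradient hreg hkill)
    (dense_gradient_domain hreg hkill) (fun i => ⟨_, hd i⟩) ?_ ?_ ev ?_ hev
  · classical
    rw [orthonormal_iff_ite]
    intro i j
    change inner ℂ (ofRealLp μ (φ i)) (ofRealLp μ (φ j)) = _
    rw [inner_ofRealLp, orthonormal_iff_ite.1 φ.orthonormal]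
    split_ifs <;> simp
  · intro f hf
    obtain ⟨u, v, rfl⟩ := exists_ofRealLp_add f
    have huv : ∀ i, inner ℝ (φ i) u = 0 ∧ inner ℝ (φ i) v = 0 := by
      intro i
      have h5 := hf i
      change inner ℂ (ofRealLp μ (φ i)) _ = _ at h5
      rw [inner_add_right, inner_smul_right, inner_ofRealLp, inner_ofRealLp] at h5
      have h6 := congrArg Complex.re h5
      have h7 := congrArg Complex.im h5
      simp only [Complex.add_re, Complex.add_im, Complex.mul_re, Complex.mul_im, Complex.I_re,
        Complex.I_im, Complex.ofReal_re, Complex.ofReal_im, Complex.zero_re, Complex.zero_im]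
        at h6 h7
      constructor <;> linarith
    have hzero : ∀ w : Lp ℝ 2 μ, (∀ i, inner ℝ (φ i) w = 0) → w = 0 := by
      intro w hw
      refine φ.repr.injective (lp.ext (funext fun i => ?_))
      rw [φ.repr_apply_apply, hw, map_zero]
      rfl
    rw [hzero u fun i => (huv i).1, hzero v fun i => (huv i).2, map_zero, smul_zero, add_zero]
  · intro i g
    rw [hT]
    change inner ℂ (ω i) (E.gradient g) = ev i * inner ℂ (ofRealLp μ (φ i)) (g : Lp ℂ 2 μ)
    -- The eigenvalue identity is a closed condition on the pair (g, ∂g), so it suffices to check it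
    -- on C.
    have hcl : IsClosed {p : Lp ℂ 2 μ × E.OneForms |
        inner ℂ (ω i) p.2 = ev i * inner ℂ (ofRealLp μ (φ i)) p.1} :=
      isClosed_eq (by fun_prop) (by fun_prop)
    refine closure_minimal (fun p hp => ?_) hcl (gradient_mem hreg hkill g)
    obtain ⟨b, rfl⟩ := (mem_gradientGraph_iff hreg hkill).1 hp
    change inner ℂ (ω i) (grad hreg hkill b) = ev i * inner ℂ (ofRealLp μ (φ i)) (E.coreLp b)
    rw [hω', hform, hform, coreLp_eq, inner_add_right, inner_smul_right, inner_ofRealLp,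
      inner_ofRealLp]
    push_cast
    ring

end Spectrum

end DirichletForm

/-! ### A star subalgebra inside its closure. -/

namespace NonUnitalStarSubalgebra

variable {A : Type*} [NonUnitalRing A] [StarRing A] [Module ℂ A] [TopologicalSpace A]
  [IsTopologicalRing A] [ContinuousStar A] [ContinuousConstSMul ℂ A]
  [IsScalarTower ℂ A A] [SMulCommClass ℂ A A]

/-- A star subalgebra as a subalgebra of its closure. -/
def inClosure (S : NonUnitalStarSubalgebra ℂ A) :
    NonUnitalStarSubalgebra ℂ S.topologicalClosure :=
  S.comap (NonUnitalStarSubalgebraClass.subtype S.topologicalClosure)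

lemma dense_inClosure (S : NonUnitalStarSubalgebra ℂ A) :
    Dense (S.inClosure : Set S.topologicalClosure) := by
  intro x
  rw [closure_subtype]
  have hx : (x : A) ∈ closure (S : Set A) := x.2
  refine closure_mono ?_ hx
  intro s hs
  exact ⟨⟨s, S.le_topologicalClosure hs⟩, hs, rfl⟩

end NonUnitalStarSubalgebra

/-! ### The spectral triple. -/

theorem mainTheorem3 {X : Type*} [MetricSpace X] [LocallyCompactSpace X]
    [TopologicalSpace.SeparableSpace X] [MeasurableSpace X] [BorelSpace X]
    (μ : Measure X) [μ.Regular] [μ.IsOpenPosMeasure] (E : DirichletForm μ)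
    (hreg : E.IsRegular) (hkill : E.NoKilling) (hdom : E.IsEnergyDominant) :
    (E.gradient.domain : Set (Lp ℂ 2 μ)) = E.complexDomain ∧
    ∃ A₀ : NonUnitalStarSubalgebra ℂ C₀(X, ℂ), (A₀ : Set C₀(X, ℂ)) = E.boundedEnergy ∧
    ∃ π : A₀.topologicalClosure →⋆ₙₐ[ℂ] (E.Spinors →L[ℂ] E.Spinors),
      Function.Injective π ∧
      (∀ (a : A₀.topologicalClosure) (v : E.Spinors),
        (π a v).fst =ᵐ[μ] fun x => (a : C₀(X, ℂ)) x * v.fst x) ∧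
      (∀ (a : E.core) (ha : (a : C₀(X, ℂ)) ∈ A₀) (f : Lp ℂ 2 μ) (c d : E.core),
        (π ⟨a, A₀.le_topologicalClosure ha⟩ (WithLp.toLp 2 (f, E.tensor c d))).snd
          = E.tensor (a * c) d - E.tensor a (c * d)) ∧
      (∀ (a : E.core) (ha : (a : C₀(X, ℂ)) ∈ A₀), ∃ T : E.Spinors →L[ℂ] E.Spinors,
        IsCommutator E.dirac (π ⟨a, A₀.le_topologicalClosure ha⟩) T ∧
        ENNReal.ofReal (‖T‖ ^ 2) ≤ E.gammaSup a) ∧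
      (E.HasDiscreteSpectrum →
        HasCompactResolventOn E.dirac (kernel E.dirac)ᗮ ∧ IsSpectralTriple E.dirac π) := by
  -- With local compactness this gives σ-compactness, needed for the exhaustion behind the cutoff
  -- sequence.
  have : SecondCountableTopology X := UniformSpace.secondCountable_of_separable X
  set A₀ := E.boundedSubalgebra hreg hkill hdom with hA₀
  have hle : A₀ ≤ E.core := fun a ha => ha.1
  -- Only the action on 1-forms needs extension by continuity; on L² all of `C₀(X)` acts by
  -- multiplication.
  obtain ⟨σ, hσ⟩ := NonUnitalStarAlgHom.exists_extension_closure A₀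
    ((DirichletForm.leftRep hreg hkill).comp (NonUnitalStarSubalgebra.inclusion hle))
    fun s => DirichletForm.norm_leftRep_le hreg hkill ⟨s, hle s.2⟩
  set π := NonUnitalStarAlgHom.diag ((ZeroAtInftyContinuousMap.mulRep μ).comp
    (NonUnitalStarSubalgebraClass.subtype A₀.topologicalClosure)) σ with hπ
  have hinj : Function.Injective π := by
    intro a b hab
    refine Subtype.ext (ZeroAtInftyContinuousMap.mulRep_injective (μ := μ)
      (ContinuousLinearMap.ext fun f => ?_))
    -- The L² component alone separates functions, because μ charges every nonempty open set.
    have h1 := congrArg (fun T => (T (WithLp.toLp 2 (f, (0 : E.OneForms)))).fst) hab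
    exact h1
  have hπa : ∀ (a : E.core) (ha : (a : C₀(X, ℂ)) ∈ A₀), π ⟨a, A₀.le_topologicalClosure ha⟩
      = ContinuousLinearMap.diagL (ZeroAtInftyContinuousMap.mulRep μ (a : C₀(X, ℂ)))
        (DirichletForm.leftRep hreg hkill a) := by
    intro a ha
    change ContinuousLinearMap.diagL (ZeroAtInftyContinuousMap.mulRep μ (a : C₀(X, ℂ)))
      (σ ⟨a, A₀.le_topologicalClosure ha⟩) = _
    rw [hσ ⟨a, ha⟩]
    rfl
  have hcomm : ∀ (a : E.core) (ha : (a : C₀(X, ℂ)) ∈ A₀), ∃ T : E.Spinors →L[ℂ] E.Spinors,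
      IsCommutator E.dirac (π ⟨a, A₀.le_topologicalClosure ha⟩) T ∧
      ENNReal.ofReal (‖T‖ ^ 2) ≤ E.gammaSup a := by
    intro a ha
    rw [hπa a ha]
    exact DirichletForm.exists_isCommutator hreg hkill hdom ha.2
  refine ⟨DirichletForm.gradient_domain hreg hkill, A₀, rfl, π, hinj,
    fun a v => ZeroAtInftyContinuousMap.mulRep_coeFn (a : C₀(X, ℂ)) v.fst,
    fun a ha f c d => ?_, hcomm, fun hL => ?_⟩
  · rw [hπa a ha, ← DirichletForm.leftRep_tensor hreg hkill]
    rfl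
  · have hcpt := DirichletForm.hasCompactResolventOn_dirac hreg hkill hL
    refine ⟨hcpt, ?_, hinj, ⟨A₀.inClosure, A₀.dense_inClosure, fun a ha => ?_⟩, hcpt⟩
    · exact LinearPMap.isSelfAdjoint_offDiag (DirichletForm.isClosed_gradient hreg hkill)
        (DirichletForm.dense_gradient_domain hreg hkill)
    · obtain ⟨T, hT, -⟩ := hcomm ⟨a, hle ha⟩ ha
      exact ⟨T, hT⟩
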